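/- **Setting.** Let $T>0$, $\nu>0$, let $p\ge 1$ be an odd integer, let $f\in C^4(\mathbb R)$ have bounded derivatives $f^{(k)}$, $0\le k\le 4$, and let $u\in C^2(\mathbb R)$ have bounded derivatives $u^{(k)}$, $0\le k\le 2$. Let $c$ be a bounded classical solution of $$c_t+u(x)c_x-\nu c_{xx}=f(c)\ \text{ on } \mathbb R\times(0,T],\qquad c(x,0)=c_0(x),$$ which is regular in the following sense: the derivatives $\partial_t^a\partial_x^b c$ with $2a+b\le 7$, or with $a=0$ and $b\le p+1$, exist (in any order of differentiation) and are continuous on $\mathbb R\times[0,T]$, and, for $(a,b)\ne(0,0)$, they are bounded in $L^2(\mathbb R)$ uniformly in $t\in[0,T]$. **Scheme.** For $\Delta t,\Delta x>0$ put $x_i=i\Delta x$ ($i\in\mathbb Z$), $t_n=n\Delta t$. For a grid function $v=(v_i)_{i\in\mathbb Z}$ let $I_p[v]$ be one of the following (the same choice throughout): * the symmetric piecewise Lagrange interpolant of degree $p$: on $[x_j,x_{j+1})$ it is the polynomial of degree at most $p$ that takes the values $v_k$ at the $p+1$ nodes $x_k$, $j-\frac{p-1}2\le k\le j+\frac{p+1}2$;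 * the spline interpolant of degree $p$ (for bounded $v$): the bounded function of class $C^{p-1}$ that is a polynomial of degree at most $p$ on each $[x_j,x_{j+1}]$ and takes the value $v_j$ at $x_j$ for all $j$. Let $z_+(x),z_-(x),z_0(x)$ be solutions of $$z_\pm(x)=x-\tfrac{\Delta t}2\,[u(x)+u(z_\pm(x))]\pm\sqrt{6\Delta t\,\nu},\qquad z_0(x)=x-\tfrac{\Delta t}2\,[u(x)+u(z_0(x))],$$ and let $\alpha_\pm=\frac16$, $\alpha_0=\frac23$. The scheme SL2 is $c_i^0=c_0(x_i)$ and, for $i\in\mathbb Z$, $n\ge 0$, $$c_i^{n+1}=\sum_{k\in\{+,-,0\}}\alpha_k\Big[I_p[c^n](z_k(x_i))+\tfrac{\Delta t}2 f\big(I_p[c^n](z_k(x_i))\big)\Big]+\tfrac{\Delta t}2 f(c_i^{n+1}).$$ Write $\|e\|_2=\big(\Delta x\sum_{i\in\mathbb Z}|e_i|^2\big)^{1/2}$ for grid functions $e$, and $c(t_n)=(c(x_i,t_n))_{i\in\mathbb Z}$. **Theorem.** There are constants $K_T>0$ and $\delta>0$, which do not depend on $\Delta t,\Delta x,n$, such that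 for all $0<\Delta t<\delta$ and $0<\Delta x<\delta$ the scheme has exactly one solution $(c^n)_{n\ge0}$, and for every $n\ge0$ with $t_n\in[0,T]$ the error $c(t_n)-c^n$ is square summable with $$\|c(t_n)-c^n\|_2\le K_T\Big(\Delta t^2+\frac{\Delta x^p}{\Delta t}\Big).$$ -/

import Mathlib

open Polynomial MeasureTheory

noncomputable section

namespace SL2

/-- The two families of interpolation operators: symmetric Lagrange and spline interpolation. -/
inductive InterpKind where
  | lagrange
  | spline

/-- Symmetric piecewise Lagrange interpolation of odd degree `p` on the grid `x_j = j Δx`, `j ∈ ℤ`: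
on the cell `[x_j, x_{j+1})` it is the polynomial of degree at most `p` through the `p + 1` nodes
`x_{j - (p-1)/2}, …, x_{j + (p+1)/2}`, which are placed symmetrically about the cell. -/
def lagrangeInterp (p : ℕ) (Δx : ℝ) (v : ℤ → ℝ) (x : ℝ) : ℝ :=
  (Lagrange.interpolate
    (Finset.Icc (⌊x / Δx⌋ - ((p / 2 : ℕ) : ℤ)) (⌊x / Δx⌋ + ((p / 2 : ℕ) : ℤ) + 1))
    (fun k : ℤ => (k : ℝ) * Δx) v).eval x

/-- `s` is a cardinal spline of degree `p` with knots at the grid nodes `j Δx`, `j ∈ ℤ`: it is of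
class `C^{p-1}` and on every cell it is a polynomial of degree at most `p`. -/
def IsCardinalSpline (p : ℕ) (Δx : ℝ) (s : ℝ → ℝ) : Prop :=
  ContDiff ℝ ((p - 1 : ℕ) : WithTop ℕ∞) s ∧
    ∀ j : ℤ, ∃ P : ℝ[X], P.natDegree ≤ p ∧
      ∀ x ∈ Set.Icc ((j : ℝ) * Δx) (((j : ℝ) + 1) * Δx), s x = P.eval x

/-- `IsInterpolant κ p Δx v s`: the function `s` is the interpolant `I_p[v]` of the grid function
`v`. In the spline case it is the bounded cardinal spline through the values of `v`. -/
def IsInterpolant (κ : InterpKind) (p : ℕ) (Δx : ℝ) (v : ℤ → ℝ) (s : ℝ → ℝ) : Prop :=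
  match κ with
  | .lagrange => ∀ x, s x = lagrangeInterp p Δx v x
  | .spline => IsCardinalSpline p Δx s ∧ (∃ C, ∀ x, |s x| ≤ C) ∧
      ∀ j : ℤ, s ((j : ℝ) * Δx) = v j

/-- `z` is a foot of the discrete characteristic through `x`, with random increment `e`
(`e = 1, -1, 0` for `z_+`, `z_-`, `z_0`). -/
def IsFoot (u : ℝ → ℝ) (ν Δt e x z : ℝ) : Prop :=
  z = x - Δt / 2 * (u x + u z) + e * Real.sqrt (6 * Δt * ν)

/-- One step `v = c^n ↦ w = c^{n+1}` of the fully discrete scheme. -/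
def IsStep (κ : InterpKind) (p : ℕ) (u f : ℝ → ℝ) (ν Δt Δx : ℝ) (v w : ℤ → ℝ) : Prop :=
  ∃ s : ℝ → ℝ, IsInterpolant κ p Δx v s ∧
    ∀ i : ℤ, ∃ zp zm z0 : ℝ,
      IsFoot u ν Δt 1 ((i : ℝ) * Δx) zp ∧
      IsFoot u ν Δt (-1) ((i : ℝ) * Δx) zm ∧
      IsFoot u ν Δt 0 ((i : ℝ) * Δx) z0 ∧
      w i = 1 / 6 * (s zp + Δt / 2 * f (s zp)) + 1 / 6 * (s zm + Δt / 2 * f (s zm))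
        + 2 / 3 * (s z0 + Δt / 2 * f (s z0)) + Δt / 2 * f (w i)

/-- `U n i = c_i^n` is a solution of the scheme with initial values `c_0(x_i)`. -/
def IsSchemeSolution (κ : InterpKind) (p : ℕ) (u f c₀ : ℝ → ℝ) (ν Δt Δx : ℝ)
    (U : ℕ → ℤ → ℝ) : Prop :=
  (∀ i : ℤ, U 0 i = c₀ ((i : ℝ) * Δx)) ∧ ∀ n : ℕ, IsStep κ p u f ν Δt Δx (U n) (U (n + 1))

/-- `g` is of class `C^m` on `ℝ` and its derivatives up to order `m` are bounded. -/
def BoundedDerivs (m : ℕ) (g : ℝ → ℝ) : Prop :=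
  ContDiff ℝ (m : WithTop ℕ∞) g ∧ ∃ K : ℝ, ∀ k ≤ m, ∀ x, |iteratedDeriv k g x| ≤ K

/-- The orders `(a, b)` of the derivatives `∂_t^a ∂_x^b c` that enter the analysis: parabolic order
at most `7`, and pure space derivatives up to order `p + 1`. -/
def RegOrder (p a b : ℕ) : Prop :=
  2 * a + b ≤ 7 ∨ (a = 0 ∧ b ≤ p + 1)

/-- `c x t` is a classical solution of `c_t + u c_x - ν c_xx = f(c)` on `ℝ × (0, T]` with
`c(x, 0) = c₀ x`, it is bounded, and it is regular up to `t = 0`: the partial derivatives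
`D a b = ∂_t^a ∂_x^b c` with `RegOrder p a b` exist (one-sided in time at `t = 0` and `t = T`),
do not depend on the order of differentiation, are continuous on `ℝ × [0, T]`, and, except possibly
for `c` itself, are square integrable in space uniformly in time. -/
def IsRegularSolution (p : ℕ) (u f c₀ : ℝ → ℝ) (ν T : ℝ) (c : ℝ → ℝ → ℝ) : Prop :=
  ∃ (D : ℕ → ℕ → ℝ → ℝ → ℝ) (M : ℝ),
    (∀ x, ∀ t ∈ Set.Icc 0 T, D 0 0 x t = c x t) ∧
    (∀ a b, RegOrder p a (b + 1) → ∀ x, ∀ t ∈ Set.Icc 0 T,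
      HasDerivAt (fun y => D a b y t) (D a (b + 1) x t) x) ∧
    (∀ a b, RegOrder p (a + 1) b → ∀ x, ∀ t ∈ Set.Icc 0 T,
      HasDerivWithinAt (fun s => D a b x s) (D (a + 1) b x t) (Set.Icc 0 T) t) ∧
    (∀ a b, RegOrder p a b →
      ContinuousOn (fun q : ℝ × ℝ => D a b q.1 q.2) (Set.univ ×ˢ Set.Icc 0 T)) ∧
    (∀ x, ∀ t ∈ Set.Icc 0 T, |c x t| ≤ M) ∧
    (∀ a b, RegOrder p a b → (a, b) ≠ (0, 0) → ∀ t ∈ Set.Icc 0 T,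
      Integrable (fun x => D a b x t ^ 2) ∧ ∫ x, D a b x t ^ 2 ≤ M) ∧
    (∀ x, ∀ t ∈ Set.Ioc 0 T, D 1 0 x t + u x * D 0 1 x t - ν * D 0 2 x t = f (c x t)) ∧
    (∀ x, c x 0 = c₀ x)

/-- The discrete 2-norm `(Δx ∑_i |e_i|²)^{1/2}` of a grid function (used together with the
summability of the series). -/
def discreteNorm (Δx : ℝ) (e : ℤ → ℝ) : ℝ :=
  Real.sqrt (Δx * ∑' i : ℤ, e i ^ 2)

end SL2

end

open Polynomial MeasureTheory

noncomputable section

namespace SL2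

/-! Both interpolation operators have the form `∑ v_j ψ(x / Δx - j)` with a rapidly decaying kernel
`ψ` that is cardinal, reproduces polynomials of degree `p` and, decisively, is a positive definite
function (`exists_kernel`).

Positive definiteness gives `ℓ²` stability with a constant `1 + O(Δt)` even for variable velocity
(`IsKernel.stability`). Let `y_i` be the feet of the characteristics in units of `Δx`. The Gram
matrix of `ψ` at the points `y_i` and at the integers has the blocks `G = (ψ(y_i - y_k))`, `Ψ =
(ψ(y_i - j))` and, by cardinality, the identity. Its positivity means `Ψ Ψᵀ ≤ G`. The differences
`y_i - y_k` deviate from `i - k` by `O(Δt |i - k|)` and `ψ` vanishes at the nonzero integers, so row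
sums give `G ≤ 1 + O(Δt)`.

Positive definiteness itself comes from B-splines of odd degree. The hat function is an
autocorrelation; raising the degree by two is averaging against the hat, a limit of averages over
clusters of points; and minus a second difference is again such a cluster sum. The Lagrange kernel
is a nonnegative combination of signed differences of B-splines, because `∏ (X - l²)` has
coefficients of alternating sign. The spline kernel is an integral over `θ` of positive definite
periodizations of a B-spline, divided by the collocation symbol, which is shown to be positive by
induction on the degree.

For consistency, the characteristics and the reaction are treated by the trapezoidal rule, and the
weights `1/6, 2/3, 1/6` at `0, ±√(6 Δt ν)` match the moments of the Gaussian of variance `2 ν Δt`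
through order five. All terms up to second order cancel, and the local error is `O(Δt³)` with local
Sobolev norms as coefficients (`truncation_le`), which can be summed over the grid
(`sum_sq_le_of_jetBound`). Interpolating the exact solution costs `O(Δx^p)` in `ℓ²`
(`IsKernel.interp_error`).

Altogether the squared error satisfies `E_{n+1} ≤ exp(B Δt) E_n + (C / Δt) (Δx^{2p} + Δt⁶)`, where
`1 / Δt` is the price of Young's inequality for the leading factor (`error_recursion`). Over at most
`T / Δt` steps this accumulates to `Δx^{2p} / Δt² + Δt⁴`, the square of the asserted rate
(`discreteNorm_le_of_recursion`). -/

/-- Taylor's formula along a chain of derivatives, where the last one stays close to `r`. -/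
lemma taylor_bound {s : Set ℝ} (hs : Convex ℝ s) {a : ℝ} (ha : a ∈ s) {r K : ℝ} :
    ∀ (n : ℕ) (φ : ℕ → ℝ → ℝ),
      (∀ k < n, ∀ y ∈ s, HasDerivWithinAt (φ k) (φ (k + 1) y) s y) →
      (∀ y ∈ s, |φ n y - r| ≤ K) → ∀ y ∈ s,
      |φ 0 y - ∑ k ∈ Finset.range n, φ k a * (y - a) ^ k / (k.factorial : ℝ)
        - r * (y - a) ^ n / (n.factorial : ℝ)| ≤ K * |y - a| ^ n := by
  intro n
  induction n with
  | zero => intro φ _ h y hy; simpa using h y hy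
  | succ n ih =>
    intro φ hd hK y hy
    have ih' := ih (fun k => φ (k + 1)) (fun k hk y hy => hd (k + 1) (by omega) y hy) hK
    have hK0 : 0 ≤ K := (abs_nonneg _).trans (hK a ha)
    have hsub : Set.uIcc a y ⊆ s := by
      rw [← segment_eq_uIcc]; exact hs.segment_subset ha hy
    have hder : ∀ z ∈ Set.uIcc a y, HasDerivWithinAt
        (fun z => φ 0 z - ∑ k ∈ Finset.range (n + 1), φ k a * (z - a) ^ k / (k.factorial : ℝ)
          - r * (z - a) ^ (n + 1) / ((n + 1).factorial : ℝ))
        (φ 1 z - ∑ k ∈ Finset.range n, φ (k + 1) a * (z - a) ^ k / (k.factorial : ℝ)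
          - r * (z - a) ^ n / (n.factorial : ℝ)) (Set.uIcc a y) z := by
      intro z hz
      have hp : ∀ (k : ℕ) (c : ℝ), HasDerivWithinAt
          (fun z : ℝ => c * (z - a) ^ (k + 1) / ((k + 1).factorial : ℝ))
          (c * (z - a) ^ k / (k.factorial : ℝ)) (Set.uIcc a y) z := by
        intro k c
        have h := (((((hasDerivAt_id z).sub_const a).pow (k + 1)).const_mul c).div_const
          ((k + 1).factorial : ℝ)).hasDerivWithinAt (s := Set.uIcc a y)
        refine h.congr_deriv ?_
        rw [Nat.factorial_succ]; push_cast
        have : (k.factorial : ℝ) ≠ 0 := by positivity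
        simp; field_simp
      refine HasDerivWithinAt.sub (HasDerivWithinAt.sub ((hd 0 (by omega) z (hsub hz)).mono hsub) ?_)
        (hp n r)
      simp_rw [Finset.sum_range_succ']
      have : HasDerivWithinAt (fun z : ℝ => ∑ k ∈ Finset.range n,
          φ (k + 1) a * (z - a) ^ (k + 1) / ((k + 1).factorial : ℝ))
          (∑ k ∈ Finset.range n, φ (k + 1) a * (z - a) ^ k / (k.factorial : ℝ))
          (Set.uIcc a y) z := HasDerivWithinAt.fun_sum fun k _ => hp k _
      simpa using this.add_const (φ 0 a)
    have hb : ∀ z ∈ Set.uIcc a y, ‖φ 1 z - ∑ k ∈ Finset.range n,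
        φ (k + 1) a * (z - a) ^ k / (k.factorial : ℝ)
          - r * (z - a) ^ n / (n.factorial : ℝ)‖ ≤ K * |y - a| ^ n := by
      intro z hz
      refine (ih' z (hsub hz)).trans ?_
      exact mul_le_mul_of_nonneg_left
        (pow_le_pow_left₀ (abs_nonneg _) (Set.abs_sub_left_of_mem_uIcc hz) n) hK0
    -- The mean value inequality on the segment from `a` to `y` supplies the last factor `|y - a|`.
    -- The gain of a factorial is given up, so the same `K` serves at every order.
    have := (convex_uIcc a y).norm_image_sub_le_of_norm_hasDerivWithin_le hder hb
      Set.left_mem_uIcc Set.right_mem_uIcc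
    have h0 : φ 0 a - ∑ k ∈ Finset.range (n + 1), φ k a * (a - a) ^ k / (k.factorial : ℝ)
          - r * (a - a) ^ (n + 1) / ((n + 1).factorial : ℝ) = 0 := by
      rw [Finset.sum_range_succ']; simp
    rw [h0, sub_zero, Real.norm_eq_abs, Real.norm_eq_abs] at this
    rw [pow_succ |y - a|, ← mul_assoc]; exact this

/-! ### Central second differences -/

/-- The central second difference with step `1`. -/
def sd (g : ℝ → ℝ) (x : ℝ) : ℝ := g (x + 1) - 2 * g x + g (x - 1)

lemma sd_eq_fwdDiff (g : ℝ → ℝ) (x : ℝ) : sd g x = (fwdDiff (1 : ℝ))^[2] g (x - 1) := by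
  simp [sd, fwdDiff]; ring

lemma sd_iterate_eq_fwdDiff (m : ℕ) (g : ℝ → ℝ) (x : ℝ) :
    sd^[m] g x = (fwdDiff (1 : ℝ))^[2 * m] g (x - m) := by
  induction m generalizing x with
  | zero => simp
  | succ m ih =>
    have : sd^[m] g = fun x => (fwdDiff (1 : ℝ))^[2 * m] g (x - m) := funext ih
    rw [Function.iterate_succ_apply', sd_eq_fwdDiff, this, show 2 * (m + 1) = 2 + 2 * m by ring,
      Function.iterate_add_apply]
    simp only [Function.iterate_succ, Function.iterate_zero, Function.comp, id]
    simp only [fwdDiff]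
    push_cast
    ring_nf

/-- Coefficients of the iterated second difference. -/
def sdCoeff (m k : ℕ) : ℝ := (-1) ^ (2 * m - k) * ((2 * m).choose k : ℝ)

lemma sd_iterate_eq_sum (m : ℕ) (g : ℝ → ℝ) (x : ℝ) :
    sd^[m] g x = ∑ k ∈ Finset.range (2 * m + 1), sdCoeff m k * g (x + ((k : ℤ) - m : ℤ)) := by
  rw [sd_iterate_eq_fwdDiff, fwdDiff_iter_eq_sum_shift]
  refine Finset.sum_congr rfl fun k _ => ?_
  simp [sdCoeff]
  left; congr 1; ring

lemma sd_iterate_congr (m : ℕ) {g g' : ℝ → ℝ} {x : ℝ}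
    (h : ∀ j : ℤ, -(m : ℤ) ≤ j → j ≤ m → g (x + j) = g' (x + j)) : sd^[m] g x = sd^[m] g' x := by
  simp_rw [sd_iterate_eq_sum]
  refine Finset.sum_congr rfl fun k hk => ?_
  rw [Finset.mem_range] at hk
  rw [h _ (by omega) (by omega)]

lemma sd_iterate_poly (m : ℕ) (P : ℝ[X]) (hP : P.natDegree < 2 * m) (x : ℝ) :
    sd^[m] (fun x => P.eval x) x = 0 := by
  rw [sd_iterate_eq_fwdDiff]
  exact congrFun (Polynomial.fwdDiff_iter_eq_zero_of_degree_lt hP) _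

lemma sd_iterate_top (m : ℕ) {g : ℝ → ℝ} {x : ℝ}
    (h : ∀ j : ℤ, j < m → g (x + j) = 0) : sd^[m] g x = g (x + m) := by
  rw [sd_iterate_eq_sum, Finset.sum_range_succ, Finset.sum_eq_zero]
  · simp [sdCoeff]; congr 1; ring
  · intro k hk
    rw [Finset.mem_range] at hk
    rw [h _ (by omega), mul_zero]

lemma sd_iterate_sum {ι : Type*} (m : ℕ) (S : Finset ι) (c : ι → ℝ) (g : ι → ℝ → ℝ) (x : ℝ) :
    sd^[m] (fun x => ∑ i ∈ S, c i * g i x) x = ∑ i ∈ S, c i * sd^[m] (g i) x := by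
  simp_rw [sd_iterate_eq_sum, Finset.mul_sum]
  rw [Finset.sum_comm]
  refine Finset.sum_congr rfl fun i _ => Finset.sum_congr rfl fun k _ => by ring

lemma sd_iterate_shift (m : ℕ) (g : ℝ → ℝ) (a x : ℝ) :
    sd^[m] (fun x => g (x - a)) x = sd^[m] g (x - a) := by
  simp_rw [sd_iterate_eq_sum]
  refine Finset.sum_congr rfl fun k _ => ?_
  congr 2; ring

lemma sd_iterate_hasDerivAt (m : ℕ) {g g' : ℝ → ℝ} (h : ∀ x, HasDerivAt g (g' x) x) (x : ℝ) :
    HasDerivAt (sd^[m] g) (sd^[m] g' x) x := by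
  have : sd^[m] g = fun x => ∑ k ∈ Finset.range (2 * m + 1),
      sdCoeff m k * g (x + ((k : ℤ) - m : ℤ)) := funext (sd_iterate_eq_sum m g)
  rw [this, sd_iterate_eq_sum]
  refine HasDerivAt.fun_sum fun k _ => HasDerivAt.const_mul _ ?_
  exact (h _).comp_add_const _ _

/-! ### Positive definite functions and averages against the hat -/

/-- Positive definite real functions on the line. -/
def PosDefFun (φ : ℝ → ℝ) : Prop :=
  ∀ (ι : Type) (S : Finset ι) (a w : ι → ℝ), 0 ≤ ∑ i ∈ S, ∑ j ∈ S, w i * w j * φ (a i - a j)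

lemma PosDefFun.sum {κ : Type*} {S : Finset κ} {c : κ → ℝ} {φ : κ → ℝ → ℝ}
    (hc : ∀ k ∈ S, 0 ≤ c k) (h : ∀ k ∈ S, PosDefFun (φ k)) :
    PosDefFun (fun x => ∑ k ∈ S, c k * φ k x) := by
  intro ι T a w
  have : ∑ i ∈ T, ∑ j ∈ T, w i * w j * ∑ k ∈ S, c k * φ k (a i - a j)
      = ∑ k ∈ S, c k * ∑ i ∈ T, ∑ j ∈ T, w i * w j * φ k (a i - a j) := by
    simp_rw [Finset.mul_sum]
    rw [Finset.sum_comm (s := S)]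
    refine Finset.sum_congr rfl fun i _ => ?_
    rw [Finset.sum_comm (s := S)]
    refine Finset.sum_congr rfl fun j _ => Finset.sum_congr rfl fun k _ => by ring
  rw [this]
  exact Finset.sum_nonneg fun k hk => mul_nonneg (hc k hk) (h k hk ι T a w)

lemma PosDefFun.of_tendsto {φ : ℝ → ℝ} {Φ : ℕ → ℝ → ℝ} (h : ∀ n, PosDefFun (Φ n))
    (hl : ∀ x, Filter.Tendsto (fun n => Φ n x) Filter.atTop (nhds (φ x))) : PosDefFun φ := by
  intro ι T a w
  refine ge_of_tendsto' (tendsto_finsetSum T fun i _ => tendsto_finsetSum T fun j _ =>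
    (hl (a i - a j)).const_mul (w i * w j)) fun n => h n ι T a w

/-- Replacing every point by a weighted cluster of points. -/
lemma PosDefFun.cluster {φ : ℝ → ℝ} (h : PosDefFun φ) {κ : Type} (S : Finset κ) (b v : κ → ℝ) :
    PosDefFun (fun x => ∑ k ∈ S, ∑ l ∈ S, v k * v l * φ (x + (b k - b l))) := by
  intro ι T a w
  have := h (ι × κ) (T ×ˢ S) (fun q => a q.1 + b q.2) (fun q => w q.1 * v q.2)
  convert this using 1
  simp_rw [Finset.sum_product, Finset.mul_sum]
  refine Finset.sum_congr rfl fun i _ => ?_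
  rw [Finset.sum_comm]
  refine Finset.sum_congr rfl fun k _ => Finset.sum_congr rfl fun j _ =>
    Finset.sum_congr rfl fun l _ => ?_
  rw [show a i - a j + (b k - b l) = a i + b k - (a j + b l) by ring]; ring

/-- Two points at distance one with weights `1, -1` form a cluster whose autocorrelation is minus
the second difference. -/
lemma PosDefFun.neg_sd {φ : ℝ → ℝ} (h : PosDefFun φ) : PosDefFun (fun x => -sd φ x) := by
  have := h.cluster (Finset.univ : Finset (Fin 2)) (fun k => (k : ℕ)) (fun k => (-1) ^ (k : ℕ))
  convert this using 2 with x
  simp [Fin.sum_univ_two, sd]; ring_nf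

lemma PosDefFun.nonneg_zero {φ : ℝ → ℝ} (h : PosDefFun φ) : 0 ≤ φ 0 := by
  simpa using h Unit Finset.univ 0 1

/-- The quadratic form at the two points `x, 0` with weights `(1, 1)` and `(1, -1)` gives the two
bounds. -/
lemma PosDefFun.abs_le {φ : ℝ → ℝ} (h : PosDefFun φ) (he : ∀ x, φ (-x) = φ x) (x : ℝ) :
    |φ x| ≤ φ 0 := by
  have h1 := h (Fin 2) Finset.univ ![x, 0] ![1, 1]
  have h2 := h (Fin 2) Finset.univ ![x, 0] ![1, -1]
  simp [Fin.sum_univ_two, he] at h1 h2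
  rw [_root_.abs_le]; constructor <;> linarith

/-- The average of `φ` against the discrete hat weights of step `1 / L`. -/
def hatAvg (L : ℕ) (φ : ℝ → ℝ) (x : ℝ) : ℝ :=
  ∑ l ∈ Finset.range L, ∑ l' ∈ Finset.range L,
    ((L : ℝ)⁻¹ * (L : ℝ)⁻¹) * φ (x + ((l : ℝ) / L - (l' : ℝ) / L))

lemma PosDefFun.hatAvg {φ : ℝ → ℝ} (h : PosDefFun φ) (L : ℕ) : PosDefFun (hatAvg L φ) :=
  h.cluster (Finset.range L) (fun l => (l : ℝ) / L) (fun _ => (L : ℝ)⁻¹)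

/-- A difference of step one telescopes into `L` differences of step `1 / L`. Doing this for the
forward and the backward difference produces exactly the cluster of shifts used in `hatAvg`. -/
lemma sd_eq_sum_step (g : ℝ → ℝ) {L : ℕ} (hL : L ≠ 0) (x : ℝ) :
    sd g x = ∑ l ∈ Finset.range L, ∑ l' ∈ Finset.range L,
      (g (x + ((l : ℝ) / L - (l' : ℝ) / L) + (L : ℝ)⁻¹) - 2 * g (x + ((l : ℝ) / L - (l' : ℝ) / L))
        + g (x + ((l : ℝ) / L - (l' : ℝ) / L) - (L : ℝ)⁻¹)) := by
  have hL' : (L : ℝ) ≠ 0 := by exact_mod_cast hL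
  have h1 : ∀ l : ℕ, ∑ l' ∈ Finset.range L,
      (g (x + ((l : ℝ) / L - (l' : ℝ) / L) + (L : ℝ)⁻¹) - 2 * g (x + ((l : ℝ) / L - (l' : ℝ) / L))
        + g (x + ((l : ℝ) / L - (l' : ℝ) / L) - (L : ℝ)⁻¹))
      = (g (x + ((l + 1 : ℕ) : ℝ) / L) - g (x + (l : ℝ) / L))
        - (g (x - 1 + ((l + 1 : ℕ) : ℝ) / L) - g (x - 1 + (l : ℝ) / L)) := by
    intro l
    have := Finset.sum_range_sub' (fun l' : ℕ => g (x + ((l : ℝ) / L - (l' : ℝ) / L) + (L : ℝ)⁻¹)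
      - g (x + ((l : ℝ) / L - (l' : ℝ) / L))) L
    have e0 : x + ((l : ℝ) / L - ((0 : ℕ) : ℝ) / L) = x + l / L := by simp
    have e1 : x + ((l : ℝ) / L - (L : ℝ) / L) = x - 1 + l / L := by field_simp; ring
    rw [e0, e1] at this
    have e2 : ∀ y : ℝ, y + (l : ℝ) / L + (L : ℝ)⁻¹ = y + ((l + 1 : ℕ) : ℝ) / L := by
      intro y; push_cast; field_simp; ring
    rw [e2, e2] at this
    rw [← this]
    refine Finset.sum_congr rfl fun l' _ => ?_
    have e3 : x + ((l : ℝ) / L - ((l' + 1 : ℕ) : ℝ) / L) + (L : ℝ)⁻¹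
        = x + ((l : ℝ) / L - (l' : ℝ) / L) := by push_cast; field_simp; ring
    have e4 : x + ((l : ℝ) / L - ((l' + 1 : ℕ) : ℝ) / L)
        = x + ((l : ℝ) / L - (l' : ℝ) / L) - (L : ℝ)⁻¹ := by push_cast; field_simp; ring
    rw [e3, e4]; ring
  simp_rw [h1]
  rw [Finset.sum_sub_distrib, Finset.sum_range_sub (fun l : ℕ => g (x + (l : ℝ) / L)),
    Finset.sum_range_sub (fun l : ℕ => g (x - 1 + (l : ℝ) / L))]
  simp [sd, div_self hL']; ring

/-- By Taylor's formula each second difference of step `1 / L` of `g` is `φ / L²` up to `2 / L³`;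
there are `L²` of them. Thus convolution with the hat is reached as a limit of finite averages, and
no convolution integral is needed. -/
lemma hatAvg_tendsto {g g' φ : ℝ → ℝ} (h1 : ∀ x, HasDerivAt g (g' x) x)
    (h2 : ∀ x, HasDerivAt g' (φ x) x) (hL : ∀ x y, |φ x - φ y| ≤ |x - y|) (x : ℝ) :
    Filter.Tendsto (fun L => hatAvg L φ x) Filter.atTop (nhds (sd g x)) := by
  have key : ∀ η > 0, ∀ y, |η * η * φ y - (g (y + η) - 2 * g y + g (y - η))| ≤ 2 * η ^ 3 := by
    intro η hη y
    have ht := taylor_bound (convex_Icc (y - η) (y + η)) (a := y) (r := φ y) (K := η)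
      ⟨by linarith, by linarith⟩ 2
      (fun k => match k with | 0 => g | 1 => g' | _ => φ)
      (by
        intro k hk z _
        interval_cases k
        · exact (h1 z).hasDerivWithinAt
        · exact (h2 z).hasDerivWithinAt)
      (by
        intro z hz
        refine (hL z y).trans ?_
        rw [abs_le]; constructor <;> linarith [hz.1, hz.2])
    have a1 := ht (y + η) ⟨by linarith, by linarith⟩
    have a2 := ht (y - η) ⟨by linarith, by linarith⟩
    simp [Finset.sum_range_succ, abs_of_pos hη] at a1 a2
    rw [abs_le] at *
    constructor <;> nlinarith
  rw [tendsto_iff_dist_tendsto_zero]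
  refine squeeze_zero' (g := fun L : ℕ => 2 * (1 / (L : ℝ))) (Filter.Eventually.of_forall fun _ => dist_nonneg) ?_
    (by simpa using tendsto_one_div_atTop_nhds_zero_nat.const_mul (2 : ℝ))
  filter_upwards [Filter.eventually_gt_atTop 0] with L hL0
  have hLpos : (0 : ℝ) < L := by exact_mod_cast hL0
  rw [Real.dist_eq, sd_eq_sum_step g hL0.ne', hatAvg, ← Finset.sum_sub_distrib]
  simp_rw [← Finset.sum_sub_distrib]
  calc _ ≤ ∑ l ∈ Finset.range L, ∑ l' ∈ Finset.range L, 2 * ((L : ℝ)⁻¹) ^ 3 := by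
        refine (Finset.abs_sum_le_sum_abs _ _).trans (Finset.sum_le_sum fun l _ => ?_)
        refine (Finset.abs_sum_le_sum_abs _ _).trans (Finset.sum_le_sum fun l' _ => ?_)
        exact key _ (by positivity) _
    _ = 2 * (1 / (L : ℝ)) := by simp; field_simp


/-! ### Centred B-splines of odd degree -/

/-- The normalized truncated power `x_+^q / q!`. -/
def truncPow (q : ℕ) (x : ℝ) : ℝ := max x 0 ^ q / (q.factorial : ℝ)

lemma truncPow_of_nonpos {q : ℕ} (hq : q ≠ 0) {x : ℝ} (hx : x ≤ 0) : truncPow q x = 0 := by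
  simp [truncPow, max_eq_right hx, hq]

lemma truncPow_of_nonneg (q : ℕ) {x : ℝ} (hx : 0 ≤ x) :
    truncPow q x = x ^ q / (q.factorial : ℝ) := by
  simp [truncPow, max_eq_left hx]

lemma hasDerivAt_truncPow {q : ℕ} (hq : 1 ≤ q) (x : ℝ) :
    HasDerivAt (truncPow (q + 1)) (truncPow q x) x := by
  have hf : ((q + 1).factorial : ℝ) = (q + 1) * q.factorial := by
    rw [Nat.factorial_succ]; push_cast; ring
  have hf0 : (q.factorial : ℝ) ≠ 0 := by positivity
  have hpow : HasDerivAt (fun x : ℝ => x ^ (q + 1) / ((q + 1).factorial : ℝ))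
      (x ^ q / (q.factorial : ℝ)) x := by
    refine ((hasDerivAt_pow (q + 1) x).div_const _).congr_deriv ?_
    rw [hf]; push_cast; field_simp
    try simp
  rcases lt_trichotomy x 0 with hx | hx | hx
  · rw [truncPow_of_nonpos (by omega) hx.le]
    refine (hasDerivAt_const x (0 : ℝ)).congr_of_eventuallyEq ?_
    filter_upwards [eventually_lt_nhds hx] with y hy
    exact truncPow_of_nonpos (by omega) hy.le
  · subst hx
    rw [truncPow_of_nonpos (by omega) le_rfl]
    have hl : HasDerivWithinAt (truncPow (q + 1)) 0 (Set.Iic 0) 0 :=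
      (hasDerivWithinAt_const (0 : ℝ) (Set.Iic 0) (0 : ℝ)).congr
        (fun y hy => truncPow_of_nonpos (by omega) hy) (truncPow_of_nonpos (by omega) le_rfl)
    have hr : HasDerivWithinAt (truncPow (q + 1)) 0 (Set.Ici 0) 0 := by
      have := hpow.hasDerivWithinAt (s := Set.Ici 0)
      rw [zero_pow (by omega), zero_div] at this
      exact this.congr (fun y hy => truncPow_of_nonneg _ hy) (truncPow_of_nonneg _ le_rfl)
    simpa [Set.Iic_union_Ici] using hl.union hr
  · rw [truncPow_of_nonneg _ hx.le]
    refine hpow.congr_of_eventuallyEq ?_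
    filter_upwards [eventually_gt_nhds hx] with y hy
    exact truncPow_of_nonneg _ hy.le

lemma contDiff_truncPow (q : ℕ) : ContDiff ℝ (q : WithTop ℕ∞) (truncPow (q + 1)) := by
  induction q with
  | zero =>
    simp only [Nat.cast_zero, contDiff_zero]
    unfold truncPow; fun_prop
  | succ q ih =>
    push_cast
    rw [contDiff_succ_iff_deriv]
    refine ⟨fun x => (hasDerivAt_truncPow (by omega) x).differentiableAt, by simp, ?_⟩
    rwa [show deriv (truncPow (q + 1 + 1)) = truncPow (q + 1) from
      funext fun x => (hasDerivAt_truncPow (by omega) x).deriv]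

/-- The centred cardinal B-spline of degree `2 n + 1`. -/
def bspline (n : ℕ) : ℝ → ℝ := sd^[n + 1] (truncPow (2 * n + 1))

/-- The properties of B-splines which are inherited under averaging. -/
structure IsBump (n : ℕ) (φ : ℝ → ℝ) : Prop where
  posDef : PosDefFun φ
  lip : ∀ x y, |φ x - φ y| ≤ |x - y|
  nonneg : ∀ x, 0 ≤ φ x
  even : ∀ x, φ (-x) = φ x
  supp : ∀ x, (n : ℝ) + 1 ≤ |x| → φ x = 0
  unity : ∀ (x : ℝ) (R : ℕ), |x| + n + 1 ≤ R → ∑ k ∈ Finset.Icc (-(R : ℤ)) (R : ℤ), φ (x - (k : ℤ)) = 1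

lemma sum_Icc_telescope (u : ℤ → ℝ) (R : ℕ) :
    ∑ k ∈ Finset.Icc (-(R : ℤ)) R, (u k - u (k + 1)) = u (-R) - u (R + 1) := by
  induction R with
  | zero => simp
  | succ R ih =>
    have : Finset.Icc (-((R + 1 : ℕ) : ℤ)) ((R + 1 : ℕ) : ℤ)
        = insert (-((R : ℤ) + 1)) (insert ((R : ℤ) + 1) (Finset.Icc (-(R : ℤ)) R)) := by
      ext j; simp only [Finset.mem_Icc, Finset.mem_insert]; push_cast; omega
    rw [this, Finset.sum_insert, Finset.sum_insert, ih]
    · push_cast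
      rw [show -((R : ℤ) + 1) + 1 = -R by ring]
      ring
    · simp
    · simp only [Finset.mem_Icc, Finset.mem_insert]; omega

/-- Every property of a bump is a closed condition under pointwise limits. The index starts at one
because the empty average `hatAvg 0` is zero and violates the partition of unity. -/
lemma IsBump.of_tendsto {n : ℕ} {φ : ℝ → ℝ} {Φ : ℕ → ℝ → ℝ} (h : ∀ L, IsBump n (Φ (L + 1)))
    (hl : ∀ x, Filter.Tendsto (fun L => Φ L x) Filter.atTop (nhds (φ x))) : IsBump n φ := by
  have hl' : ∀ x, Filter.Tendsto (fun L => Φ (L + 1) x) Filter.atTop (nhds (φ x)) := fun x =>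
    (Filter.tendsto_add_atTop_iff_nat 1).2 (hl x)
  refine ⟨.of_tendsto (fun L => (h L).posDef) hl', fun x y => ?_, fun x => ?_, fun x => ?_,
    fun x hx => ?_, fun x R hR => ?_⟩
  · exact le_of_tendsto' ((hl' x).sub (hl' y)).abs fun L => (h L).lip x y
  · exact ge_of_tendsto' (hl' x) fun L => (h L).nonneg x
  · exact tendsto_nhds_unique (hl' (-x)) ((hl' x).congr fun L => ((h L).even x).symm)
  · exact tendsto_nhds_unique (hl' x) (tendsto_const_nhds.congr fun L => ((h L).supp x hx).symm)
  · exact tendsto_nhds_unique (tendsto_finsetSum _ fun k _ => hl' (x - k))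
      (tendsto_const_nhds.congr fun L => ((h L).unity x R hR).symm)

lemma abs_div_sub_div_le {L l l' : ℕ} (hl : l ∈ Finset.range L) (hl' : l' ∈ Finset.range L) :
    |(l : ℝ) / L - (l' : ℝ) / L| ≤ 1 := by
  rw [Finset.mem_range] at hl hl'
  have hL : (0 : ℝ) < L := by exact_mod_cast (by omega : 0 < L)
  have h1 : (l : ℝ) / L ≤ 1 := (div_le_one hL).2 (by exact_mod_cast hl.le)
  have h2 : (l' : ℝ) / L ≤ 1 := (div_le_one hL).2 (by exact_mod_cast hl'.le)
  have h3 : 0 ≤ (l : ℝ) / L := by positivity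
  have h4 : 0 ≤ (l' : ℝ) / L := by positivity
  rw [abs_le]; constructor <;> linarith

lemma sum_hatAvg_weights (L : ℕ) : ∑ _l ∈ Finset.range (L + 1), ∑ _l' ∈ Finset.range (L + 1),
    (((L + 1 : ℕ) : ℝ)⁻¹ * ((L + 1 : ℕ) : ℝ)⁻¹) = 1 := by
  have : ((L + 1 : ℕ) : ℝ) ≠ 0 := by positivity
  simp only [Finset.sum_const, Finset.card_range, nsmul_eq_mul]; field_simp

/-- The weights are nonnegative with sum one, which preserves the Lipschitz bound and the partition
of unity; the shifts have size at most one, so the support radius grows by one. -/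
lemma IsBump.hatAvg {n : ℕ} {φ : ℝ → ℝ} (h : IsBump n φ) (L : ℕ) :
    IsBump (n + 1) (hatAvg (L + 1) φ) := by
  refine ⟨h.posDef.hatAvg _, fun x y => ?_, fun x => ?_, fun x => ?_, fun x hx => ?_,
    fun x R hR => ?_⟩
  · unfold SL2.hatAvg
    rw [← Finset.sum_sub_distrib]
    simp_rw [← Finset.sum_sub_distrib, ← mul_sub]
    calc _ ≤ ∑ l ∈ Finset.range (L + 1), ∑ l' ∈ Finset.range (L + 1),
          (((L + 1 : ℕ) : ℝ)⁻¹ * ((L + 1 : ℕ) : ℝ)⁻¹) * |x - y| := by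
          refine (Finset.abs_sum_le_sum_abs _ _).trans (Finset.sum_le_sum fun l _ => ?_)
          refine (Finset.abs_sum_le_sum_abs _ _).trans (Finset.sum_le_sum fun l' _ => ?_)
          rw [abs_mul, abs_of_nonneg (by positivity : (0 : ℝ) ≤ ((L + 1 : ℕ) : ℝ)⁻¹ * _)]
          refine mul_le_mul_of_nonneg_left ((h.lip _ _).trans ?_) (by positivity)
          rw [add_sub_add_right_eq_sub]
      _ = |x - y| := by
          have := congrArg (· * |x - y|) (sum_hatAvg_weights L)
          simpa only [Finset.sum_mul, one_mul] using this
  · exact Finset.sum_nonneg fun l _ => Finset.sum_nonneg fun l' _ =>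
      mul_nonneg (by positivity) (h.nonneg _)
  · unfold SL2.hatAvg
    rw [Finset.sum_comm]
    refine Finset.sum_congr rfl fun l _ => Finset.sum_congr rfl fun l' _ => ?_
    rw [← h.even]; congr 2; ring
  · refine Finset.sum_eq_zero fun l hl => Finset.sum_eq_zero fun l' hl' => ?_
    rw [h.supp, mul_zero]
    have h1 := abs_div_sub_div_le hl hl'
    have h2 := abs_sub_abs_le_abs_sub x (-(((l : ℝ) / (L + 1 : ℕ) - (l' : ℝ) / (L + 1 : ℕ))))
    rw [abs_neg, sub_neg_eq_add] at h2
    push_cast at *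
    linarith
  · unfold SL2.hatAvg
    rw [Finset.sum_comm, ← sum_hatAvg_weights L]
    refine Finset.sum_congr rfl fun l hl => ?_
    rw [Finset.sum_comm]
    refine Finset.sum_congr rfl fun l' hl' => ?_
    rw [← Finset.mul_sum]
    have := h.unity (x + ((l : ℝ) / (L + 1 : ℕ) - (l' : ℝ) / (L + 1 : ℕ))) R (by
      have h1 := abs_div_sub_div_le hl hl'
      have h2 := abs_add_le x ((l : ℝ) / (L + 1 : ℕ) - (l' : ℝ) / (L + 1 : ℕ))
      push_cast at *
      linarith)
    rw [show ∑ k ∈ Finset.Icc (-(R : ℤ)) R,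
        φ (x - k + ((l : ℝ) / (L + 1 : ℕ) - (l' : ℝ) / (L + 1 : ℕ))) = 1 from ?_, mul_one]
    rw [← this]
    refine Finset.sum_congr rfl fun k _ => ?_
    congr 1; ring

lemma bspline_zero (x : ℝ) : bspline 0 x = max 0 (1 - |x|) := by
  simp only [bspline, truncPow, sd, Function.iterate_succ, Function.iterate_zero, Function.comp, id]
  simp
  rcases le_total x 0 with h | h <;> [rw [abs_of_nonpos h]; rw [abs_of_nonneg h]] <;>
  rcases le_total 0 (x + 1) with h1 | h1 <;> rcases le_total 0 (x - 1) with h2 | h2 <;>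
  simp only [max_def] <;> split_ifs <;> linarith

/-- The hat is the autocorrelation of the indicator of a unit interval, so its quadratic form is the
integral of the square of `∑ w_i 1_{[a_i, a_i + 1)}`. -/
lemma posDefFun_bspline_zero : PosDefFun (bspline 0) := by
  intro ι S a w
  have hI : ∀ i, Integrable ((Set.Ico (a i) (a i + 1)).indicator (1 : ℝ → ℝ)) :=
    fun i => (integrable_indicator_iff measurableSet_Ico).2
      (by simp [IntegrableOn, Pi.one_def])
  have hmul : ∀ i j, (fun y => (Set.Ico (a i) (a i + 1)).indicator (1 : ℝ → ℝ) y
      * (Set.Ico (a j) (a j + 1)).indicator (1 : ℝ → ℝ) y)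
      = (Set.Ico (a i) (a i + 1) ∩ Set.Ico (a j) (a j + 1)).indicator 1 := by
    intro i j
    funext y
    rw [Set.inter_indicator_one]; rfl
  have hII : ∀ i j, Integrable (fun y => (Set.Ico (a i) (a i + 1)).indicator (1 : ℝ → ℝ) y
      * (Set.Ico (a j) (a j + 1)).indicator (1 : ℝ → ℝ) y) := by
    intro i j
    rw [hmul, ← Set.indicator_indicator]
    exact (hI j).indicator measurableSet_Ico
  have hval : ∀ i j, ∫ y, (Set.Ico (a i) (a i + 1)).indicator (1 : ℝ → ℝ) y
      * (Set.Ico (a j) (a j + 1)).indicator (1 : ℝ → ℝ) y = bspline 0 (a i - a j) := by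
    intro i j
    rw [hmul, integral_indicator_one (measurableSet_Ico.inter measurableSet_Ico), bspline_zero,
      Set.Ico_inter_Ico, Real.volume_real_Ico, max_comm]
    congr 1
    rcases le_total (a i) (a j) with h | h
    · rw [abs_of_nonpos (by linarith)]; simp [h]; ring
    · rw [abs_of_nonneg (by linarith)]; simp [h]; ring
  have : ∑ i ∈ S, ∑ j ∈ S, w i * w j * bspline 0 (a i - a j)
      = ∫ y, (∑ i ∈ S, w i * (Set.Ico (a i) (a i + 1)).indicator (1 : ℝ → ℝ) y) ^ 2 := by
    simp_rw [sq, Finset.sum_mul_sum]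
    rw [integral_finsetSum]
    · refine Finset.sum_congr rfl fun i _ => ?_
      rw [integral_finsetSum]
      · refine Finset.sum_congr rfl fun j _ => ?_
        rw [← hval, ← integral_const_mul]
        congr 1; funext y; ring
      · intro j _
        refine ((hII i j).const_mul (w i * w j)).congr (.of_forall fun y => ?_)
        simp only; ring
    · intro i _
      refine integrable_finsetSum _ fun j _ => ?_
      refine ((hII i j).const_mul (w i * w j)).congr (.of_forall fun y => ?_)
      simp only; ring
  rw [this]
  exact integral_nonneg fun y => sq_nonneg _

lemma isBump_bspline_zero : IsBump 0 (bspline 0) := by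
  refine ⟨posDefFun_bspline_zero, fun x y => ?_, fun x => ?_, fun x => ?_, fun x hx => ?_,
    fun x R hR => ?_⟩
  · rw [bspline_zero, bspline_zero]
    rw [max_comm, max_comm 0 (1 - |y|)]
    refine (abs_max_sub_max_le_abs (1 - |x|) (1 - |y|) 0).trans ?_
    rw [show 1 - |x| - (1 - |y|) = -(|x| - |y|) by ring, abs_neg]
    exact abs_abs_sub_abs_le_abs_sub x y
  · rw [bspline_zero]; exact le_max_left _ _
  · rw [bspline_zero, bspline_zero, abs_neg]
  · rw [bspline_zero, max_eq_left]; simp at hx; linarith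
  -- The hat is the difference of two neighbouring ramps `(x + 1)_+ - x_+`, so the sum of its
  -- translates telescopes.
  · have h := sum_Icc_telescope (fun k : ℤ => max (x - k + 1) 0 - max (x - k) 0) R
    have e : ∀ k : ℤ, bspline 0 (x - k) = (max (x - k + 1) 0 - max (x - k) 0)
        - (max (x - (k + 1 : ℤ) + 1) 0 - max (x - (k + 1 : ℤ)) 0) := by
      intro k
      simp [bspline, truncPow, sd]
      ring_nf
    simp_rw [e]
    rw [h]
    have := abs_le.1 (show |x| ≤ R - 1 by push_cast at hR; linarith)
    push_cast
    rw [max_eq_left (by linarith), max_eq_left (by linarith), max_eq_right (by linarith),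
      max_eq_right (by linarith)]
    ring

lemma bspline_hasDerivAt (n : ℕ) (x : ℝ) :
    HasDerivAt (sd^[n + 1] (truncPow (2 * n + 3))) (sd^[n + 1] (truncPow (2 * n + 2)) x) x ∧
    HasDerivAt (sd^[n + 1] (truncPow (2 * n + 2))) (bspline n x) x :=
  ⟨sd_iterate_hasDerivAt _ (fun x => hasDerivAt_truncPow (by omega) x) x,
    sd_iterate_hasDerivAt _ (fun x => hasDerivAt_truncPow (by omega) x) x⟩

lemma bspline_succ (n : ℕ) : bspline (n + 1) = sd (sd^[n + 1] (truncPow (2 * n + 3))) := by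
  rw [bspline, Function.iterate_succ_apply']; rfl

/-- The next B-spline is the second difference of a second antiderivative of the present one, hence
a limit of its hat averages. -/
lemma isBump_bspline (n : ℕ) : IsBump n (bspline n) := by
  induction n with
  | zero => exact isBump_bspline_zero
  | succ n ih =>
    refine .of_tendsto (Φ := fun L => hatAvg L (bspline n)) (fun L => ih.hatAvg L) fun x => ?_
    rw [bspline_succ]
    exact hatAvg_tendsto (fun x => (bspline_hasDerivAt n x).1)
      (fun x => (bspline_hasDerivAt n x).2) ih.lip x


/-! ### Interpolation kernels -/

/-- Fundamental functions of interpolation operators on `ℤ` which are positive definite, decay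
rapidly and reproduce polynomials of degree at most `p`. -/
structure IsKernel (p : ℕ) (ψ : ℝ → ℝ) : Prop where
  decay : ∀ E : ℕ, ∃ C, ∀ x, |ψ x| * (1 + |x|) ^ E ≤ C
  lip : ∀ E : ℕ, ∃ C, ∀ (k : ℤ) (s : ℝ), |s| ≤ |(k : ℝ)| / 2 →
    |ψ (k + s) - ψ k| * (1 + |(k : ℝ)|) ^ E ≤ C * |s|
  cardinal : ∀ k : ℤ, ψ k = if k = 0 then 1 else 0
  even : ∀ x, ψ (-x) = ψ x
  posDef : PosDefFun ψ
  repro : ∀ P : ℝ[X], P.natDegree ≤ p → ∀ x, ∑' j : ℤ, P.eval (j : ℝ) * ψ (x - j) = P.eval x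

/-- The function `∑ v_j ψ(x / Δx - j)`. -/
def kernelInterp (ψ : ℝ → ℝ) (Δx : ℝ) (v : ℤ → ℝ) (x : ℝ) : ℝ := ∑' j : ℤ, v j * ψ (x / Δx - j)

lemma decay_of_compact {ψ : ℝ → ℝ} {K R : ℝ} (hK : 0 ≤ K) (hR : 0 ≤ R)
    (hl : ∀ x y, |ψ x - ψ y| ≤ K * |x - y|) (hs : ∀ x, R ≤ |x| → ψ x = 0) (E : ℕ) :
    ∃ C, ∀ x, |ψ x| * (1 + |x|) ^ E ≤ C := by
  refine ⟨K * (2 * R) * (1 + R) ^ E, fun x => ?_⟩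
  by_cases hx : R ≤ |x|
  · rw [hs x hx]; simp; positivity
  · have h1 := hl x R
    rw [hs R (le_abs_self R), sub_zero] at h1
    have h2 : |x - R| ≤ 2 * R := by
      have := abs_lt.1 (not_le.1 hx)
      rw [abs_le]; constructor <;> linarith
    refine mul_le_mul (h1.trans (by gcongr)) ?_ (by positivity) (by positivity)
    gcongr; exact (not_le.1 hx).le

lemma lip_of_compact {ψ : ℝ → ℝ} {K R : ℝ} (hK : 0 ≤ K) (hR : 0 ≤ R)
    (hl : ∀ x y, |ψ x - ψ y| ≤ K * |x - y|) (hs : ∀ x, R ≤ |x| → ψ x = 0) (E : ℕ) :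
    ∃ C, ∀ (k : ℤ) (s : ℝ), |s| ≤ |(k : ℝ)| / 2 →
      |ψ (k + s) - ψ k| * (1 + |(k : ℝ)|) ^ E ≤ C * |s| := by
  refine ⟨K * (1 + 2 * R) ^ E, fun k s hs' => ?_⟩
  -- For `|k| ≥ 2 R` the condition `|s| ≤ |k| / 2` keeps `k + s` outside the support as well, so
  -- both values vanish.
  by_cases hk : 2 * R ≤ |(k : ℝ)|
  · rw [hs k (by linarith), hs (k + s)]
    · simp; positivity
    · have := abs_sub_abs_le_abs_sub (k : ℝ) (-s)
      rw [abs_neg, sub_neg_eq_add] at this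
      linarith
  · have h1 := hl (k + s) k
    rw [add_sub_cancel_left] at h1
    calc _ ≤ K * |s| * (1 + 2 * R) ^ E := by
          gcongr; exact (not_le.1 hk).le
      _ = _ := by ring

lemma PosDefFun.neg_sd_iterate {φ : ℝ → ℝ} (h : PosDefFun φ) (r : ℕ) :
    PosDefFun (fun x => (-1) ^ r * sd^[r] φ x) := by
  induction r with
  | zero => simpa using h
  | succ r ih =>
    convert ih.neg_sd using 2 with x
    rw [Function.iterate_succ_apply']
    simp only [sd]; ring

lemma sd_iterate_even {φ : ℝ → ℝ} (h : ∀ x, φ (-x) = φ x) (r : ℕ) (x : ℝ) :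
    sd^[r] φ (-x) = sd^[r] φ x := by
  induction r generalizing x with
  | zero => exact h x
  | succ r ih =>
    rw [Function.iterate_succ_apply']
    simp only [sd]
    rw [show -x + 1 = -(x - 1) by ring, show -x - 1 = -(x + 1) by ring, ih, ih, ih]; ring

lemma sd_iterate_lip {φ : ℝ → ℝ} (h : ∀ x y, |φ x - φ y| ≤ |x - y|) (r : ℕ) :
    ∃ K, 0 ≤ K ∧ ∀ x y, |sd^[r] φ x - sd^[r] φ y| ≤ K * |x - y| := by
  refine ⟨∑ k ∈ Finset.range (2 * r + 1), |sdCoeff r k|,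
    Finset.sum_nonneg fun _ _ => abs_nonneg _, fun x y => ?_⟩
  rw [sd_iterate_eq_sum, sd_iterate_eq_sum, ← Finset.sum_sub_distrib, Finset.sum_mul]
  refine (Finset.abs_sum_le_sum_abs _ _).trans (Finset.sum_le_sum fun k _ => ?_)
  rw [← mul_sub, abs_mul]
  refine mul_le_mul_of_nonneg_left ((h _ _).trans ?_) (abs_nonneg _)
  rw [add_sub_add_right_eq_sub]

/-! ### The kernel of symmetric Lagrange interpolation -/

/-- The polynomial `∏_{l=1}^n (X - l²)`. -/
def sqNodes (n : ℕ) : ℝ[X] := ∏ l ∈ Finset.range n, (X - C (((l : ℝ) + 1) ^ 2))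

/-- The polynomial `∏_{l=-n}^n (X - l)`. -/
def nodesPoly (n : ℕ) : ℝ[X] := X * (sqNodes n).comp (X ^ 2)

lemma natDegree_sqNodes (n : ℕ) : (sqNodes n).natDegree = n := by
  unfold sqNodes
  rw [natDegree_prod_of_monic _ _ fun l _ => monic_X_sub_C _]
  simp_rw [natDegree_X_sub_C]; simp

lemma natDegree_nodesPoly_le (n : ℕ) : (nodesPoly n).natDegree ≤ 2 * n + 1 := by
  unfold nodesPoly
  refine natDegree_mul_le.trans ?_
  rw [natDegree_comp, natDegree_sqNodes]; simp; omega

lemma eval_nodesPoly (n : ℕ) (x : ℝ) :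
    (nodesPoly n).eval x = x * ∏ l ∈ Finset.range n, (x ^ 2 - ((l : ℝ) + 1) ^ 2) := by
  simp [nodesPoly, sqNodes, eval_prod]

lemma eval_nodesPoly_eq_sum (n : ℕ) (x : ℝ) : (nodesPoly n).eval x
    = ∑ k ∈ Finset.range (n + 1), (sqNodes n).coeff k * x ^ (2 * k + 1) := by
  simp only [nodesPoly, eval_mul, eval_X, eval_comp, eval_pow]
  rw [eval_eq_sum_range, natDegree_sqNodes, Finset.mul_sum]
  refine Finset.sum_congr rfl fun k _ => by ring

lemma eval_nodesPoly_of_abs_le {n : ℕ} {j : ℤ} (h1 : -(n : ℤ) ≤ j) (h2 : j ≤ n) :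
    (nodesPoly n).eval (j : ℝ) = 0 := by
  rw [eval_nodesPoly]
  rcases eq_or_ne j 0 with rfl | hj
  · simp
  · refine mul_eq_zero_of_right _ (Finset.prod_eq_zero (i := j.natAbs - 1) ?_ ?_)
    · rw [Finset.mem_range]; omega
    · have h : ((j.natAbs - 1 : ℕ) : ℝ) + 1 = |(j : ℝ)| := by
        have : j.natAbs - 1 + 1 = j.natAbs := by omega
        rw [← Int.cast_abs, ← Int.natCast_natAbs]; exact_mod_cast this
      rw [h, sq_abs, sub_self]

lemma eval_nodesPoly_pos (n : ℕ) : 0 < (nodesPoly n).eval ((n : ℝ) + 1) := by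
  rw [eval_nodesPoly]
  refine mul_pos (by positivity) (Finset.prod_pos fun l hl => ?_)
  have : (l : ℝ) < n := by exact_mod_cast Finset.mem_range.1 hl
  nlinarith [(Nat.cast_nonneg l : (0 : ℝ) ≤ l)]

/-- All roots are positive, so the coefficients alternate in sign. These signs cancel those of the
iterated differences in `lagrangeKernel_eq_sum`, and this makes the Lagrange kernel positive
definite. -/
lemma sqNodes_coeff_sign (n k : ℕ) : 0 ≤ (-1 : ℝ) ^ (n + k) * (sqNodes n).coeff k := by
  induction n generalizing k with
  | zero => cases k <;> simp [sqNodes, coeff_one]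
  | succ n ih =>
    have hs : sqNodes (n + 1) = sqNodes n * (X - C (((n : ℝ) + 1) ^ 2)) := by
      simp [sqNodes, Finset.prod_range_succ]
    cases k with
    | zero =>
      rw [hs, mul_sub, coeff_sub, coeff_mul_C, mul_coeff_zero, coeff_X_zero]
      have := mul_nonneg (ih 0) (sq_nonneg ((n : ℝ) + 1))
      refine this.trans_eq ?_
      ring
    | succ k =>
      rw [hs, mul_sub, coeff_sub, coeff_mul_C, coeff_mul_X]
      have := add_nonneg (ih k) (mul_nonneg (ih (k + 1)) (sq_nonneg ((n : ℝ) + 1)))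
      refine this.trans_eq ?_
      ring

/-- The truncation `x ↦ ω(x_+)` of `nodesPoly`. -/
def truncNodes (n : ℕ) (x : ℝ) : ℝ := (nodesPoly n).eval (max x 0)

/-- The fundamental function of symmetric Lagrange interpolation of degree `2 n + 1`. -/
def lagrangeKernel (n : ℕ) (x : ℝ) : ℝ :=
  sd^[n + 1] (truncNodes n) x / (nodesPoly n).eval ((n : ℝ) + 1)

lemma truncNodes_of_nonneg (n : ℕ) {x : ℝ} (hx : 0 ≤ x) :
    truncNodes n x = (nodesPoly n).eval x := by rw [truncNodes, max_eq_left hx]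

lemma truncNodes_of_nonpos (n : ℕ) {x : ℝ} (hx : x ≤ 0) : truncNodes n x = 0 := by
  rw [truncNodes, max_eq_right hx, eval_nodesPoly, zero_mul]

/-- The polynomial vanishes at the integers from `-n` to `n`, so truncation at zero is invisible on
the integers `≥ -n`. The cardinality of the Lagrange kernel rests on this. -/
lemma truncNodes_int {n : ℕ} {j : ℤ} (h : -(n : ℤ) ≤ j) :
    truncNodes n j = (nodesPoly n).eval (j : ℝ) := by
  rcases le_total 0 j with hj | hj
  · exact truncNodes_of_nonneg n (by exact_mod_cast hj)
  · rw [truncNodes_of_nonpos n (by exact_mod_cast hj), eval_nodesPoly_of_abs_le h (by omega)]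

lemma truncNodes_int_eq_zero {n : ℕ} {j : ℤ} (h : j ≤ n) : truncNodes n j = 0 := by
  rcases le_total 0 j with hj | hj
  · rw [truncNodes_of_nonneg n (by exact_mod_cast hj), eval_nodesPoly_of_abs_le (by omega) h]
  · exact truncNodes_of_nonpos n (by exact_mod_cast hj)

/-- The node polynomial contains only odd powers. Of the `n + 1` second differences, `k + 1` turn
the truncated power of degree `2 k + 1` into a B-spline, and `n - k` are left over. The sign is
distributed so that both factors are of the right kind: nonnegative numbers and positive definite
functions. -/
lemma lagrangeKernel_eq_sum (n : ℕ) (x : ℝ) :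
    lagrangeKernel n x = ∑ k ∈ Finset.range (n + 1),
      ((-1) ^ (n + k) * (sqNodes n).coeff k * ((2 * k + 1).factorial : ℝ)
        / (nodesPoly n).eval ((n : ℝ) + 1)) * ((-1) ^ (n - k) * sd^[n - k] (bspline k) x) := by
  have : truncNodes n = fun x => ∑ k ∈ Finset.range (n + 1),
      ((sqNodes n).coeff k * ((2 * k + 1).factorial : ℝ)) * truncPow (2 * k + 1) x := by
    funext x
    rw [truncNodes, eval_nodesPoly_eq_sum]
    refine Finset.sum_congr rfl fun k _ => ?_
    have : ((2 * k + 1).factorial : ℝ) ≠ 0 := by positivity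
    rw [truncPow]; field_simp
  rw [lagrangeKernel, this, sd_iterate_sum, Finset.sum_div]
  refine Finset.sum_congr rfl fun k hk => ?_
  have hk' : k ≤ n := by rw [Finset.mem_range] at hk; omega
  have hit : sd^[n - k] (bspline k) = sd^[n + 1] (truncPow (2 * k + 1)) := by
    rw [bspline, ← Function.iterate_add_apply]; congr 1; omega
  have hsgn : (-1 : ℝ) ^ (n + k) * (-1) ^ (n - k) = 1 := by
    rw [← pow_add, show n + k + (n - k) = 2 * n by omega, pow_mul]; simp
  rw [hit]
  calc _ = ((-1 : ℝ) ^ (n + k) * (-1) ^ (n - k)) * ((sqNodes n).coeff k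
        * ((2 * k + 1).factorial : ℝ) * sd^[n + 1] (truncPow (2 * k + 1)) x
          / (nodesPoly n).eval ((n : ℝ) + 1)) := by rw [hsgn, one_mul]
    _ = _ := by ring

/-- To the right of the support the truncation is inactive, and `n + 1` second differences
annihilate degree `2 n + 1`; to the left all arguments are nonpositive. -/
lemma lagrangeKernel_supp (n : ℕ) {x : ℝ} (hx : (n : ℝ) + 1 ≤ |x|) : lagrangeKernel n x = 0 := by
  rw [lagrangeKernel, div_eq_zero_iff]; left
  rcases le_total 0 x with h | h
  · rw [abs_of_nonneg h] at hx
    rw [sd_iterate_congr (g' := fun x => (nodesPoly n).eval x), sd_iterate_poly]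
    · have := natDegree_nodesPoly_le n; omega
    · intro j hj _
      have : -((n + 1 : ℕ) : ℝ) ≤ j := by exact_mod_cast hj
      push_cast at this
      exact truncNodes_of_nonneg n (by linarith)
  · rw [abs_of_nonpos h] at hx
    rw [sd_iterate_congr (g' := fun x => (0 : ℝ[X]).eval x), sd_iterate_poly]
    · simp
    · intro j _ hj
      have : (j : ℝ) ≤ ((n + 1 : ℕ) : ℝ) := by exact_mod_cast hj
      push_cast at this
      simpa using truncNodes_of_nonpos n (by linarith : x + j ≤ 0)

lemma lagrangeKernel_int (n : ℕ) (k : ℤ) : lagrangeKernel n k = if k = 0 then 1 else 0 := by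
  have hne := (eval_nodesPoly_pos n).ne'
  rcases lt_trichotomy k 0 with hk | rfl | hk
  · rw [if_neg hk.ne, lagrangeKernel, sd_iterate_congr (g' := fun x => (0 : ℝ[X]).eval x),
      sd_iterate_poly, zero_div]
    · simp
    · intro j _ hj
      have := truncNodes_int_eq_zero (n := n) (j := k + j) (by omega)
      push_cast at this; simpa using this
  · rw [if_pos rfl, lagrangeKernel, sd_iterate_top]
    · rw [div_eq_one_iff_eq hne, truncNodes_of_nonneg n (by push_cast; positivity)]
      simp
    · intro j hj
      have := truncNodes_int_eq_zero (n := n) (j := j) (by omega)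
      simpa using this
  · rw [if_neg hk.ne', lagrangeKernel, sd_iterate_congr (g' := fun x => (nodesPoly n).eval x),
      sd_iterate_poly, zero_div]
    · have := natDegree_nodesPoly_le n; omega
    · intro j hj _
      have := truncNodes_int (n := n) (j := k + j) (by omega)
      push_cast at this; simpa using this

/-- The polynomial which agrees with `lagrangeKernel` on the cell `[c, c + 1)`. -/
def lagrangeCell (n : ℕ) (c : ℤ) : ℝ[X] :=
  C ((nodesPoly n).eval ((n : ℝ) + 1))⁻¹ * ∑ k ∈ Finset.range (2 * (n + 1) + 1),
    C (sdCoeff (n + 1) k) * (if 0 ≤ c + ((k : ℤ) - (n + 1 : ℕ))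
      then (nodesPoly n).comp (X + C ((((k : ℤ) - (n + 1 : ℕ) : ℤ) : ℝ))) else 0)

lemma natDegree_lagrangeCell_le (n : ℕ) (c : ℤ) : (lagrangeCell n c).natDegree ≤ 2 * n + 1 := by
  refine (natDegree_C_mul_le _ _).trans (natDegree_sum_le_of_forall_le _ _ fun k _ => ?_)
  refine (natDegree_C_mul_le _ _).trans ?_
  split_ifs
  · rw [natDegree_comp, natDegree_X_add_C, mul_one]; exact natDegree_nodesPoly_le n
  · simp

lemma eval_lagrangeCell (n : ℕ) (c : ℤ) (x : ℝ) (h : ∀ j : ℤ, (0 ≤ c + j →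
      truncNodes n (x + j) = (nodesPoly n).eval (x + j)) ∧
      (c + j < 0 → -((n : ℤ) + 1) ≤ j → truncNodes n (x + j) = 0)) :
    (lagrangeCell n c).eval x = lagrangeKernel n x := by
  rw [lagrangeKernel, sd_iterate_eq_sum, lagrangeCell, eval_mul, eval_C, eval_finsetSum,
    div_eq_inv_mul]
  congr 1
  refine Finset.sum_congr rfl fun k _ => ?_
  rw [eval_mul, eval_C]
  congr 1
  split_ifs with hk
  · rw [(h _).1 hk]; simp
  · rw [(h _).2 (by omega) (by omega), eval_zero]

lemma eval_lagrangeCell_of_mem (n : ℕ) {c : ℤ} {x : ℝ} (h1 : (c : ℝ) ≤ x) (h2 : x < c + 1) :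
    (lagrangeCell n c).eval x = lagrangeKernel n x := by
  refine eval_lagrangeCell n c x fun j => ⟨fun hj => ?_, fun hj _ => ?_⟩
  · have : (0 : ℝ) ≤ c + j := by exact_mod_cast hj
    exact truncNodes_of_nonneg n (by linarith)
  · have : (c : ℝ) + j + 1 ≤ 0 := by exact_mod_cast hj
    exact truncNodes_of_nonpos n (by linarith)

/-- The polynomial of one cell keeps the values of the kernel at nodes well outside that cell, again
because the node polynomial vanishes at the integers from `-n` to `n`. On any cell the kernel sum is
therefore the interpolation polynomial of the whole stencil. -/
lemma eval_lagrangeCell_node (n : ℕ) {c k : ℤ} (h1 : c - n ≤ k) (h2 : k ≤ c + n + 1) :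
    (lagrangeCell n c).eval (k : ℝ) = if k = 0 then 1 else 0 := by
  rw [← lagrangeKernel_int n k]
  refine eval_lagrangeCell n c k fun j => ⟨fun hj => ?_, fun hj _ => ?_⟩
  · have := truncNodes_int (n := n) (j := k + j) (by omega)
    push_cast at this; exact this
  · have := truncNodes_int_eq_zero (n := n) (j := k + j) (by omega)
    push_cast at this; exact this

/-- On the cell of `x` the kernel sum is a polynomial of degree at most `2 n + 1` with the
prescribed values at the `2 n + 2` stencil nodes, and such a polynomial is unique. -/
lemma lagrangeInterp_eq (n : ℕ) {Δx : ℝ} (hΔ : 0 < Δx) (v : ℤ → ℝ) (x : ℝ) :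
    lagrangeInterp (2 * n + 1) Δx v x = kernelInterp (lagrangeKernel n) Δx v x := by
  have hn : (2 * n + 1) / 2 = n := by omega
  unfold lagrangeInterp kernelInterp
  rw [hn]
  set c := ⌊x / Δx⌋ with hc
  have hc1 : (c : ℝ) ≤ x / Δx := Int.floor_le _
  have hc2 : x / Δx < c + 1 := Int.lt_floor_add_one _
  set S := Finset.Icc (c - (n : ℤ)) (c + (n : ℤ) + 1) with hS
  set Q : ℝ[X] := ∑ j ∈ S, C (v j) * (lagrangeCell n (c - j)).comp (C Δx⁻¹ * X - C (j : ℝ)) with hQ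
  have hinj : Set.InjOn (fun k : ℤ => (k : ℝ) * Δx) S := by
    intro a _ b _ hab
    simpa [hΔ.ne'] using hab
  have hQi : Q = Lagrange.interpolate S (fun k : ℤ => (k : ℝ) * Δx) v := by
    refine Lagrange.eq_interpolate_of_eval_eq v hinj ?_ fun k hk => ?_
    · refine (degree_le_natDegree).trans_lt ?_
      have hd : Q.natDegree ≤ 2 * n + 1 := by
        refine natDegree_sum_le_of_forall_le _ _ fun j _ => (natDegree_C_mul_le _ _).trans ?_
        refine natDegree_comp_le.trans ?_
        have h1 : (C Δx⁻¹ * X - C (j : ℝ)).natDegree ≤ 1 := by compute_degree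
        calc _ ≤ (2 * n + 1) * 1 := Nat.mul_le_mul (natDegree_lagrangeCell_le n _) h1
          _ = _ := by ring
      have hcard : S.card = 2 * n + 2 := by rw [hS, Int.card_Icc]; omega
      rw [hcard]; exact_mod_cast (by omega : Q.natDegree < 2 * n + 2)
    · rw [hS, Finset.mem_Icc] at hk
      rw [hQ, eval_finsetSum]
      have : ∀ j ∈ S, (C (v j) * (lagrangeCell n (c - j)).comp (C Δx⁻¹ * X - C (j : ℝ))).eval
          ((k : ℝ) * Δx) = if j = k then v k else 0 := by
        intro j _
        have := eval_lagrangeCell_node n (c := c - j) (k := k - j) (by omega) (by omega)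
        have e : Δx⁻¹ * ((k : ℝ) * Δx) - j = ((k - j : ℤ) : ℝ) := by push_cast; field_simp
        rw [eval_mul, eval_comp]
        simp only [eval_C, eval_sub, eval_mul, eval_X]
        rw [e, this]
        by_cases hjk : j = k
        · simp [hjk]
        · rw [if_neg (by omega), if_neg hjk, mul_zero]
      rw [Finset.sum_congr rfl this, Finset.sum_ite_eq', if_pos (by rw [hS, Finset.mem_Icc]; exact hk)]
  rw [← hQi, hQ, eval_finsetSum, tsum_eq_sum (s := S)]
  · refine Finset.sum_congr rfl fun j _ => ?_
    rw [eval_mul, eval_comp]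
    simp only [eval_C, eval_sub, eval_mul, eval_X]
    rw [show Δx⁻¹ * x - j = x / Δx - j by field_simp, eval_lagrangeCell_of_mem n] <;> push_cast <;>
      linarith
  · intro j hj
    rw [lagrangeKernel_supp, mul_zero]
    rw [hS, Finset.mem_Icc, not_and_or, not_le, not_le] at hj
    rcases hj with hj | hj
    · have : (j : ℝ) + 1 ≤ c - n := by exact_mod_cast hj
      exact le_trans (by linarith) (le_abs_self _)
    · have : (c : ℝ) + n + 1 + 1 ≤ j := by exact_mod_cast hj
      exact le_trans (by linarith) (neg_le_abs _)

lemma isKernel_lagrangeKernel (n : ℕ) : IsKernel (2 * n + 1) (lagrangeKernel n) := by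
  have hcoef : ∀ k : ℕ, 0 ≤ (-1) ^ (n + k) * (sqNodes n).coeff k * ((2 * k + 1).factorial : ℝ)
        / (nodesPoly n).eval ((n : ℝ) + 1) := fun k =>
    div_nonneg (mul_nonneg (sqNodes_coeff_sign n k) (by positivity)) (eval_nodesPoly_pos n).le
  obtain ⟨K, hK, hl⟩ : ∃ K, 0 ≤ K ∧ ∀ x y,
      |lagrangeKernel n x - lagrangeKernel n y| ≤ K * |x - y| := by
    choose κ hκ hκl using fun k => sd_iterate_lip (isBump_bspline k).lip (n - k)
    refine ⟨∑ k ∈ Finset.range (n + 1), ((-1) ^ (n + k) * (sqNodes n).coeff k *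
      ((2 * k + 1).factorial : ℝ) / (nodesPoly n).eval ((n : ℝ) + 1)) * κ k,
      Finset.sum_nonneg fun k _ => mul_nonneg (hcoef k) (hκ k), fun x y => ?_⟩
    rw [lagrangeKernel_eq_sum, lagrangeKernel_eq_sum, ← Finset.sum_sub_distrib, Finset.sum_mul]
    refine (Finset.abs_sum_le_sum_abs _ _).trans (Finset.sum_le_sum fun k _ => ?_)
    rw [← mul_sub, ← mul_sub, abs_mul, abs_mul, abs_pow, abs_neg, abs_one, one_pow, one_mul,
      abs_of_nonneg (hcoef k), mul_assoc _ (κ k)]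
    exact mul_le_mul_of_nonneg_left (hκl k x y) (hcoef k)
  have hs : ∀ x, (n : ℝ) + 1 ≤ |x| → lagrangeKernel n x = 0 := fun x => lagrangeKernel_supp n
  refine ⟨decay_of_compact hK (by positivity) hl hs, lip_of_compact hK (by positivity) hl hs,
    lagrangeKernel_int n, fun x => ?_, ?_, fun P hP x => ?_⟩
  · rw [lagrangeKernel_eq_sum, lagrangeKernel_eq_sum]
    refine Finset.sum_congr rfl fun k _ => ?_
    rw [sd_iterate_even (isBump_bspline k).even]
  · have := PosDefFun.sum (S := Finset.range (n + 1)) (fun k _ => hcoef k)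
      (fun k _ => (isBump_bspline k).posDef.neg_sd_iterate (n - k))
    convert this using 2 with x
    exact lagrangeKernel_eq_sum n x
  -- Reproduction is inherited from Lagrange interpolation on the unit grid, where a polynomial of
  -- degree at most `2 n + 1` is its own interpolant.
  · have := lagrangeInterp_eq n one_pos (fun j => P.eval (j : ℝ)) x
    rw [kernelInterp, div_one] at this
    rw [← this, lagrangeInterp]
    have hP' := Lagrange.eq_interpolate_of_eval_eq (s := Finset.Icc
      (⌊x / 1⌋ - (((2 * n + 1) / 2 : ℕ) : ℤ)) (⌊x / 1⌋ + (((2 * n + 1) / 2 : ℕ) : ℤ) + 1))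
      (v := fun k : ℤ => (k : ℝ) * 1) (fun j : ℤ => P.eval (j : ℝ)) (f := P)
      (fun a _ b _ hab => by simpa using hab)
      (by
        refine (degree_le_natDegree).trans_lt ?_
        rw [Int.card_Icc]
        exact_mod_cast (by omega : P.natDegree < _))
      (fun i _ => by simp)
    rw [← hP']


/-! ### Periodized B-splines and positivity of the collocation symbol -/

lemma tsum_bump_eq {n : ℕ} {φ : ℝ → ℝ} (hφ : IsBump n φ) (a : ℤ → ℝ) {x : ℝ} {R : ℕ}
    (hR : |x| + n + 1 ≤ R) :
    ∑' k : ℤ, a k * φ (x - k) = ∑ k ∈ Finset.Icc (-(R : ℤ)) R, a k * φ (x - k) := by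
  refine tsum_eq_sum fun k hk => ?_
  rw [hφ.supp, mul_zero]
  have h1 := abs_sub_abs_le_abs_sub (k : ℝ) x
  rw [abs_sub_comm] at h1
  have h2 : (R : ℝ) ≤ |(k : ℝ)| := by
    rw [Finset.mem_Icc, not_and_or, not_le, not_le] at hk
    rw [← Int.cast_abs]
    have : (R : ℤ) ≤ |k| := by
      rcases hk with hk | hk
      · exact le_trans (by omega) (neg_le_abs k)
      · exact le_trans (by omega) (le_abs_self k)
    exact_mod_cast this
  linarith

lemma sum_sum_sub_eq (g : ℤ → ℝ) {R : ℕ} (hg : ∀ k, k ∉ Finset.Icc (-(R : ℤ)) R → g k = 0)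
    (S : Finset ℤ) : ∑ j ∈ S, ∑ l ∈ S, g (j - l)
      = ∑ k ∈ Finset.Icc (-(R : ℤ)) R, g k * ((S.filter fun j => j - k ∈ S).card : ℝ) := by
  have h1 : ∀ j l : ℤ, g (j - l)
      = ∑ k ∈ Finset.Icc (-(R : ℤ)) R, if l = j - k then g k else 0 := by
    intro j l
    have : ∀ k : ℤ, (l = j - k) ↔ (j - l = k) := fun k => by constructor <;> intro h <;> omega
    simp_rw [this]
    rw [Finset.sum_ite_eq]
    split_ifs with h
    · rfl
    · exact hg _ h
  simp_rw [h1]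
  have h2 : ∀ j, ∑ l ∈ S, ∑ k ∈ Finset.Icc (-(R : ℤ)) R, (if l = j - k then g k else 0)
      = ∑ k ∈ Finset.Icc (-(R : ℤ)) R, if j - k ∈ S then g k else 0 := by
    intro j
    rw [Finset.sum_comm]
    refine Finset.sum_congr rfl fun k _ => ?_
    rw [Finset.sum_ite_eq']
  simp_rw [h2]
  rw [Finset.sum_comm]
  refine Finset.sum_congr rfl fun k _ => ?_
  rw [← Finset.sum_filter, Finset.sum_const, nsmul_eq_mul, mul_comm]

/-- In the square `[0, N)²` the difference `k` occurs at least `N - |k|` and at most `N` times, so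
after division by `N` each `g k` gets a weight tending to one. -/
lemma tendsto_cesaro (g : ℤ → ℝ) {R : ℕ} (hg : ∀ k, k ∉ Finset.Icc (-(R : ℤ)) R → g k = 0) :
    Filter.Tendsto (fun N : ℕ => (N : ℝ)⁻¹ * ∑ j ∈ Finset.Ico (0 : ℤ) N,
      ∑ l ∈ Finset.Ico (0 : ℤ) N, g (j - l)) Filter.atTop
      (nhds (∑ k ∈ Finset.Icc (-(R : ℤ)) R, g k)) := by
  simp_rw [sum_sum_sub_eq g hg, Finset.mul_sum]
  refine tendsto_finsetSum _ fun k _ => ?_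
  have hc : ∀ N : ℕ, (N : ℝ) - |(k : ℝ)| ≤ (((Finset.Ico (0 : ℤ) N).filter
      fun j => j - k ∈ Finset.Ico (0 : ℤ) N).card : ℝ) ∧ (((Finset.Ico (0 : ℤ) N).filter
      fun j => j - k ∈ Finset.Ico (0 : ℤ) N).card : ℝ) ≤ N := by
    intro N
    have : (Finset.Ico (0 : ℤ) N).filter (fun j => j - k ∈ Finset.Ico (0 : ℤ) N)
        = Finset.Ico (max 0 k) (min (N : ℤ) (N + k)) := by
      ext j; simp only [Finset.mem_filter, Finset.mem_Ico]; omega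
    rw [this, Int.card_Ico]
    constructor
    · have h : (N : ℤ) - |k| ≤ ((min (N : ℤ) (N + k) - max 0 k).toNat : ℤ) := by
        rcases le_total 0 k with h | h
        · rw [abs_of_nonneg h]; omega
        · rw [abs_of_nonpos h]; omega
      rw [← Int.cast_abs]; exact_mod_cast h
    · exact_mod_cast (by omega : (min (N : ℤ) (N + k) - max 0 k).toNat ≤ N)
  have hlim : Filter.Tendsto (fun N : ℕ => (N : ℝ)⁻¹ * (((Finset.Ico (0 : ℤ) N).filter
      fun j => j - k ∈ Finset.Ico (0 : ℤ) N).card : ℝ)) Filter.atTop (nhds 1) := by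
    have h0 : Filter.Tendsto (fun N : ℕ => 1 - |(k : ℝ)| * (N : ℝ)⁻¹) Filter.atTop (nhds 1) := by
      simpa using (tendsto_inv_atTop_nhds_zero_nat (𝕜 := ℝ)).const_mul (|(k : ℝ)|)
        |>.const_sub 1
    refine tendsto_of_tendsto_of_tendsto_of_le_of_le' h0 tendsto_const_nhds ?_ ?_
    · filter_upwards [Filter.eventually_gt_atTop 0] with N hN
      have hN' : (0 : ℝ) < N := by exact_mod_cast hN
      have := mul_le_mul_of_nonneg_left (hc N).1 (inv_nonneg.2 hN'.le)
      refine le_trans (le_of_eq ?_) this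
      field_simp
    · filter_upwards [Filter.eventually_gt_atTop 0] with N hN
      have hN' : (0 : ℝ) < N := by exact_mod_cast hN
      have := mul_le_mul_of_nonneg_left (hc N).2 (inv_nonneg.2 hN'.le)
      rwa [inv_mul_cancel₀ hN'.ne'] at this
  have := hlim.const_mul (g k)
  rw [mul_one] at this
  refine this.congr fun N => by ring

lemma PosDefFun.add {φ φ' : ℝ → ℝ} (h : PosDefFun φ) (h' : PosDefFun φ') :
    PosDefFun (fun x => φ x + φ' x) := by
  intro ι S a w
  simp_rw [mul_add, Finset.sum_add_distrib]
  exact add_nonneg (h ι S a w) (h' ι S a w)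

lemma PosDefFun.const_mul {φ : ℝ → ℝ} (h : PosDefFun φ) {c : ℝ} (hc : 0 ≤ c) :
    PosDefFun (fun x => c * φ x) := by
  intro ι S a w
  simp_rw [mul_left_comm _ c, ← Finset.mul_sum]
  exact mul_nonneg hc (h ι S a w)

/-- The periodization `∑_k cos (k θ) φ(x - k)`. -/
def cosPeriod (φ : ℝ → ℝ) (θ x : ℝ) : ℝ := ∑' k : ℤ, Real.cos (k * θ) * φ (x - k)

lemma cosPeriod_eq {n : ℕ} {φ : ℝ → ℝ} (hφ : IsBump n φ) (θ : ℝ) {x : ℝ} {R : ℕ}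
    (hR : |x| + n + 1 ≤ R) :
    cosPeriod φ θ x = ∑ k ∈ Finset.Icc (-(R : ℤ)) R, Real.cos (k * θ) * φ (x - k) :=
  tsum_bump_eq hφ _ hR

/-- Clusters at the integers with weights `cos (j θ)` and `sin (j θ)` add up, by the addition
theorem, to a double sum of `cos ((j - l) θ) φ(x - (j - l))`. Divided by the number of points, it
tends to the periodization. -/
lemma posDefFun_cosPeriod {n : ℕ} {φ : ℝ → ℝ} (hφ : IsBump n φ) (θ : ℝ) :
    PosDefFun (cosPeriod φ θ) := by
  refine PosDefFun.of_tendsto (Φ := fun N x => (N : ℝ)⁻¹ * ∑ j ∈ Finset.Ico (0 : ℤ) N,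
      ∑ l ∈ Finset.Ico (0 : ℤ) N, Real.cos ((j - l : ℤ) * θ) * φ (x - (j - l : ℤ))) ?_ ?_
  · intro N
    have h1 := hφ.posDef.cluster (Finset.Ico (0 : ℤ) N) (fun j => -(j : ℝ))
      (fun j => Real.cos (j * θ))
    have h2 := hφ.posDef.cluster (Finset.Ico (0 : ℤ) N) (fun j => -(j : ℝ))
      (fun j => Real.sin (j * θ))
    have := (h1.add h2).const_mul (inv_nonneg.2 N.cast_nonneg : 0 ≤ (N : ℝ)⁻¹)
    convert this using 2 with x
    rw [← Finset.sum_add_distrib]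
    congr 1
    refine Finset.sum_congr rfl fun j _ => ?_
    rw [← Finset.sum_add_distrib]
    refine Finset.sum_congr rfl fun l _ => ?_
    push_cast
    rw [sub_mul, Real.cos_sub, show x + (-(j : ℝ) - -(l : ℝ)) = x - (j - l) by ring]; ring
  · intro x
    obtain ⟨R, hR⟩ := exists_nat_ge (|x| + n + 1)
    rw [cosPeriod_eq hφ θ hR]
    refine tendsto_cesaro (fun k => Real.cos (k * θ) * φ (x - k)) fun k hk => ?_
    rw [hφ.supp, mul_zero]
    have h1 := abs_sub_abs_le_abs_sub (k : ℝ) x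
    rw [abs_sub_comm] at h1
    have h2 : (R : ℝ) ≤ |(k : ℝ)| := by
      rw [Finset.mem_Icc, not_and_or, not_le, not_le] at hk
      rw [← Int.cast_abs]
      have : (R : ℤ) ≤ |k| := by
        rcases hk with hk | hk
        · exact le_trans (by omega) (neg_le_abs k)
        · exact le_trans (by omega) (le_abs_self k)
      exact_mod_cast this
    linarith

lemma sum_Icc_neg (R : ℕ) (g : ℤ → ℝ) :
    ∑ k ∈ Finset.Icc (-(R : ℤ)) R, g (-k) = ∑ k ∈ Finset.Icc (-(R : ℤ)) R, g k :=
  Finset.sum_nbij' (fun k => -k) (fun k => -k) (by simp; omega) (by simp; omega)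
    (by simp) (by simp) (by simp)

lemma cosPeriod_even {n : ℕ} {φ : ℝ → ℝ} (hφ : IsBump n φ) (θ x : ℝ) :
    cosPeriod φ θ (-x) = cosPeriod φ θ x := by
  obtain ⟨R, hR⟩ := exists_nat_ge (|x| + n + 1)
  rw [cosPeriod_eq hφ θ hR, cosPeriod_eq hφ θ (x := -x) (R := R) (by rwa [abs_neg]),
    ← sum_Icc_neg]
  refine Finset.sum_congr rfl fun k _ => ?_
  rw [← hφ.even]
  push_cast
  rw [neg_mul, Real.cos_neg]; congr 2; ring

/-- The symbol `∑_k b(k) cos (k θ)` of the B-spline collocation operator. -/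
def splineSymbol (n : ℕ) (θ : ℝ) : ℝ :=
  ∑ k ∈ Finset.Icc (-((n + 1 : ℕ) : ℤ)) (n + 1 : ℕ), bspline n k * Real.cos (k * θ)

lemma cosPeriod_bspline_zero (n : ℕ) (θ : ℝ) :
    cosPeriod (bspline n) θ 0 = splineSymbol n θ := by
  rw [cosPeriod_eq (isBump_bspline n) θ (R := n + 1) (by simp), splineSymbol]
  refine Finset.sum_congr rfl fun k _ => ?_
  rw [zero_sub, (isBump_bspline n).even, mul_comm]

lemma sum_bspline (n : ℕ) :
    ∑ k ∈ Finset.Icc (-((n + 1 : ℕ) : ℤ)) (n + 1 : ℕ), bspline n k = 1 := by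
  rw [← (isBump_bspline n).unity 0 (n + 1) (by simp)]
  refine Finset.sum_congr rfl fun k _ => ?_
  rw [zero_sub, (isBump_bspline n).even]

lemma continuous_splineSymbol (n : ℕ) : Continuous (splineSymbol n) := by
  unfold splineSymbol; fun_prop

lemma splineSymbol_le_one (n : ℕ) (θ : ℝ) : splineSymbol n θ ≤ 1 := by
  rw [← sum_bspline n]
  exact Finset.sum_le_sum fun k _ =>
    mul_le_of_le_one_right ((isBump_bspline n).nonneg _) (Real.cos_le_one _)

/-- The second derivative of a B-spline is the second difference of the B-spline two degrees lower,
and on periodizations with frequency `θ` a second difference acts at the origin as multiplication by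
`2 cos θ - 2`. Differentiating the zero function twice gives the claim. -/
lemma sd_cosPeriod (n : ℕ) (θ : ℝ) (h : ∀ x, cosPeriod (bspline (n + 1)) θ x = 0) :
    (2 - 2 * Real.cos θ) * splineSymbol n θ = 0 := by
  -- One finite window that contains every contributing index for all `|x| < 1`, so that the sum can
  -- be differentiated term by term near the origin.
  set R : ℕ := n + 4 with hR
  set g₂ := sd^[n + 1] (truncPow (2 * n + 3)) with hg2
  set g₁ := sd^[n + 1] (truncPow (2 * n + 2)) with hg1
  have hd2 : ∀ x, HasDerivAt (sd g₂) (sd g₁ x) x := fun x =>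
    sd_iterate_hasDerivAt 1 (fun x => (bspline_hasDerivAt n x).1) x
  have hd1 : ∀ x, HasDerivAt (sd g₁) (sd (bspline n) x) x := fun x =>
    sd_iterate_hasDerivAt 1 (fun x => (bspline_hasDerivAt n x).2) x
  have hF : ∀ x, HasDerivAt (fun x => ∑ k ∈ Finset.Icc (-(R : ℤ)) R,
      Real.cos (k * θ) * sd g₂ (x - k)) (∑ k ∈ Finset.Icc (-(R : ℤ)) R,
      Real.cos (k * θ) * sd g₁ (x - k)) x := fun x =>
    HasDerivAt.fun_sum fun k _ => ((hd2 _).comp_sub_const x _).const_mul _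
  have hF' : ∀ x, HasDerivAt (fun x => ∑ k ∈ Finset.Icc (-(R : ℤ)) R,
      Real.cos (k * θ) * sd g₁ (x - k)) (∑ k ∈ Finset.Icc (-(R : ℤ)) R,
      Real.cos (k * θ) * sd (bspline n) (x - k)) x := fun x =>
    HasDerivAt.fun_sum fun k _ => ((hd1 _).comp_sub_const x _).const_mul _
  have hz : ∀ x ∈ Set.Ioo (-1 : ℝ) 1, ∑ k ∈ Finset.Icc (-(R : ℤ)) R,
      Real.cos (k * θ) * sd g₂ (x - k) = 0 := by
    intro x hx
    rw [← h x, cosPeriod_eq (isBump_bspline (n + 1)) θ (R := R), bspline_succ]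
    have := (abs_lt.2 hx).le
    rw [hR]; push_cast; linarith
  have hz' : ∀ x ∈ Set.Ioo (-1 : ℝ) 1, ∑ k ∈ Finset.Icc (-(R : ℤ)) R,
      Real.cos (k * θ) * sd g₁ (x - k) = 0 := by
    intro x hx
    refine (hF x).unique ((hasDerivAt_const x (0 : ℝ)).congr_of_eventuallyEq ?_)
    filter_upwards [Ioo_mem_nhds hx.1 hx.2] with y hy using hz y hy
  have hz'' : ∑ k ∈ Finset.Icc (-(R : ℤ)) R,
      Real.cos (k * θ) * sd (bspline n) ((0 : ℝ) - k) = 0 := by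
    refine (hF' 0).unique ((hasDerivAt_const (0 : ℝ) (0 : ℝ)).congr_of_eventuallyEq ?_)
    filter_upwards [Ioo_mem_nhds (show (-1 : ℝ) < 0 by norm_num) one_pos] with y hy using hz' y hy
  have hb := isBump_bspline n
  have hshift : ∀ e : ℤ, |e| ≤ 1 → ∑ k ∈ Finset.Icc (-(R : ℤ)) R,
      Real.cos (k * θ) * bspline n (e - k) = cosPeriod (bspline n) θ e := by
    intro e he
    rw [cosPeriod_eq hb θ]
    have : (|e| : ℝ) ≤ 1 := by exact_mod_cast he
    rw [hR]; push_cast; linarith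
  have h0 := hshift 0 (by simp)
  have h1 := hshift 1 (by simp)
  have hm1 := hshift (-1) (by simp)
  -- Shifting the index by one rotates the phase by `θ`; the sine part drops out since the B-spline
  -- is even.
  have hval : cosPeriod (bspline n) θ 1 = Real.cos θ * splineSymbol n θ := by
    rw [← cosPeriod_bspline_zero, cosPeriod, cosPeriod]
    rw [← (Equiv.addRight (1 : ℤ)).tsum_eq]
    simp only [Equiv.coe_addRight, Int.cast_add, Int.cast_one, add_mul, one_mul, Real.cos_add]
    have hsin : ∑' k : ℤ, Real.sin (k * θ) * bspline n (0 - k) = 0 := by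
      rw [tsum_bump_eq hb (fun k => Real.sin (k * θ)) (R := n + 1) (by simp)]
      have := sum_Icc_neg (n + 1) (fun k => Real.sin (k * θ) * bspline n (0 - k))
      have h2 : ∀ k : ℤ, Real.sin ((-k : ℤ) * θ) * bspline n (0 - (-k : ℤ))
          = -(Real.sin (k * θ) * bspline n (0 - k)) := by
        intro k
        push_cast
        rw [neg_mul, Real.sin_neg, ← hb.even (0 - -(k : ℝ)),
          show -(0 - -(k : ℝ)) = 0 - k by ring]; ring
      simp_rw [h2, Finset.sum_neg_distrib] at this
      linarith
    have hs : ∀ a : ℤ → ℝ, Summable fun k : ℤ => a k * bspline n (0 - k) := by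
      intro a
      refine summable_of_ne_finset_zero (s := Finset.Icc (-((n + 1 : ℕ) : ℤ)) (n + 1 : ℕ))
        fun k hk => ?_
      rw [hb.supp, mul_zero]
      rw [zero_sub, abs_neg, ← Int.cast_abs]
      have : ((n : ℤ) + 1) ≤ |k| := by
        rw [Finset.mem_Icc, not_and_or, not_le, not_le] at hk
        rcases hk with hk | hk
        · exact le_trans (by push_cast at hk; omega) (neg_le_abs k)
        · exact le_trans (by push_cast at hk; omega) (le_abs_self k)
      exact_mod_cast this
    have e : ∀ k : ℤ, (Real.cos (k * θ) * Real.cos θ - Real.sin (k * θ) * Real.sin θ)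
        * bspline n (1 - (k + 1)) = Real.cos θ * (Real.cos (k * θ) * bspline n (0 - k))
          - Real.sin θ * (Real.sin (k * θ) * bspline n (0 - k)) := by
      intro k
      rw [show (1 : ℝ) - (k + 1) = 0 - k by ring]; ring
    simp_rw [e]
    rw [((hs _).mul_left _).tsum_sub ((hs _).mul_left _), tsum_mul_left, tsum_mul_left, hsin]
    ring
  have hval' : cosPeriod (bspline n) θ (-1) = Real.cos θ * splineSymbol n θ := by
    rw [cosPeriod_even hb, hval]
  have : ∑ k ∈ Finset.Icc (-(R : ℤ)) R, Real.cos (k * θ) * sd (bspline n) ((0 : ℝ) - k)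
      = Real.cos θ * splineSymbol n θ - 2 * splineSymbol n θ + Real.cos θ * splineSymbol n θ := by
    push_cast at h0 h1 hm1
    rw [cosPeriod_bspline_zero] at h0
    have e : ∀ k : ℤ, Real.cos (k * θ) * sd (bspline n) ((0 : ℝ) - k)
        = Real.cos (k * θ) * bspline n (1 - k) - 2 * (Real.cos (k * θ) * bspline n (0 - k))
          + Real.cos (k * θ) * bspline n (-1 - k) := by
      intro k
      rw [sd, show (0 : ℝ) - k + 1 = 1 - k by ring, show (0 : ℝ) - k - 1 = -1 - k by ring]; ring
    simp_rw [e]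
    rw [Finset.sum_add_distrib, Finset.sum_sub_distrib, ← Finset.mul_sum, h0, h1, hm1, hval, hval']
  linarith

/-- The symbol is the value at the origin of a positive definite even function, hence nonnegative.
Were it zero, that function would vanish identically, and `sd_cosPeriod` with the induction
hypothesis would force `cos θ = 1`. But for such `θ` the symbol is the sum of all B-spline values at
integers, which is one. -/
lemma splineSymbol_pos (n : ℕ) (θ : ℝ) : 0 < splineSymbol n θ := by
  induction n with
  | zero =>
    have h1 : ∀ k : ℤ, k ≠ 0 → bspline 0 k = 0 := fun k hk => (isBump_bspline 0).supp _ (by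
      rw [← Int.cast_abs]
      simpa using (by exact_mod_cast Int.one_le_abs hk : (1 : ℝ) ≤ ((|k| : ℤ) : ℝ)))
    rw [splineSymbol, Finset.sum_eq_single 0]
    · simp [bspline_zero]
    · intro k _ hk
      rw [h1 k hk, zero_mul]
    · simp
  | succ n ih =>
    have hb := isBump_bspline (n + 1)
    have hpd := posDefFun_cosPeriod hb θ
    have h0 : 0 ≤ splineSymbol (n + 1) θ := by
      rw [← cosPeriod_bspline_zero]; exact hpd.nonneg_zero
    refine lt_of_le_of_ne h0 fun hz => ?_
    have hall : ∀ x, cosPeriod (bspline (n + 1)) θ x = 0 := fun x => by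
      have := hpd.abs_le (cosPeriod_even hb θ) x
      rw [cosPeriod_bspline_zero, ← hz] at this
      exact abs_eq_zero.1 (le_antisymm this (abs_nonneg _))
    have hcos : Real.cos θ = 1 := by
      have := (mul_eq_zero.1 (sd_cosPeriod n θ hall)).resolve_right ih.ne'
      linarith
    obtain ⟨j, hj⟩ := (Real.cos_eq_one_iff θ).1 hcos
    have : splineSymbol (n + 1) θ = 1 := by
      rw [← sum_bspline (n + 1), splineSymbol]
      refine Finset.sum_congr rfl fun k _ => ?_
      rw [show (k : ℝ) * θ = (k * j : ℤ) * (2 * Real.pi) by rw [← hj]; push_cast; ring,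
        Real.cos_int_mul_two_pi, mul_one]
    linarith


/-! ### The inverse of the collocation operator -/

lemma summable_inv_one_add_abs_sq : Summable fun k : ℤ => ((1 + |(k : ℝ)|) ^ 2)⁻¹ := by
  have h : Summable fun n : ℕ => ((1 + (n : ℝ)) ^ 2)⁻¹ := by
    have := (summable_nat_add_iff 1).2 (Real.summable_nat_pow_inv.2 (by norm_num : 1 < 2))
    refine this.congr fun n => ?_
    push_cast; ring
  refine Summable.of_nat_of_neg ?_ ?_ <;> simpa using h

/-- The cosine coefficients of a function on `[0, 2π]`. -/
def cosCoeff (w : ℝ → ℝ) (k : ℤ) : ℝ :=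
  (2 * Real.pi)⁻¹ * ∫ θ in (0 : ℝ)..(2 * Real.pi), w θ * Real.cos (k * θ)

lemma cosCoeff_one (k : ℤ) : cosCoeff (fun _ => 1) k = if k = 0 then 1 else 0 := by
  unfold cosCoeff
  split_ifs with h
  · subst h
    simp; field_simp
  · have hk : (k : ℝ) ≠ 0 := by exact_mod_cast h
    simp only [one_mul]
    rw [intervalIntegral.integral_comp_mul_left (fun x => Real.cos x) hk, integral_cos]
    have : Real.sin ((k : ℝ) * (2 * Real.pi)) = 0 := by
      have := Real.sin_int_mul_pi (2 * k)
      push_cast at this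
      rw [← this]; ring_nf
    simp [this]

lemma cosCoeff_sub {w w' : ℝ → ℝ} (h : Continuous w) (h' : Continuous w') (k : ℤ) :
    cosCoeff (fun θ => w θ - w' θ) k = cosCoeff w k - cosCoeff w' k := by
  unfold cosCoeff
  rw [← mul_sub, ← intervalIntegral.integral_sub]
  · simp_rw [sub_mul]
  · exact (by fun_prop : Continuous fun θ => w θ * Real.cos (k * θ)).intervalIntegrable _ _
  · exact (by fun_prop : Continuous fun θ => w' θ * Real.cos (k * θ)).intervalIntegrable _ _

lemma abs_cosCoeff_le {w : ℝ → ℝ} {M : ℝ} (h : ∀ θ, |w θ| ≤ M) (k : ℤ) : |cosCoeff w k| ≤ M := by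
  have hpi := Real.pi_pos
  have := intervalIntegral.norm_integral_le_of_norm_le_const (a := 0) (b := 2 * Real.pi) (C := M)
    (f := fun θ => w θ * Real.cos (k * θ)) fun θ _ => by
      rw [Real.norm_eq_abs, abs_mul]
      exact (mul_le_of_le_one_right (abs_nonneg _) (Real.abs_cos_le_one _)).trans (h θ)
  rw [Real.norm_eq_abs, sub_zero, abs_of_pos (by positivity : (0 : ℝ) < 2 * Real.pi)] at this
  rw [cosCoeff, abs_mul, abs_of_pos (by positivity : (0 : ℝ) < (2 * Real.pi)⁻¹)]
  calc _ ≤ (2 * Real.pi)⁻¹ * (M * (2 * Real.pi)) := by gcongr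
    _ = M := by field_simp

lemma sum_bspline_mul_cos (n : ℕ) (k : ℤ) (θ : ℝ) :
    ∑ l ∈ Finset.Icc (-((n + 1 : ℕ) : ℤ)) (n + 1 : ℕ), bspline n l * Real.cos ((k - l : ℤ) * θ)
      = splineSymbol n θ * Real.cos (k * θ) := by
  have h := sum_Icc_neg (n + 1) (fun l => bspline n l * Real.sin (l * θ))
  have h2 : ∀ l : ℤ, bspline n (-l : ℤ) * Real.sin ((-l : ℤ) * θ)
      = -(bspline n l * Real.sin (l * θ)) := by
    intro l
    push_cast
    rw [(isBump_bspline n).even, neg_mul, Real.sin_neg, mul_neg]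
  simp_rw [h2, Finset.sum_neg_distrib] at h
  have h0 : ∑ l ∈ Finset.Icc (-((n + 1 : ℕ) : ℤ)) (n + 1 : ℕ), bspline n l * Real.sin (l * θ) = 0 := by
    linarith
  have e : ∀ l : ℤ, bspline n l * Real.cos ((k - l : ℤ) * θ)
      = bspline n l * Real.cos (l * θ) * Real.cos (k * θ)
        + bspline n l * Real.sin (l * θ) * Real.sin (k * θ) := by
    intro l
    push_cast
    rw [sub_mul, Real.cos_sub]; ring
  simp_rw [e]
  rw [Finset.sum_add_distrib, ← Finset.sum_mul, ← Finset.sum_mul, h0, zero_mul, add_zero]; rfl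

lemma sum_bspline_mul_cosCoeff (n : ℕ) {w : ℝ → ℝ} (hw : Continuous w) (k : ℤ) :
    ∑ l ∈ Finset.Icc (-((n + 1 : ℕ) : ℤ)) (n + 1 : ℕ), bspline n l * cosCoeff w (k - l)
      = cosCoeff (fun θ => w θ * splineSymbol n θ) k := by
  unfold cosCoeff
  have e : ∀ l : ℤ, bspline n l * ((2 * Real.pi)⁻¹ * ∫ θ in (0 : ℝ)..(2 * Real.pi),
        w θ * Real.cos ((k - l : ℤ) * θ))
      = (2 * Real.pi)⁻¹ * ∫ θ in (0 : ℝ)..(2 * Real.pi),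
        w θ * (bspline n l * Real.cos ((k - l : ℤ) * θ)) := by
    intro l
    rw [mul_left_comm, ← intervalIntegral.integral_const_mul]
    congr 2; funext θ; ring
  simp_rw [e]
  rw [← Finset.mul_sum, ← intervalIntegral.integral_finsetSum]
  · simp_rw [← Finset.mul_sum, sum_bspline_mul_cos, mul_assoc]
  · intro l _
    exact (by fun_prop : Continuous fun θ => w θ * (bspline n l *
      Real.cos ((k - l : ℤ) * θ))).intervalIntegrable _ _

/-- The coefficients of the inverse of the B-spline collocation operator. -/
def splineCoeff (n : ℕ) (k : ℤ) : ℝ := cosCoeff (fun θ => (splineSymbol n θ)⁻¹) k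

lemma continuous_inv_splineSymbol (n : ℕ) : Continuous fun θ => (splineSymbol n θ)⁻¹ :=
  (continuous_splineSymbol n).inv₀ fun θ => (splineSymbol_pos n θ).ne'

lemma sum_bspline_mul_splineCoeff (n : ℕ) (k : ℤ) :
    ∑ l ∈ Finset.Icc (-((n + 1 : ℕ) : ℤ)) (n + 1 : ℕ), bspline n l * splineCoeff n (k - l)
      = if k = 0 then 1 else 0 := by
  unfold splineCoeff
  rw [sum_bspline_mul_cosCoeff n (continuous_inv_splineSymbol n), ← cosCoeff_one]
  congr 1; funext θ
  exact inv_mul_cancel₀ (splineSymbol_pos n θ).ne'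

lemma splineCoeff_neg (n : ℕ) (k : ℤ) : splineCoeff n (-k) = splineCoeff n k := by
  unfold splineCoeff cosCoeff
  simp [Real.cos_neg]

/-- The function is a cosine polynomial of degree at most `N (n + 1)`. Each further factor `1 - σ`,
with `σ` the symbol, is a convolution on the coefficient side and reaches `n + 1` indices further.
-/
lemma cosCoeff_pow_eq_zero (n N : ℕ) (k : ℤ) (hk : N * (n + 1) < |k|) :
    cosCoeff (fun θ => (1 - splineSymbol n θ) ^ N) k = 0 := by
  have hc := continuous_splineSymbol n
  induction N generalizing k with
  | zero =>
    simp only [pow_zero]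
    rw [cosCoeff_one, if_neg]
    rintro rfl; simp at hk
  | succ N ih =>
    have e : (fun θ => (1 - splineSymbol n θ) ^ (N + 1)) = fun θ => (1 - splineSymbol n θ) ^ N
        - (1 - splineSymbol n θ) ^ N * splineSymbol n θ := by funext θ; ring
    rw [e, cosCoeff_sub (by fun_prop) (by fun_prop),
      ← sum_bspline_mul_cosCoeff n (by fun_prop : Continuous fun θ => (1 - splineSymbol n θ) ^ N)]
    push_cast at hk
    rw [ih k (by nlinarith), Finset.sum_eq_zero, sub_zero]
    intro l hl
    rw [ih, mul_zero]
    rw [Finset.mem_Icc] at hl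
    push_cast at hl
    have h1 : |l| ≤ n + 1 := abs_le.2 ⟨by linarith, hl.2⟩
    have h2 := abs_sub_abs_le_abs_sub k l
    nlinarith

lemma exists_splineSymbol_ge (n : ℕ) : ∃ b > 0, b ≤ 1 ∧ ∀ θ, b ≤ splineSymbol n θ := by
  obtain ⟨θ₀, -, h⟩ := isCompact_Icc.exists_isMinOn (Set.nonempty_Icc.2 Real.two_pi_pos.le)
    (continuous_splineSymbol n).continuousOn
  refine ⟨splineSymbol n θ₀, splineSymbol_pos n θ₀, splineSymbol_le_one n θ₀, fun θ => ?_⟩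
  have hper : Function.Periodic (splineSymbol n) (2 * Real.pi) := by
    intro θ
    refine Finset.sum_congr rfl fun k _ => ?_
    rw [mul_add, Real.cos_add_int_mul_two_pi]
  obtain ⟨y, hy, hy'⟩ := hper.exists_mem_Ico₀ Real.two_pi_pos θ
  rw [hy']
  exact h (Set.Ico_subset_Icc_self hy)

/-- With `σ` the symbol, `1 / σ = ∑_{m < N} (1 - σ)^m + (1 - σ)^N / σ`. The powers below `N` have
degree less than `|k|` and do not contribute to the coefficient `k`; the remainder is at most `(1 -
b)^N / b`. -/
lemma abs_splineCoeff_le {n : ℕ} {b : ℝ} (hb : 0 < b) (h : ∀ θ, b ≤ splineSymbol n θ) (N : ℕ)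
    (k : ℤ) (hk : N * (n + 1) ≤ |k|) : |splineCoeff n k| ≤ (1 - b) ^ N * b⁻¹ := by
  have hc := continuous_splineSymbol n
  have hci := continuous_inv_splineSymbol n
  have key : ∀ N : ℕ, N * (n + 1) ≤ |k| → splineCoeff n k
      = cosCoeff (fun θ => (1 - splineSymbol n θ) ^ N * (splineSymbol n θ)⁻¹) k := by
    intro N
    induction N with
    | zero => intro _; simp [splineCoeff]
    | succ N ih =>
      intro hN
      push_cast at hN
      have h0 := cosCoeff_pow_eq_zero n N k (by linarith)
      rw [ih (by linarith)]
      have e : (fun θ => (1 - splineSymbol n θ) ^ (N + 1) * (splineSymbol n θ)⁻¹)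
          = fun θ => (1 - splineSymbol n θ) ^ N * (splineSymbol n θ)⁻¹
            - (1 - splineSymbol n θ) ^ N := by
        funext θ
        have := (splineSymbol_pos n θ).ne'
        field_simp; ring
      rw [e, cosCoeff_sub (by fun_prop) (by fun_prop), h0, sub_zero]
  rw [key N hk]
  refine abs_cosCoeff_le (fun θ => ?_) k
  have h1 := splineSymbol_le_one n θ
  have h2 := splineSymbol_pos n θ
  rw [abs_of_nonneg (mul_nonneg (pow_nonneg (by linarith) _) (inv_nonneg.2 h2.le))]
  exact mul_le_mul (pow_le_pow_left₀ (by linarith) (by linarith [h θ]) _)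
    (inv_anti₀ hb (h θ)) (inv_nonneg.2 h2.le) (pow_nonneg (by linarith [h θ]) _)

/-- With `N` the integer part of `|k| / (n + 1)` the preceding bound is geometric in `|k|`, which
beats every power. -/
lemma splineCoeff_decay (n E : ℕ) : ∃ C, ∀ k : ℤ, |splineCoeff n k| * (1 + |(k : ℝ)|) ^ E ≤ C := by
  obtain ⟨b, hb, hb1, h⟩ := exists_splineSymbol_ge n
  obtain ⟨B, hB⟩ := (tendsto_pow_const_mul_const_pow_of_lt_one E (r := 1 - b) (by linarith)
    (by linarith)).bddAbove_range
  have hB' : ∀ N : ℕ, ((N : ℝ) + 1) ^ E * (1 - b) ^ N ≤ 2 ^ E * B + 1 := by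
    intro N
    have hBN : (N : ℝ) ^ E * (1 - b) ^ N ≤ B := hB ⟨N, rfl⟩
    have hB0 : 0 ≤ B := le_trans (mul_nonneg (by positivity) (pow_nonneg (by linarith) _)) hBN
    rcases Nat.eq_zero_or_pos N with rfl | hN
    · simp; positivity
    · have : (1 : ℝ) ≤ N := by exact_mod_cast hN
      calc _ ≤ (2 * (N : ℝ)) ^ E * (1 - b) ^ N := by
            refine mul_le_mul_of_nonneg_right ?_ (pow_nonneg (by linarith) _)
            exact pow_le_pow_left₀ (by positivity) (by linarith) _
        _ = 2 ^ E * ((N : ℝ) ^ E * (1 - b) ^ N) := by ring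
        _ ≤ 2 ^ E * B := by gcongr
        _ ≤ _ := by linarith
  refine ⟨((n : ℝ) + 1) ^ E * (2 ^ E * B + 1) * b⁻¹, fun k => ?_⟩
  set N := k.natAbs / (n + 1) with hN
  have h1 : N * (n + 1) ≤ k.natAbs := Nat.div_mul_le_self _ _
  have h2 : k.natAbs + 1 ≤ (N + 1) * (n + 1) := by
    rw [mul_comm]
    exact Nat.lt_mul_div_succ k.natAbs (Nat.succ_pos n)
  have hk := abs_splineCoeff_le hb h N k (by rw [← Int.natCast_natAbs]; exact_mod_cast h1)
  have h3 : 1 + |(k : ℝ)| ≤ ((N : ℝ) + 1) * (n + 1) := by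
    have : ((k.natAbs + 1 : ℕ) : ℝ) ≤ ((N + 1) * (n + 1) : ℕ) := by exact_mod_cast h2
    push_cast [Nat.cast_natAbs] at this; linarith
  calc _ ≤ ((1 - b) ^ N * b⁻¹) * (((N : ℝ) + 1) * (n + 1)) ^ E := by gcongr
    _ = ((n : ℝ) + 1) ^ E * (((N : ℝ) + 1) ^ E * (1 - b) ^ N) * b⁻¹ := by rw [mul_pow]; ring
    _ ≤ _ := by
      refine mul_le_mul_of_nonneg_right ?_ (inv_nonneg.2 hb.le)
      exact mul_le_mul_of_nonneg_left (hB' N) (by positivity)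

/-! ### The kernel of cardinal spline interpolation -/

/-- The series `∑_k a_k b(x - k)` of B-splines of degree `2 n + 1`. -/
def splineSeries (n : ℕ) (a : ℤ → ℝ) (x : ℝ) : ℝ := ∑' k : ℤ, a k * bspline n (x - k)

/-- The fundamental function of cardinal spline interpolation of degree `2 n + 1`. -/
def splineKernel (n : ℕ) : ℝ → ℝ := splineSeries n (splineCoeff n)

lemma splineSeries_eq (n : ℕ) (a : ℤ → ℝ) {x : ℝ} {R : ℕ} (hR : |x| + n + 1 ≤ R) :
    splineSeries n a x = ∑ k ∈ Finset.Icc (-(R : ℤ)) R, a k * bspline n (x - k) :=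
  tsum_bump_eq (isBump_bspline n) a hR

lemma splineSeries_shift (n : ℕ) (a : ℤ → ℝ) (x : ℝ) (j : ℤ) :
    splineSeries n a (x - j) = splineSeries n (fun k => a (k - j)) x := by
  unfold splineSeries
  rw [← (Equiv.addRight j).tsum_eq (fun k : ℤ => a (k - j) * bspline n (x - k))]
  refine tsum_congr fun k => ?_
  simp only [Equiv.coe_addRight, add_sub_cancel_right]
  push_cast
  congr 2; ring

lemma splineSeries_int (n : ℕ) (a : ℤ → ℝ) (i : ℤ) : splineSeries n a i
    = ∑ l ∈ Finset.Icc (-((n + 1 : ℕ) : ℤ)) (n + 1 : ℕ), bspline n l * a (i - l) := by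
  have := splineSeries_shift n (fun k => a (k + i)) i i
  simp only [sub_add_cancel] at this
  rw [← this, sub_self, splineSeries_eq n _ (R := n + 1) (by simp), ← sum_Icc_neg]
  refine Finset.sum_congr rfl fun k _ => ?_
  rw [mul_comm, show -k + i = i - k by ring]; push_cast; simp

/-- Inserting the integral for the coefficients shows the kernel to be the mean over `θ` of the
periodized B-spline divided by its symbol: positive definite functions with positive weights. -/
lemma posDefFun_splineKernel (n : ℕ) : PosDefFun (splineKernel n) := by
  have hb := isBump_bspline n
  have hci := continuous_inv_splineSymbol n
  have hK : ∀ x, splineKernel n x = (2 * Real.pi)⁻¹ * ∫ θ in (0 : ℝ)..(2 * Real.pi),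
      (splineSymbol n θ)⁻¹ * cosPeriod (bspline n) θ x := by
    intro x
    obtain ⟨R, hR⟩ := exists_nat_ge (|x| + n + 1)
    rw [splineKernel, splineSeries_eq n _ hR]
    simp_rw [cosPeriod_eq hb _ hR, splineCoeff, cosCoeff, mul_assoc, Finset.mul_sum]
    rw [← Finset.mul_sum, intervalIntegral.integral_finsetSum]
    · congr 1
      refine Finset.sum_congr rfl fun k _ => ?_
      rw [← intervalIntegral.integral_mul_const]
      simp_rw [mul_assoc]
    · intro k _
      exact (by fun_prop : Continuous fun θ => (splineSymbol n θ)⁻¹ *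
        (Real.cos (k * θ) * bspline n (x - k))).intervalIntegrable _ _
  have hcont : ∀ x, Continuous fun θ => cosPeriod (bspline n) θ x := by
    intro x
    obtain ⟨R, hR⟩ := exists_nat_ge (|x| + n + 1)
    simp_rw [cosPeriod_eq hb _ hR]
    fun_prop
  intro ι S a w
  have : ∑ i ∈ S, ∑ j ∈ S, w i * w j * splineKernel n (a i - a j)
      = (2 * Real.pi)⁻¹ * ∫ θ in (0 : ℝ)..(2 * Real.pi), (splineSymbol n θ)⁻¹ *
        ∑ i ∈ S, ∑ j ∈ S, w i * w j * cosPeriod (bspline n) θ (a i - a j) := by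
    simp_rw [Finset.mul_sum]
    rw [intervalIntegral.integral_finsetSum, Finset.mul_sum]
    · refine Finset.sum_congr rfl fun i _ => ?_
      rw [intervalIntegral.integral_finsetSum, Finset.mul_sum]
      · refine Finset.sum_congr rfl fun j _ => ?_
        rw [hK, mul_left_comm, ← intervalIntegral.integral_const_mul]
        congr 2; funext θ; ring
      · intro j _
        have := hcont (a i - a j)
        exact (by fun_prop : Continuous fun θ => (splineSymbol n θ)⁻¹ *
          (w i * w j * cosPeriod (bspline n) θ (a i - a j))).intervalIntegrable _ _
    · intro i _
      refine (continuous_finsetSum _ fun j _ => ?_).intervalIntegrable _ _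
      have := hcont (a i - a j)
      fun_prop
  rw [this]
  refine mul_nonneg (by positivity) (intervalIntegral.integral_nonneg Real.two_pi_pos.le
    fun θ _ => mul_nonneg (inv_nonneg.2 (splineSymbol_pos n θ).le)
      (posDefFun_cosPeriod hb θ ι S a w))

lemma splineKernel_int (n : ℕ) (k : ℤ) : splineKernel n k = if k = 0 then 1 else 0 := by
  rw [splineKernel, splineSeries_int, sum_bspline_mul_splineCoeff]

lemma splineKernel_even (n : ℕ) (x : ℝ) : splineKernel n (-x) = splineKernel n x := by
  unfold splineKernel splineSeries
  rw [← (Equiv.neg ℤ).tsum_eq]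
  refine tsum_congr fun k => ?_
  rw [Equiv.neg_apply, splineCoeff_neg, ← (isBump_bspline n).even]
  push_cast
  congr 2; ring

lemma one_add_abs_le_mul (x y : ℝ) : 1 + |x| ≤ (1 + |y|) * (1 + |x - y|) := by
  have := abs_sub_abs_le_abs_sub x y
  nlinarith [abs_nonneg y, abs_nonneg (x - y)]

/-- B-splines are nonnegative with sum one, so the series is a weighted mean of the coefficients at
distance at most `n + 1`. -/
lemma abs_splineSeries_le (n : ℕ) {a : ℤ → ℝ} {x A : ℝ}
    (h : ∀ k : ℤ, |x - k| ≤ n + 1 → |a k| ≤ A) : |splineSeries n a x| ≤ A := by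
  have hb := isBump_bspline n
  obtain ⟨R, hR⟩ := exists_nat_ge (|x| + n + 1)
  rw [splineSeries_eq n _ hR]
  calc _ ≤ ∑ k ∈ Finset.Icc (-(R : ℤ)) R, A * bspline n (x - (k : ℤ)) := by
        refine (Finset.abs_sum_le_sum_abs _ _).trans (Finset.sum_le_sum fun k _ => ?_)
        rw [abs_mul, abs_of_nonneg (hb.nonneg _)]
        by_cases hk : |x - k| ≤ n + 1
        · exact mul_le_mul_of_nonneg_right (h k hk) (hb.nonneg _)
        · rw [hb.supp _ (not_le.1 hk).le]; simp
    _ = A := by rw [← Finset.mul_sum, hb.unity x R hR, mul_one]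

lemma splineSeries_growth (n E : ℕ) {a : ℤ → ℝ} {C : ℝ}
    (h : ∀ k : ℤ, |a k| ≤ C * (1 + |(k : ℝ)|) ^ E) :
    ∀ x, |splineSeries n a x| ≤ C * (n + 2) ^ E * (1 + |x|) ^ E := by
  have hC : 0 ≤ C := by
    have := (abs_nonneg _).trans (h 0); simpa using this
  intro x
  refine abs_splineSeries_le n fun k hk => (h k).trans ?_
  rw [mul_assoc, ← mul_pow]
  refine mul_le_mul_of_nonneg_left (pow_le_pow_left₀ (by positivity) ?_ _) hC
  have := one_add_abs_le_mul k x
  rw [abs_sub_comm] at this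
  nlinarith [abs_nonneg x]

lemma splineKernel_decay (n E : ℕ) : ∃ C, ∀ x, |splineKernel n x| * (1 + |x|) ^ E ≤ C := by
  obtain ⟨C, hC⟩ := splineCoeff_decay n E
  have hC0 : 0 ≤ C := le_trans (by positivity) (hC 0)
  refine ⟨C * (n + 2) ^ E, fun x => ?_⟩
  rw [← le_div_iff₀ (by positivity)]
  refine abs_splineSeries_le n fun k hk => ?_
  rw [le_div_iff₀ (by positivity)]
  calc _ ≤ |splineCoeff n k| * ((1 + |(k : ℝ)|) * (n + 2)) ^ E := by
        gcongr
        have := one_add_abs_le_mul x k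
        nlinarith [abs_nonneg (k : ℝ)]
    _ = |splineCoeff n k| * (1 + |(k : ℝ)|) ^ E * (n + 2) ^ E := by rw [mul_pow]; ring
    _ ≤ _ := by gcongr; exact hC k

lemma splineKernel_lip (n E : ℕ) : ∃ C, ∀ (k : ℤ) (s : ℝ), |s| ≤ |(k : ℝ)| / 2 →
    |splineKernel n (k + s) - splineKernel n k| * (1 + |(k : ℝ)|) ^ E ≤ C * |s| := by
  have hb := isBump_bspline n
  obtain ⟨C, hC⟩ := splineCoeff_decay n (E + 2)
  have hC0 : 0 ≤ C := le_trans (by positivity) (hC 0)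
  set Z := ∑' l : ℤ, ((1 + |(l : ℝ)|) ^ 2)⁻¹ with hZ
  refine ⟨C * (2 * (n + 2)) ^ E * Z, fun k s hs => ?_⟩
  obtain ⟨R, hR⟩ := exists_nat_ge (|(k : ℝ)| + |s| + n + 1)
  have hR1 : |(k : ℝ) + s| + n + 1 ≤ R := by linarith [abs_add_le (k : ℝ) s]
  have hR2 : |(k : ℝ)| + n + 1 ≤ R := by linarith [abs_nonneg s]
  rw [splineKernel, splineSeries_eq n _ hR1, splineSeries_eq n _ hR2, ← Finset.sum_sub_distrib]
  have hterm : ∀ l : ℤ, |splineCoeff n l * bspline n (k + s - l)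
      - splineCoeff n l * bspline n (k - l)| * (1 + |(k : ℝ)|) ^ E
        ≤ C * (2 * (n + 2)) ^ E * |s| * ((1 + |(l : ℝ)|) ^ 2)⁻¹ := by
    intro l
    rw [← mul_sub, abs_mul]
    by_cases hl : |(k : ℝ) + s - l| ≤ n + 1 ∨ |(k : ℝ) - l| ≤ n + 1
    · have h1 : 1 + |(k : ℝ)| ≤ (1 + |(l : ℝ)|) * (2 * (n + 2)) := by
        rcases hl with hl | hl
        · have h2 := one_add_abs_le_mul (k + s) l
          have h3 : |(k : ℝ)| ≤ |(k : ℝ) + s| + |s| := by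
            have := abs_sub_abs_le_abs_sub (k : ℝ) (-s)
            rw [abs_neg, sub_neg_eq_add] at this; linarith
          nlinarith [abs_nonneg (l : ℝ)]
        · have h2 := one_add_abs_le_mul k l
          nlinarith [abs_nonneg (l : ℝ)]
      have h2 : |bspline n (k + s - l) - bspline n (k - l)| ≤ |s| := by
        refine (hb.lip _ _).trans (le_of_eq ?_)
        congr 1; ring
      rw [← div_eq_mul_inv, le_div_iff₀ (by positivity)]
      calc _ ≤ |splineCoeff n l| * |s| * ((1 + |(l : ℝ)|) * (2 * (n + 2))) ^ E
            * (1 + |(l : ℝ)|) ^ 2 := by gcongr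
        _ = |splineCoeff n l| * (1 + |(l : ℝ)|) ^ (E + 2) * (2 * (n + 2)) ^ E * |s| := by
            rw [mul_pow]; ring
        _ ≤ _ := by gcongr; exact hC l
    · rw [not_or, not_le, not_le] at hl
      rw [hb.supp _ hl.1.le, hb.supp _ hl.2.le]
      simp; positivity
  calc _ ≤ ∑ l ∈ Finset.Icc (-(R : ℤ)) R, C * (2 * (n + 2)) ^ E * |s| *
          ((1 + |(l : ℝ)|) ^ 2)⁻¹ := by
        refine (mul_le_mul_of_nonneg_right (Finset.abs_sum_le_sum_abs _ _) (by positivity)).trans ?_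
        rw [Finset.sum_mul]
        exact Finset.sum_le_sum fun l _ => hterm l
    _ ≤ C * (2 * (n + 2)) ^ E * |s| * Z := by
        rw [← Finset.mul_sum]
        refine mul_le_mul_of_nonneg_left ?_ (by positivity)
        exact summable_inv_one_add_abs_sq.sum_le_tsum _ fun l _ => by positivity
    _ = _ := by ring


/-! ### Uniqueness of cardinal splines of polynomial growth -/

lemma sd_iterate_add (m : ℕ) (g g' : ℝ → ℝ) (x : ℝ) :
    sd^[m] (fun x => g x + g' x) x = sd^[m] g x + sd^[m] g' x := by
  simp_rw [sd_iterate_eq_sum, mul_add, Finset.sum_add_distrib]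

lemma iteratedDeriv_polynomial (P : ℝ[X]) (k : ℕ) (x : ℝ) :
    iteratedDeriv k (fun x => P.eval x) x = (derivative^[k] P).eval x := by
  induction k generalizing P with
  | zero => simp
  | succ k ih =>
    rw [iteratedDeriv_succ', Function.iterate_succ_apply, ← ih]
    congr 1; funext y; exact P.deriv

/-- The endpoints are included: where the function is smooth, its derivatives are determined from
one side. This is what matches neighbouring pieces at a knot. -/
lemma iteratedDeriv_eq_of_eqOn_Icc {s : ℝ → ℝ} {N k : ℕ} (hs : ContDiff ℝ (N : WithTop ℕ∞) s)
    (hk : k ≤ N) {a b : ℝ} (hab : a < b) {P : ℝ[X]} (hP : ∀ x ∈ Set.Icc a b, s x = P.eval x)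
    {x : ℝ} (hx : x ∈ Set.Icc a b) : iteratedDeriv k s x = (derivative^[k] P).eval x := by
  have hu := uniqueDiffOn_Icc hab
  have hPc : ContDiff ℝ (k : WithTop ℕ∞) (fun x => P.eval x) := by
    simpa using P.contDiff_aeval (𝕜 := ℝ) k
  rw [← iteratedDeriv_polynomial, ← iteratedDerivWithin_eq_iteratedDeriv hu
      ((hs.of_le (by exact_mod_cast hk)).contDiffAt) hx,
    ← iteratedDerivWithin_eq_iteratedDeriv hu (hPc.contDiffAt) hx]
  exact iteratedDerivWithin_congr hP hx

/-- All derivatives up to order `p - 1` of the two pieces agree at the knot, so their difference has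
there a zero of multiplicity `p` while its degree is at most `p`. -/
lemma exists_jump {p : ℕ} {s : ℝ → ℝ} (hp : 1 ≤ p)
    (hs : ContDiff ℝ ((p - 1 : ℕ) : WithTop ℕ∞) s) {a x b : ℝ}
    (h1 : a < x) (h2 : x < b) {P Q : ℝ[X]} (hP : ∀ y ∈ Set.Icc a x, s y = P.eval y)
    (hQ : ∀ y ∈ Set.Icc x b, s y = Q.eval y) (hPd : P.natDegree ≤ p) (hQd : Q.natDegree ≤ p) :
    Q = P + C (Q.coeff p - P.coeff p) * (X - C x) ^ p := by
  set D := Q - P with hD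
  have hroot : ∀ k ≤ p - 1, (derivative^[k] D).IsRoot x := by
    intro k hk
    have e1 := iteratedDeriv_eq_of_eqOn_Icc hs hk h1 hP (Set.right_mem_Icc.2 h1.le)
    have e2 := iteratedDeriv_eq_of_eqOn_Icc hs hk h2 hQ (Set.left_mem_Icc.2 h2.le)
    rw [IsRoot, hD, iterate_derivative_sub, eval_sub, ← e1, ← e2, sub_self]
  have hdeg : D.natDegree ≤ p := (natDegree_sub_le _ _).trans (max_le hQd hPd)
  have hmon : ((X - C x : ℝ[X]) ^ p).Monic := (monic_X_sub_C x).pow p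
  have hnd : ((X - C x : ℝ[X]) ^ p).natDegree = p := by
    rw [(monic_X_sub_C x).natDegree_pow]; simp
  obtain ⟨r, hr⟩ : ∃ r : ℝ, D = C r * (X - C x) ^ p := by
    by_cases h0 : D = 0
    · exact ⟨0, by simp [h0]⟩
    have hm := (lt_rootMultiplicity_iff_isRoot_iterate_derivative h0).2 hroot
    obtain ⟨q, hq⟩ := (le_rootMultiplicity_iff h0).1 (by omega : p ≤ D.rootMultiplicity x)
    have hq0 : q ≠ 0 := by rintro rfl; simp at hq; exact h0 hq
    have : D.natDegree = p + q.natDegree := by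
      rw [hq, hmon.natDegree_mul' hq0, hnd]
    have hq' := eq_C_of_natDegree_eq_zero (by omega : q.natDegree = 0)
    exact ⟨q.coeff 0, by rw [hq, mul_comm]; congr 1⟩
  have hc : D.coeff p = r := by
    rw [hr, coeff_C_mul]
    have : ((X - C x : ℝ[X]) ^ p).coeff p = 1 := by
      have := hmon.coeff_natDegree; rwa [hnd] at this
    rw [this, mul_one]
  rw [← coeff_sub, ← hD, hc, ← hr, hD]; ring

/-- The leading coefficient is a divided difference over `p + 1` equidistant points of the interval;
the resulting constant does not depend on the position of the interval. -/
lemma exists_coeff_bound (p : ℕ) (hp : 1 ≤ p) : ∃ K, 0 ≤ K ∧ ∀ (P : ℝ[X]) (a A : ℝ),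
    P.natDegree ≤ p → (∀ x ∈ Set.Icc a (a + 1), |P.eval x| ≤ A) → |P.coeff p| ≤ K * A := by
  classical
  refine ⟨∑ i ∈ Finset.range (p + 1),
    |∏ j ∈ (Finset.range (p + 1)).erase i, (((i : ℝ) - j) / p)|⁻¹,
    Finset.sum_nonneg fun _ _ => inv_nonneg.2 (abs_nonneg _), fun P a A hP hA => ?_⟩
  have hp0 : (0 : ℝ) < p := by exact_mod_cast hp
  have h := Lagrange.coeff_eq_sum (s := Finset.range (p + 1)) (v := fun i : ℕ => a + (i : ℝ) / p)
    (fun i _ j _ hij => by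
      simp only [add_right_inj] at hij
      rw [div_left_inj' hp0.ne'] at hij
      exact_mod_cast hij) (P := P)
    ((degree_le_natDegree).trans_lt (by rw [Finset.card_range]; exact_mod_cast Nat.lt_succ_of_le hP))
  rw [Finset.card_range, Nat.add_sub_cancel] at h
  rw [h, Finset.sum_mul]
  refine (Finset.abs_sum_le_sum_abs _ _).trans (Finset.sum_le_sum fun i hi => ?_)
  have e : ∀ j : ℕ, a + (i : ℝ) / p - (a + (j : ℝ) / p) = ((i : ℝ) - j) / p := fun j => by ring
  simp_rw [e]
  rw [abs_div, div_eq_inv_mul]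
  refine mul_le_mul_of_nonneg_left (hA _ ?_) (inv_nonneg.2 (abs_nonneg _))
  have : (i : ℝ) ≤ p := by exact_mod_cast Nat.lt_succ_iff.1 (Finset.mem_range.1 hi)
  have h1 : (i : ℝ) / p ≤ 1 := (div_le_one hp0).2 this
  have h2 : 0 ≤ (i : ℝ) / p := by positivity
  exact ⟨by linarith, by linarith⟩

/-- Convolution with the coefficients of the inverse collocation operator. -/
def splineConv (n : ℕ) (v : ℤ → ℝ) (k : ℤ) : ℝ := ∑' j : ℤ, splineCoeff n (k - j) * v j

lemma splineConv_bound (n E : ℕ) : ∃ K, 0 ≤ K ∧ ∀ (v : ℤ → ℝ) (C : ℝ),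
    (∀ j, |v j| ≤ C * (1 + |(j : ℝ)|) ^ E) → (∀ k, Summable fun j => splineCoeff n (k - j) * v j) ∧
    ∀ k, |splineConv n v k| ≤ K * C * (1 + |(k : ℝ)|) ^ E := by
  obtain ⟨A, hA⟩ := splineCoeff_decay n (E + 2)
  have hA0 : 0 ≤ A := le_trans (by positivity) (hA 0)
  refine ⟨A * ∑' j : ℤ, ((1 + |(j : ℝ)|) ^ 2)⁻¹,
    mul_nonneg hA0 (tsum_nonneg fun _ => by positivity), fun v C hv => ?_⟩
  have hC : 0 ≤ C := by
    have := (abs_nonneg _).trans (hv 0); simpa using this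
  have hterm : ∀ k j : ℤ, ‖splineCoeff n (k - j) * v j‖
      ≤ A * C * (1 + |(k : ℝ)|) ^ E * ((1 + |((k - j : ℤ) : ℝ)|) ^ 2)⁻¹ := by
    intro k j
    rw [Real.norm_eq_abs, abs_mul, ← div_eq_mul_inv, le_div_iff₀ (by positivity)]
    have h1 := one_add_abs_le_mul (j : ℝ) k
    rw [abs_sub_comm, ← Int.cast_sub] at h1
    calc _ ≤ |splineCoeff n (k - j)| * (C * ((1 + |(k : ℝ)|) * (1 + |((k - j : ℤ) : ℝ)|)) ^ E)
          * (1 + |((k - j : ℤ) : ℝ)|) ^ 2 := by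
          gcongr
          refine (hv j).trans ?_
          gcongr
      _ = (|splineCoeff n (k - j)| * (1 + |((k - j : ℤ) : ℝ)|) ^ (E + 2)) * C
          * (1 + |(k : ℝ)|) ^ E := by rw [mul_pow]; ring
      _ ≤ A * C * (1 + |(k : ℝ)|) ^ E := by gcongr; exact hA _
  have hsum : ∀ k : ℤ, Summable fun j : ℤ => ((1 + |((k - j : ℤ) : ℝ)|) ^ 2)⁻¹ := fun k =>
    (Equiv.subLeft k).summable_iff (f := fun j : ℤ => ((1 + |(j : ℝ)|) ^ 2)⁻¹) |>.2
      summable_inv_one_add_abs_sq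
  refine ⟨fun k => Summable.of_norm_bounded ((hsum k).mul_left _) (hterm k), fun k => ?_⟩
  have := tsum_of_norm_bounded ((hsum k).mul_left (A * C * (1 + |(k : ℝ)|) ^ E)).hasSum (hterm k)
  rw [tsum_mul_left] at this
  have e : ∑' j : ℤ, ((1 + |((k - j : ℤ) : ℝ)|) ^ 2)⁻¹ = ∑' j : ℤ, ((1 + |(j : ℝ)|) ^ 2)⁻¹ :=
    (Equiv.subLeft k).tsum_eq (fun j : ℤ => ((1 + |(j : ℝ)|) ^ 2)⁻¹)
  rw [e] at this
  refine this.trans (le_of_eq ?_)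
  ring

lemma sum_bspline_mul_splineConv (n : ℕ) {v : ℤ → ℝ} {C : ℝ} {E : ℕ}
    (hv : ∀ j, |v j| ≤ C * (1 + |(j : ℝ)|) ^ E) (i : ℤ) :
    ∑ l ∈ Finset.Icc (-((n + 1 : ℕ) : ℤ)) (n + 1 : ℕ), bspline n l * splineConv n v (i - l)
      = v i := by
  obtain ⟨K, -, hK⟩ := splineConv_bound n E
  have hs := (hK v C hv).1
  unfold splineConv
  simp_rw [← tsum_mul_left]
  rw [← Summable.tsum_finsetSum fun l _ => (hs (i - l)).mul_left _]
  have e : ∀ j : ℤ, ∑ l ∈ Finset.Icc (-((n + 1 : ℕ) : ℤ)) (n + 1 : ℕ),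
      bspline n l * (splineCoeff n (i - l - j) * v j) = if j = i then v i else 0 := by
    intro j
    simp_rw [← mul_assoc]
    rw [← Finset.sum_mul]
    have := sum_bspline_mul_splineCoeff n (i - j)
    simp_rw [show ∀ l : ℤ, i - l - j = i - j - l from fun l => by ring]
    rw [this]
    by_cases h : j = i
    · simp [h]
    · rw [if_neg (by omega), if_neg h, zero_mul]
  simp_rw [e]
  exact tsum_ite_eq i _

/-- The collocation operator and convolution with its inverse coefficients commute, so `v = b * (a *
v) = a * (b * v) = 0`; polynomial growth justifies the interchange of sums. -/
lemma splineConv_sum_bspline (n : ℕ) {v : ℤ → ℝ} {C : ℝ} {E : ℕ}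
    (hv : ∀ j, |v j| ≤ C * (1 + |(j : ℝ)|) ^ E)
    (h0 : ∀ i, ∑ l ∈ Finset.Icc (-((n + 1 : ℕ) : ℤ)) (n + 1 : ℕ), bspline n l * v (i - l) = 0)
    (k : ℤ) : v k = 0 := by
  obtain ⟨K, -, hK⟩ := splineConv_bound n E
  have hs := (hK v C hv).1
  rw [← sum_bspline_mul_splineConv n hv k]
  have e : ∀ l : ℤ, splineConv n v (k - l) = ∑' i : ℤ, splineCoeff n (k - i) * v (i - l) := by
    intro l
    rw [splineConv, ← (Equiv.subRight l).tsum_eq]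
    refine tsum_congr fun i => ?_
    simp
  have hs' : ∀ l : ℤ, Summable fun i : ℤ => splineCoeff n (k - i) * v (i - l) := by
    intro l
    refine ((Equiv.subRight l).summable_iff.2 (hs (k - l))).congr fun i => ?_
    simp
  simp_rw [e, ← tsum_mul_left]
  rw [← Summable.tsum_finsetSum fun l _ => (hs' l).mul_left _]
  have e2 : ∀ i : ℤ, ∑ l ∈ Finset.Icc (-((n + 1 : ℕ) : ℤ)) (n + 1 : ℕ),
      bspline n l * (splineCoeff n (k - i) * v (i - l)) = 0 := by
    intro i
    rw [← mul_zero (splineCoeff n (k - i)), ← h0 i, Finset.mul_sum]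
    exact Finset.sum_congr rfl fun l _ => by ring
  simp_rw [e2, tsum_zero]

lemma contDiff_bspline (n : ℕ) : ContDiff ℝ ((2 * n : ℕ) : WithTop ℕ∞) (bspline n) := by
  have : bspline n = fun x => ∑ k ∈ Finset.range (2 * (n + 1) + 1),
      sdCoeff (n + 1) k * truncPow (2 * n + 1) (x + ((k : ℤ) - (n + 1 : ℕ) : ℤ)) :=
    funext (sd_iterate_eq_sum _ _)
  rw [this]
  refine ContDiff.sum fun k _ => contDiff_const.mul ?_
  exact (contDiff_truncPow (2 * n)).comp (contDiff_id.add contDiff_const)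

lemma bspline_cell (n : ℕ) (c : ℤ) : ∃ P : ℝ[X], P.natDegree ≤ 2 * n + 1 ∧
    ∀ x ∈ Set.Icc (c : ℝ) (c + 1), bspline n x = P.eval x := by
  refine ⟨∑ k ∈ Finset.range (2 * (n + 1) + 1), C (sdCoeff (n + 1) k) *
    (if 0 ≤ c + ((k : ℤ) - (n + 1 : ℕ)) then C (((2 * n + 1).factorial : ℝ)⁻¹) *
      (X + C ((((k : ℤ) - (n + 1 : ℕ) : ℤ) : ℝ))) ^ (2 * n + 1) else 0), ?_, fun x hx => ?_⟩
  · refine natDegree_sum_le_of_forall_le _ _ fun k _ => (natDegree_C_mul_le _ _).trans ?_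
    split_ifs
    · refine (natDegree_C_mul_le _ _).trans (natDegree_pow_le.trans ?_)
      rw [natDegree_X_add_C, mul_one]
    · simp
  · rw [bspline, sd_iterate_eq_sum, eval_finsetSum]
    refine Finset.sum_congr rfl fun k _ => ?_
    rw [eval_mul, eval_C]
    congr 1
    split_ifs with h
    · have : (0 : ℝ) ≤ c + ((k : ℤ) - (n + 1 : ℕ) : ℤ) := by exact_mod_cast h
      rw [truncPow_of_nonneg _ (by linarith [hx.1])]
      simp [div_eq_inv_mul]
    · have : (c : ℝ) + ((k : ℤ) - (n + 1 : ℕ) : ℤ) + 1 ≤ 0 := by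
        exact_mod_cast (by omega : c + ((k : ℤ) - (n + 1 : ℕ)) + 1 ≤ 0)
      rw [truncPow_of_nonpos (by omega) (by linarith [hx.2]), eval_zero]

lemma isCardinalSpline_splineSeries (n : ℕ) (a : ℤ → ℝ) :
    IsCardinalSpline (2 * n + 1) 1 (splineSeries n a) := by
  constructor
  · rw [Nat.add_sub_cancel, contDiff_iff_contDiffAt]
    intro x
    obtain ⟨R, hR⟩ := exists_nat_ge (|x| + 1 + n + 1)
    have : ContDiffAt ℝ ((2 * n : ℕ) : WithTop ℕ∞) (fun x => ∑ k ∈ Finset.Icc (-(R : ℤ)) R,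
        a k * bspline n (x - k)) x := (ContDiff.sum fun k _ => contDiff_const.mul
          ((contDiff_bspline n).comp (contDiff_id.sub contDiff_const))).contDiffAt
    refine this.congr_of_eventuallyEq ?_
    filter_upwards [Metric.ball_mem_nhds x one_pos] with y hy
    rw [Metric.mem_ball, Real.dist_eq] at hy
    refine splineSeries_eq n a ?_
    linarith [abs_sub_abs_le_abs_sub y x]
  · intro j
    obtain ⟨R, hR⟩ := exists_nat_ge (|(j : ℝ)| + 1 + n + 1)
    choose P hPd hP using fun k : ℤ => bspline_cell n (j - k)
    refine ⟨∑ k ∈ Finset.Icc (-(R : ℤ)) R, C (a k) * (P k).comp (X - C (k : ℝ)), ?_,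
      fun x hx => ?_⟩
    · refine natDegree_sum_le_of_forall_le _ _ fun k _ => (natDegree_C_mul_le _ _).trans ?_
      rw [natDegree_comp, natDegree_X_sub_C, mul_one]
      exact hPd k
    · rw [mul_one, mul_one] at hx
      have : |x| ≤ |(j : ℝ)| + 1 := by
        have h1 := abs_sub_abs_le_abs_sub x j
        have h2 : |x - j| ≤ 1 := abs_le.2 ⟨by linarith [hx.1], by linarith [hx.2]⟩
        linarith
      rw [splineSeries_eq n a (R := R) (by linarith), eval_finsetSum]
      refine Finset.sum_congr rfl fun k _ => ?_
      rw [hP k (x - k) ⟨by push_cast; linarith [hx.1], by push_cast; linarith [hx.2]⟩]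
      simp

lemma splineSeries_splineConv (n : ℕ) {v : ℤ → ℝ} {C : ℝ} {E : ℕ}
    (hv : ∀ j, |v j| ≤ C * (1 + |(j : ℝ)|) ^ E) (x : ℝ) :
    splineSeries n (splineConv n v) x = ∑' j : ℤ, v j * splineKernel n (x - j) := by
  obtain ⟨K, -, hK⟩ := splineConv_bound n E
  have hs := (hK v C hv).1
  obtain ⟨R, hR⟩ := exists_nat_ge (|x| + n + 1)
  rw [splineSeries_eq n _ hR]
  unfold splineConv
  simp_rw [← tsum_mul_right]
  rw [← Summable.tsum_finsetSum fun k _ => (hs k).mul_right _]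
  refine tsum_congr fun j => ?_
  rw [splineKernel, splineSeries_shift, splineSeries_eq n _ hR, Finset.mul_sum]
  exact Finset.sum_congr rfl fun k _ => by ring

lemma splineSeries_splineConv_int (n : ℕ) {v : ℤ → ℝ} {C : ℝ} {E : ℕ}
    (hv : ∀ j, |v j| ≤ C * (1 + |(j : ℝ)|) ^ E) (i : ℤ) :
    splineSeries n (splineConv n v) i = v i := by
  rw [splineSeries_int, sum_bspline_mul_splineConv n hv]

/-- A cardinal spline of polynomial growth which vanishes on `ℤ` vanishes. -/
lemma eq_zero_of_isCardinalSpline (n : ℕ) {s : ℝ → ℝ} (hs : IsCardinalSpline (2 * n + 1) 1 s)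
    {A : ℝ} {E : ℕ} (hg : ∀ x, |s x| ≤ A * (1 + |x|) ^ E) (h0 : ∀ j : ℤ, s j = 0) (x : ℝ) :
    s x = 0 := by
  obtain ⟨hsm, hcell⟩ := hs
  choose P hPd hP using hcell
  simp only [mul_one] at hP
  have hA : 0 ≤ A := by have := (abs_nonneg _).trans (hg 0); simpa using this
  set p := 2 * n + 1 with hp
  -- The jumps of the leading coefficient at the knots. They grow at most polynomially, since the
  -- pieces do and `exists_coeff_bound` is uniform in the cell.
  set J : ℤ → ℝ := fun j => (P j).coeff p - (P (j - 1)).coeff p with hJ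
  have hjump : ∀ j : ℤ, P j = P (j - 1) + C (J j) * (X - C (j : ℝ)) ^ p := by
    intro j
    refine exists_jump (a := (j : ℝ) - 1) (b := j + 1) (by omega) hsm (by linarith) (by linarith)
      (fun y hy => hP (j - 1) y ?_) (fun y hy => hP j y hy) (hPd _) (hPd _)
    push_cast
    exact ⟨hy.1, by linarith [hy.2]⟩
  obtain ⟨K, hK, hKb⟩ := exists_coeff_bound p (by omega)
  have hcoef : ∀ j : ℤ, |(P j).coeff p| ≤ K * (A * (2 * (1 + |(j : ℝ)|)) ^ E) := by
    intro j
    refine hKb (P j) j _ (hPd j) fun x hx => ?_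
    rw [← hP j x hx]
    refine (hg x).trans ?_
    have h1 := abs_sub_abs_le_abs_sub x j
    have h2 : |x - j| ≤ 1 := abs_le.2 ⟨by linarith [hx.1], by linarith [hx.2]⟩
    gcongr
    linarith [abs_nonneg (j : ℝ)]
  have hJb : ∀ j : ℤ, |J j| ≤ (2 * K * A * 4 ^ E) * (1 + |(j : ℝ)|) ^ E := by
    intro j
    have h1 : |(P j).coeff p| ≤ K * (A * (4 * (1 + |(j : ℝ)|)) ^ E) :=
      (hcoef j).trans (by gcongr; norm_num)
    have h2 : |(P (j - 1)).coeff p| ≤ K * (A * (4 * (1 + |(j : ℝ)|)) ^ E) := by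
      refine (hcoef (j - 1)).trans ?_
      have : |((j - 1 : ℤ) : ℝ)| ≤ |(j : ℝ)| + 1 := by
        push_cast
        simpa using abs_sub (j : ℝ) 1
      gcongr K * (A * ?_ ^ E)
      linarith [abs_nonneg (j : ℝ)]
    rw [mul_pow] at h1 h2
    have := abs_sub ((P j).coeff p) ((P (j - 1)).coeff p)
    rw [hJ]
    simp only
    linarith
  have hstep : ∀ (a : ℤ) (r : ℕ), P (a + r)
      = P a + ∑ l ∈ Finset.Ioc a (a + r), C (J l) * (X - C (l : ℝ)) ^ p := by
    intro a r
    induction r with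
    | zero => simp
    | succ r ih =>
      have hI : Finset.Ioc a (a + (r + 1 : ℕ)) = insert (a + r + 1) (Finset.Ioc a (a + r)) := by
        ext l; simp only [Finset.mem_Ioc, Finset.mem_insert]; omega
      have := hjump (a + r + 1)
      rw [add_sub_cancel_right] at this
      rw [hI, Finset.sum_insert (by simp), Nat.cast_succ, ← add_assoc, this, ih]
      push_cast; ring
  -- Near `i` the spline is one polynomial plus truncated powers weighted by the jumps. The
  -- difference `sd^[n + 1]` of its zero values at the integers kills the polynomial and turns
  -- truncated powers into B-splines, so the collocation operator annihilates the jumps.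
  have hconv : ∀ i : ℤ, ∑ l ∈ Finset.Icc (-((n + 1 : ℕ) : ℤ)) (n + 1 : ℕ),
      bspline n l * J (i - l) = 0 := by
    intro i
    set a : ℤ := i - (n + 1 : ℕ) with ha
    set S := Finset.Ioc a (a + (2 * (n + 1) : ℕ)) with hS
    have hval : ∀ j : ℤ, -((n + 1 : ℕ) : ℤ) ≤ j → j ≤ (n + 1 : ℕ) →
        s ((i : ℝ) + j) = (P a).eval ((i : ℝ) + j)
          + ∑ l ∈ S, (J l * (p.factorial : ℝ)) * truncPow p ((i : ℝ) + j - l) := by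
      intro j hj1 hj2
      have hmem : (i : ℝ) + j ∈ Set.Icc ((i + j : ℤ) : ℝ) ((i + j : ℤ) + 1) := by
        push_cast; exact ⟨le_rfl, by linarith⟩
      have hij : i + j = a + ((j + (n + 1 : ℕ)).toNat : ℤ) := by
        rw [Int.toNat_of_nonneg (by omega)]; omega
      rw [hP (i + j) _ hmem, hij, hstep, eval_add, eval_finsetSum]
      congr 1
      have hsub : Finset.Ioc a (a + ((j + (n + 1 : ℕ)).toNat : ℤ)) ⊆ S := by
        intro l hl
        rw [hS, Finset.mem_Ioc] at *
        omega
      rw [← Finset.sum_subset hsub]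
      · refine Finset.sum_congr rfl fun l hl => ?_
        rw [Finset.mem_Ioc] at hl
        have : (0 : ℝ) ≤ (i : ℝ) + j - l := by
          exact_mod_cast (by omega : (0 : ℤ) ≤ i + j - l)
        have hf : (p.factorial : ℝ) ≠ 0 := by positivity
        rw [truncPow_of_nonneg _ this]
        simp
        field_simp
      · intro l _ hl
        rw [Finset.mem_Ioc, not_and_or, not_lt, not_le] at hl
        rw [truncPow_of_nonpos (by omega), mul_zero]
        rw [hS, Finset.mem_Ioc] at *
        exact_mod_cast (by omega : i + j - l ≤ (0 : ℤ))
    have h1 : sd^[n + 1] s i = 0 := by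
      rw [sd_iterate_congr (g' := fun x => (0 : ℝ[X]).eval x), sd_iterate_poly]
      · simp
      · intro j _ _
        rw [eval_zero, ← h0 (i + j)]; push_cast; rfl
    have h2 : sd^[n + 1] s i = sd^[n + 1] (fun x => ∑ l ∈ S,
        (J l * (p.factorial : ℝ)) * truncPow p (x - l)) i := by
      rw [sd_iterate_congr _ (g' := fun x => (P a).eval x + ∑ l ∈ S,
        (J l * (p.factorial : ℝ)) * truncPow p (x - l)) hval]
      rw [sd_iterate_add, sd_iterate_poly (n + 1) (P a) (by have := hPd a; omega), zero_add]
    rw [h2, sd_iterate_sum] at h1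
    have h3 : ∀ l : ℤ, sd^[n + 1] (fun x => truncPow p (x - l)) i = bspline n (i - l) :=
      fun l => sd_iterate_shift _ _ _ _
    simp_rw [h3] at h1
    have hf : (p.factorial : ℝ) ≠ 0 := by positivity
    have h4 : ∑ l ∈ S, J l * bspline n (i - l) = 0 := by
      have : ∑ l ∈ S, J l * (p.factorial : ℝ) * bspline n (i - l)
          = (p.factorial : ℝ) * ∑ l ∈ S, J l * bspline n (i - l) := by
        rw [Finset.mul_sum]; exact Finset.sum_congr rfl fun l _ => by ring
      rw [this] at h1
      exact (mul_eq_zero.1 h1).resolve_left hf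
    rw [← h4]
    have hb := isBump_bspline n
    -- Enlarging the index set adds only `i - (n + 1)` on the left, an endpoint of the support,
    -- where the B-spline vanishes.
    have hS' : S ⊆ Finset.Icc (i - (n + 1 : ℕ)) (i + (n + 1 : ℕ)) := by
      intro l hl; rw [hS, Finset.mem_Ioc] at hl; rw [Finset.mem_Icc]; omega
    rw [Finset.sum_subset hS']
    · refine Finset.sum_nbij' (fun l => i - l) (fun l => i - l) ?_ ?_ ?_ ?_ ?_
      · intro l hl; rw [Finset.mem_Icc] at *; omega
      · intro l hl; rw [Finset.mem_Icc] at *; omega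
      · intro l _; ring
      · intro l _; ring
      · intro l _
        rw [mul_comm]; push_cast; congr 2; ring
    · intro l hl hl'
      rw [hS, Finset.mem_Ioc] at hl'
      rw [Finset.mem_Icc] at hl
      have : l = i - (n + 1 : ℕ) := by omega
      rw [hb.supp, mul_zero]
      rw [this]; push_cast
      rw [show (i : ℝ) - (i - (n + 1)) = n + 1 by ring]
      exact le_abs_self _
  have hJ0 := splineConv_sum_bspline n hJb hconv
  have hsucc : ∀ j : ℤ, P j = P (j - 1) := by
    intro j; rw [hjump j, hJ0 j]; simp
  have hconst : ∀ j : ℤ, P j = P 0 := by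
    intro j
    induction j using Int.induction_on with
    | zero => rfl
    | succ j ih => rw [hsucc, add_sub_cancel_right, ih]
    | pred j ih => rw [← hsucc, ih]
  -- Without jumps the spline is a single polynomial, and it has every integer as a root.
  have hP0 : P 0 = 0 := by
    refine eq_zero_of_infinite_isRoot _ (Set.Infinite.mono (s := Set.range fun j : ℤ => (j : ℝ)) ?_
      (Set.infinite_range_of_injective Int.cast_injective))
    rintro _ ⟨j, rfl⟩
    have := hP j j ⟨le_rfl, by linarith⟩
    rw [h0, hconst] at this
    exact this.symm
  rw [hP ⌊x⌋ x ⟨Int.floor_le x, (Int.lt_floor_add_one x).le⟩, hconst, hP0, eval_zero]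


/-! ### Both interpolants in kernel form -/

lemma IsCardinalSpline.scale {p : ℕ} {a : ℝ} {s : ℝ → ℝ} (hs : IsCardinalSpline p a s) {r : ℝ}
    (hr : 0 < r) : IsCardinalSpline p (a * r) (fun x => s (x / r)) := by
  refine ⟨hs.1.comp (contDiff_id.div_const r), fun j => ?_⟩
  obtain ⟨P, hP, h⟩ := hs.2 j
  refine ⟨P.comp (C r⁻¹ * X), ?_, fun x hx => ?_⟩
  · refine natDegree_comp_le.trans ?_
    have h1 : (C r⁻¹ * X : ℝ[X]).natDegree ≤ 1 := by compute_degree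
    calc _ ≤ p * 1 := Nat.mul_le_mul hP h1
      _ = p := mul_one p
  · show s (x / r) = _
    rw [h (x / r), eval_comp]
    · simp [div_eq_inv_mul]
    · rw [← mul_assoc, ← mul_assoc] at hx
      exact ⟨(le_div_iff₀ hr).2 hx.1, (div_le_iff₀ hr).2 hx.2⟩

lemma IsCardinalSpline.sub {p : ℕ} {a : ℝ} {s s' : ℝ → ℝ} (hs : IsCardinalSpline p a s)
    (hs' : IsCardinalSpline p a s') : IsCardinalSpline p a (fun x => s x - s' x) := by
  refine ⟨hs.1.sub hs'.1, fun j => ?_⟩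
  obtain ⟨P, hP, h⟩ := hs.2 j
  obtain ⟨P', hP', h'⟩ := hs'.2 j
  exact ⟨P - P', (natDegree_sub_le _ _).trans (max_le hP hP'), fun x hx => by
    rw [eval_sub, ← h x hx, ← h' x hx]⟩

lemma exists_eval_growth (P : ℝ[X]) : ∃ C, ∀ x, |P.eval x| ≤ C * (1 + |x|) ^ P.natDegree := by
  refine ⟨∑ i ∈ Finset.range (P.natDegree + 1), |P.coeff i|, fun x => ?_⟩
  rw [eval_eq_sum_range, Finset.sum_mul]
  refine (Finset.abs_sum_le_sum_abs _ _).trans (Finset.sum_le_sum fun i hi => ?_)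
  rw [abs_mul, abs_pow]
  refine mul_le_mul_of_nonneg_left ?_ (abs_nonneg _)
  calc |x| ^ i ≤ (1 + |x|) ^ i := by gcongr; linarith
    _ ≤ _ := pow_le_pow_right₀ (by linarith [abs_nonneg x])
      (Nat.lt_succ_iff.1 (Finset.mem_range.1 hi))

/-- A polynomial is itself a cardinal spline. Its difference from the kernel series has polynomial
growth and vanishes at the integers, so uniqueness gives reproduction. Uniqueness among bounded
splines would not suffice here. -/
lemma isKernel_splineKernel (n : ℕ) : IsKernel (2 * n + 1) (splineKernel n) := by
  refine ⟨splineKernel_decay n, splineKernel_lip n, splineKernel_int n, splineKernel_even n,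
    posDefFun_splineKernel n, fun P hP x => ?_⟩
  obtain ⟨C, hC⟩ := exists_eval_growth P
  obtain ⟨K, -, hK⟩ := splineConv_bound n P.natDegree
  have hv : ∀ j : ℤ, |P.eval (j : ℝ)| ≤ C * (1 + |(j : ℝ)|) ^ P.natDegree := fun j => hC j
  rw [← splineSeries_splineConv n hv]
  have hPs : IsCardinalSpline (2 * n + 1) 1 (fun x => P.eval x) :=
    ⟨by simpa using P.contDiff_aeval (𝕜 := ℝ) _, fun j => ⟨P, hP, fun _ _ => rfl⟩⟩
  have hz := eq_zero_of_isCardinalSpline n (hPs.sub (isCardinalSpline_splineSeries n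
    (splineConv n fun j => P.eval (j : ℝ)))) (E := P.natDegree)
    (A := C + K * C * (n + 2) ^ P.natDegree) (fun y => ?_) (fun j => ?_) x
  · linarith
  · have h1 := splineSeries_growth n P.natDegree ((hK _ C hv).2) y
    have h2 := abs_sub (P.eval y) (splineSeries n (splineConv n fun j => P.eval (j : ℝ)) y)
    have h3 := hC y
    linarith
  · rw [splineSeries_splineConv_int n hv, sub_self]

/-- Interpolation on grids is given by a kernel. -/
theorem exists_kernel (κ : InterpKind) {p : ℕ} (hp : Odd p) : ∃ ψ, IsKernel p ψ ∧
    ∀ Δx > 0, ∀ v : ℤ → ℝ, (∃ C, ∀ j, |v j| ≤ C) → ∀ s : ℝ → ℝ,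
      IsInterpolant κ p Δx v s ↔ ∀ x, s x = kernelInterp ψ Δx v x := by
  obtain ⟨n, rfl⟩ := hp
  cases κ with
  | lagrange =>
    refine ⟨lagrangeKernel n, isKernel_lagrangeKernel n, fun Δx hΔ v _ s => ?_⟩
    simp only [IsInterpolant, lagrangeInterp_eq n hΔ]
  | spline =>
    refine ⟨splineKernel n, isKernel_splineKernel n, fun Δx hΔ v ⟨C, hC⟩ s => ?_⟩
    have hv : ∀ j : ℤ, |v j| ≤ C * (1 + |(j : ℝ)|) ^ 0 := fun j => by simpa using hC j
    obtain ⟨K, -, hK⟩ := splineConv_bound n 0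
    have hker : ∀ x, kernelInterp (splineKernel n) Δx v x
        = splineSeries n (splineConv n v) (x / Δx) := fun x =>
      (splineSeries_splineConv n hv _).symm
    have hbd : ∀ y, |splineSeries n (splineConv n v) y| ≤ K * C := fun y => by
      simpa using splineSeries_growth n 0 (hK v C hv).2 y
    have hcard := isCardinalSpline_splineSeries n (splineConv n v)
    simp only [IsInterpolant, hker]
    constructor
    · rintro ⟨hs, ⟨B, hB⟩, hsv⟩ x
      have hs1 := hs.scale (inv_pos.2 hΔ)
      rw [mul_inv_cancel₀ hΔ.ne'] at hs1
      have := eq_zero_of_isCardinalSpline n (hs1.sub hcard) (E := 0) (A := B + K * C)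
        (fun y => by
          have h1 := hB (y / Δx⁻¹)
          have h2 := hbd y
          have h3 := abs_sub (s (y / Δx⁻¹)) (splineSeries n (splineConv n v) y)
          simp only [pow_zero, mul_one]
          linarith)
        (fun j => by
          rw [splineSeries_splineConv_int n hv, div_inv_eq_mul, hsv, sub_self]) (x / Δx)
      simp only [div_inv_eq_mul, div_mul_cancel₀ _ hΔ.ne'] at this
      linarith
    · intro h
      have hs : s = fun x => splineSeries n (splineConv n v) (x / Δx) := funext h
      refine ⟨?_, ⟨K * C, fun x => by rw [h]; exact hbd _⟩, fun j => ?_⟩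
      · have := hcard.scale hΔ
        rw [one_mul] at this
        rwa [hs]
      · rw [h, mul_div_cancel_right₀ _ hΔ.ne', splineSeries_splineConv_int n hv]


/-! ### Stability of kernel interpolation in `ℓ²` -/

lemma IsKernel.summable_growth {p : ℕ} {ψ : ℝ → ℝ} (h : IsKernel p ψ) {v : ℤ → ℝ} {C : ℝ} {E : ℕ}
    (hv : ∀ j, |v j| ≤ C * (1 + |(j : ℝ)|) ^ E) (x : ℝ) :
    Summable fun j : ℤ => v j * ψ (x - j) := by
  obtain ⟨A, hA⟩ := h.decay (E + 2)
  have hC : 0 ≤ C := by have := (abs_nonneg _).trans (hv 0); simpa using this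
  have hA0 : 0 ≤ A := le_trans (by positivity) (hA 0)
  refine Summable.of_norm_bounded (summable_inv_one_add_abs_sq.mul_left
    (C * A * (1 + |x|) ^ (E + 2))) fun j => ?_
  rw [Real.norm_eq_abs, abs_mul, ← div_eq_mul_inv, le_div_iff₀ (by positivity)]
  have h1 := one_add_abs_le_mul (j : ℝ) x
  rw [abs_sub_comm] at h1
  calc _ ≤ C * (1 + |(j : ℝ)|) ^ E * |ψ (x - j)| * (1 + |(j : ℝ)|) ^ 2 := by gcongr; exact hv j
    _ = C * |ψ (x - j)| * (1 + |(j : ℝ)|) ^ (E + 2) := by ring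
    _ ≤ C * |ψ (x - j)| * ((1 + |x|) * (1 + |x - j|)) ^ (E + 2) := by gcongr
    _ = C * (|ψ (x - j)| * (1 + |x - j|) ^ (E + 2)) * (1 + |x|) ^ (E + 2) := by
        rw [mul_pow]; ring
    _ ≤ _ := by gcongr; exact hA _

lemma IsKernel.summable {p : ℕ} {ψ : ℝ → ℝ} (h : IsKernel p ψ) {v : ℤ → ℝ} {C : ℝ}
    (hv : ∀ j, |v j| ≤ C) (x : ℝ) : Summable fun j : ℤ => v j * ψ (x - j) :=
  h.summable_growth (C := C) (E := 0) (fun j => by simpa using hv j) x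

lemma IsKernel.abs_interp_le {p : ℕ} {ψ : ℝ → ℝ} (h : IsKernel p ψ) : ∃ K, 0 ≤ K ∧
    ∀ (Δx : ℝ) (v : ℤ → ℝ) (C : ℝ), (∀ j, |v j| ≤ C) → ∀ x, |kernelInterp ψ Δx v x| ≤ K * C := by
  obtain ⟨A, hA⟩ := h.decay 2
  have hA0 : 0 ≤ A := le_trans (by positivity) (hA 0)
  set Z := ∑' l : ℤ, ((1 + |(l : ℝ)|) ^ 2)⁻¹ with hZ
  refine ⟨4 * A * Z, mul_nonneg (by positivity) (tsum_nonneg fun _ => by positivity),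
    fun Δx v C hv x => ?_⟩
  have hC : 0 ≤ C := (abs_nonneg _).trans (hv 0)
  set y := x / Δx
  have hb : ∀ k : ℤ, ‖v (k + ⌊y⌋) * ψ (y - (k + ⌊y⌋ : ℤ))‖ ≤ 4 * A * C * ((1 + |(k : ℝ)|) ^ 2)⁻¹ := by
    intro k
    rw [Real.norm_eq_abs, abs_mul, ← div_eq_mul_inv, le_div_iff₀ (by positivity)]
    have h1 := one_add_abs_le_mul (k : ℝ) (Int.fract y)
    have h2 : |Int.fract y| ≤ 1 := by
      rw [abs_of_nonneg (Int.fract_nonneg y)]; exact (Int.fract_lt_one y).le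
    have h3 : y - (k + ⌊y⌋ : ℤ) = Int.fract y - k := by
      have := Int.self_sub_floor y
      push_cast; linarith
    rw [h3]
    rw [abs_sub_comm] at h1
    have h4 : 1 + |(k : ℝ)| ≤ 2 * (1 + |Int.fract y - k|) :=
      h1.trans (by gcongr; linarith)
    calc _ ≤ C * |ψ (Int.fract y - k)| * (2 * (1 + |Int.fract y - k|)) ^ 2 := by
          gcongr; exact hv _
      _ = 4 * C * (|ψ (Int.fract y - k)| * (1 + |Int.fract y - k|) ^ 2) := by ring
      _ ≤ 4 * C * A := by gcongr; exact hA _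
      _ = _ := by ring
  have := tsum_of_norm_bounded (summable_inv_one_add_abs_sq.mul_left (4 * A * C)).hasSum hb
  rw [tsum_mul_left, Real.norm_eq_abs] at this
  rw [kernelInterp, ← (Equiv.addRight ⌊y⌋).tsum_eq]
  refine le_trans this (le_of_eq ?_)
  ring

lemma kernelInterp_sub {p : ℕ} {ψ : ℝ → ℝ} (h : IsKernel p ψ) {v v' : ℤ → ℝ} {C C' : ℝ}
    (hv : ∀ j, |v j| ≤ C) (hv' : ∀ j, |v' j| ≤ C') (Δx x : ℝ) :
    kernelInterp ψ Δx (fun j => v j - v' j) x = kernelInterp ψ Δx v x - kernelInterp ψ Δx v' x := by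
  unfold kernelInterp
  rw [← (h.summable hv _).tsum_sub (h.summable hv' _)]
  exact tsum_congr fun j => by ring

/-- The sampled values `∑_j e_j ψ(y_i - j)` at nearly equidistant points are stable in `ℓ²`,
with a constant close to `1`. -/
theorem IsKernel.stability {p : ℕ} {ψ : ℝ → ℝ} (h : IsKernel p ψ) : ∃ C, 0 ≤ C ∧
    ∀ (η : ℝ) (y e : ℤ → ℝ), 0 ≤ η → η ≤ 1 / 2 →
      (∀ i k : ℤ, |y i - y k - (i - k)| ≤ η * |(i : ℝ) - k|) → Summable (fun j => e j ^ 2) →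
      Summable (fun i => (∑' j : ℤ, e j * ψ (y i - j)) ^ 2) ∧
      ∑' i, (∑' j : ℤ, e j * ψ (y i - j)) ^ 2 ≤ (1 + C * η) * ∑' j, e j ^ 2 := by
  -- Of the three powers of decay, one absorbs the displacement `η |i - k|` and two make the row
  -- sums converge.
  obtain ⟨A, hA⟩ := h.lip 3
  set Z := ∑' l : ℤ, ((1 + |(l : ℝ)|) ^ 2)⁻¹ with hZ
  have hZ0 : 0 ≤ Z := tsum_nonneg fun _ => by positivity
  have hA0 : 0 ≤ A := by
    have := hA 1 (1 / 2) (by norm_num)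
    have h2 : 0 ≤ A * |(1 / 2 : ℝ)| := le_trans (by positivity) this
    exact nonneg_of_mul_nonneg_left h2 (by norm_num)
  refine ⟨A * Z, by positivity, fun η y e hη hη2 hy he => ?_⟩
  set g := 1 + A * Z * η with hg
  have hg1 : 1 ≤ g := by rw [hg]; linarith [show 0 ≤ A * Z * η by positivity]
  -- The kernel vanishes at the nonzero integer `i - k`, so the entry is controlled by the Lipschitz
  -- bound alone; `η ≤ 1/2` makes that bound applicable.
  have hgram : ∀ i k : ℤ, i ≠ k → |ψ (y i - y k)| ≤ A * η * ((1 + |((i - k : ℤ) : ℝ)|) ^ 2)⁻¹ := by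
    intro i k hik
    have h1 := hy i k
    have h2 := hA (i - k) (y i - y k - (i - k)) (by push_cast; nlinarith [abs_nonneg ((i : ℝ) - k)])
    rw [h.cardinal, if_neg (by omega), sub_zero] at h2
    push_cast at h2 ⊢
    rw [show (i : ℝ) - k + (y i - y k - (i - k)) = y i - y k by ring] at h2
    rw [← div_eq_mul_inv, le_div_iff₀ (by positivity)]
    have h3 : 0 < 1 + |(i : ℝ) - k| := by positivity
    refine le_of_mul_le_mul_right ?_ h3
    calc _ = |ψ (y i - y k)| * (1 + |(i : ℝ) - k|) ^ 3 := by ring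
      _ ≤ A * |y i - y k - (i - k)| := h2
      _ ≤ A * (η * |(i : ℝ) - k|) := by gcongr
      _ ≤ A * (η * (1 + |(i : ℝ) - k|)) := by gcongr; linarith
      _ = _ := by ring
  have hψ0 : ψ 0 = 1 := by simpa using h.cardinal 0
  have hrow : ∀ (S : Finset ℤ) (i : ℤ), i ∈ S → ∑ k ∈ S, |ψ (y i - y k)| ≤ g := by
    intro S i hi
    rw [← Finset.add_sum_erase _ _ hi, sub_self, hψ0, abs_one, hg]
    gcongr
    calc _ ≤ ∑ k ∈ S.erase i, A * η * ((1 + |((i - k : ℤ) : ℝ)|) ^ 2)⁻¹ :=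
          Finset.sum_le_sum fun k hk => hgram i k (Finset.ne_of_mem_erase hk).symm
      _ = A * η * ∑ k ∈ S.erase i, ((1 + |((i - k : ℤ) : ℝ)|) ^ 2)⁻¹ := by rw [Finset.mul_sum]
      _ ≤ A * η * Z := by
          gcongr
          have hs := (Equiv.subLeft i).summable_iff
            (f := fun j : ℤ => ((1 + |(j : ℝ)|) ^ 2)⁻¹) |>.2 summable_inv_one_add_abs_sq
          have := hs.sum_le_tsum (S.erase i) fun l _ => by
            simp only [Function.comp]; positivity
          have e2 := (Equiv.subLeft i).tsum_eq (fun j : ℤ => ((1 + |(j : ℝ)|) ^ 2)⁻¹)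
          simp only [Equiv.subLeft_apply] at e2
          rw [hZ, ← e2]
          exact this
      _ = _ := by ring
  have hfin : ∀ S J : Finset ℤ, ∑ i ∈ S, (∑ j ∈ J, e j * ψ (y i - j)) ^ 2
      ≤ g * ∑ j ∈ J, e j ^ 2 := by
    intro S J
    set r : ℤ → ℝ := fun i => ∑ j ∈ J, e j * ψ (y i - j) with hr
    -- The form at the points `y_i` with weights `r_i` and at the nodes `j` with weights `-g e_j`
    -- reads `0 ≤ rᵀ G r - 2 g |r|² + g² |e|²`. Row sums give `rᵀ G r ≤ g |r|²`, whence `|r|² ≤ g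
    -- |e|²`.
    have hpd := h.posDef (ℤ ⊕ ℤ) (S.disjSum J) (Sum.elim y fun j => (j : ℝ))
      (Sum.elim r fun j => -g * e j)
    simp only [Finset.sum_disjSum, Sum.elim_inl, Sum.elim_inr, Finset.sum_add_distrib] at hpd
    have t1 : ∑ i ∈ S, ∑ k ∈ S, r i * r k * ψ (y i - y k) ≤ g * ∑ i ∈ S, r i ^ 2 := by
      have hle : ∀ i k : ℤ, r i * r k * ψ (y i - y k)
          ≤ (1 / 2) * (r i ^ 2 * |ψ (y i - y k)|) + (1 / 2) * (r k ^ 2 * |ψ (y k - y i)|) := by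
        intro i k
        have e1 : ψ (y k - y i) = ψ (y i - y k) := by rw [← h.even]; congr 1; ring
        rw [e1]
        have h1 : r i * r k * ψ (y i - y k) ≤ |r i * r k| * |ψ (y i - y k)| := by
          rw [← abs_mul]; exact le_abs_self _
        have h2 : |r i * r k| ≤ (r i ^ 2 + r k ^ 2) / 2 := by
          rw [abs_le]; constructor <;> nlinarith [sq_nonneg (r i + r k), sq_nonneg (r i - r k)]
        nlinarith [abs_nonneg (ψ (y i - y k))]
      calc _ ≤ ∑ i ∈ S, ∑ k ∈ S, ((1 / 2) * (r i ^ 2 * |ψ (y i - y k)|)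
            + (1 / 2) * (r k ^ 2 * |ψ (y k - y i)|)) :=
            Finset.sum_le_sum fun i _ => Finset.sum_le_sum fun k _ => hle i k
        _ = ∑ i ∈ S, r i ^ 2 * ∑ k ∈ S, |ψ (y i - y k)| := by
            simp_rw [Finset.sum_add_distrib, ← Finset.mul_sum]
            rw [Finset.sum_comm (f := fun i k => r k ^ 2 * |ψ (y k - y i)|)]
            simp_rw [← Finset.mul_sum]
            ring
        _ ≤ ∑ i ∈ S, r i ^ 2 * g :=
            Finset.sum_le_sum fun i hi => mul_le_mul_of_nonneg_left (hrow S i hi) (sq_nonneg _)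
        _ = _ := by rw [Finset.mul_sum]; exact Finset.sum_congr rfl fun _ _ => mul_comm _ _
    have t2 : ∑ i ∈ S, ∑ j ∈ J, r i * (-g * e j) * ψ (y i - j) = -g * ∑ i ∈ S, r i ^ 2 := by
      rw [Finset.mul_sum]
      refine Finset.sum_congr rfl fun i _ => ?_
      rw [sq, show -g * (r i * r i) = (-g * r i) * ∑ j ∈ J, e j * ψ (y i - j) by rw [hr]; ring,
        Finset.mul_sum]
      exact Finset.sum_congr rfl fun j _ => by ring
    have t3 : ∑ j ∈ J, ∑ i ∈ S, -g * e j * r i * ψ (j - y i) = -g * ∑ i ∈ S, r i ^ 2 := by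
      rw [← t2, Finset.sum_comm]
      refine Finset.sum_congr rfl fun i _ => Finset.sum_congr rfl fun j _ => ?_
      rw [← h.even, neg_sub]; ring
    have t4 : ∑ j ∈ J, ∑ l ∈ J, -g * e j * (-g * e l) * ψ (j - l) = g ^ 2 * ∑ j ∈ J, e j ^ 2 := by
      rw [Finset.mul_sum]
      refine Finset.sum_congr rfl fun j hj => ?_
      rw [Finset.sum_eq_single j]
      · rw [sub_self, hψ0]; ring
      · intro l _ hl
        have := h.cardinal (j - l)
        rw [if_neg (by omega)] at this
        push_cast at this
        rw [this, mul_zero]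
      · intro hj'; exact absurd hj hj'
    rw [t2, t3, t4] at hpd
    have hgpos : 0 < g := by linarith
    refine le_of_mul_le_mul_left ?_ hgpos
    show g * ∑ i ∈ S, r i ^ 2 ≤ _
    nlinarith
  obtain ⟨B, hB⟩ : ∃ B, ∀ j, |e j| ≤ B := by
    refine ⟨∑' j, e j ^ 2 + 1, fun j => ?_⟩
    have := he.le_tsum j fun _ _ => sq_nonneg _
    rw [abs_le]; constructor <;> nlinarith [sq_nonneg (e j + 1), sq_nonneg (e j - 1)]
  have hbound : ∀ S : Finset ℤ, ∑ i ∈ S, (∑' j : ℤ, e j * ψ (y i - j)) ^ 2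
      ≤ g * ∑' j, e j ^ 2 := by
    intro S
    refine le_of_tendsto (tendsto_finsetSum S fun i _ => ((h.summable hB (y i)).hasSum.pow 2))
      (.of_forall fun J => (hfin S J).trans ?_)
    have := he.sum_le_tsum J fun _ _ => sq_nonneg _
    have hgpos : 0 ≤ g := by linarith
    gcongr
  exact ⟨summable_of_sum_le (fun _ => sq_nonneg _) hbound,
    Real.tsum_le_of_sum_le (fun _ => sq_nonneg _) hbound⟩


/-! ### The interpolation error in `ℓ²` -/

/-- Intervals of length `m w` at points separated by `w` split into `m` families of pairwise
disjoint intervals of length `w`. -/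
lemma sum_intervalIntegral_le {g : ℝ → ℝ} (hg : ∀ x, 0 ≤ g x) (hgi : Integrable g) {w : ℝ}
    (hw : 0 < w) {z : ℤ → ℝ} (hz : ∀ i k, i < k → z i + w ≤ z k) (m : ℕ) (S : Finset ℤ) :
    ∑ i ∈ S, ∫ x in z i..z i + m * w, g x ≤ m * ∫ x, g x := by
  have h1 : ∀ l : ℕ, ∑ i ∈ S, ∫ x in z i + l * w..z i + (l + 1 : ℕ) * w, g x ≤ ∫ x, g x := by
    intro l
    have hle : ∀ i, z i + l * w ≤ z i + (l + 1 : ℕ) * w := fun i => by push_cast; nlinarith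
    simp_rw [intervalIntegral.integral_of_le (hle _)]
    rw [← integral_biUnion_finset S (fun _ _ => measurableSet_Ioc) ?_
      fun i _ => hgi.integrableOn]
    · exact setIntegral_le_integral hgi (.of_forall hg)
    · intro i _ k _ hik
      rw [Function.onFun, Set.disjoint_left]
      intro x hx hx'
      simp only [Set.mem_Ioc] at hx hx'
      push_cast at hx hx'
      rcases lt_or_gt_of_ne hik with h | h
      · linarith [hz i k h, hx.2, hx'.1]
      · linarith [hz k i h, hx'.2, hx.1]
  have h2 : ∀ i, ∫ x in z i..z i + m * w, g x
      = ∑ l ∈ Finset.range m, ∫ x in z i + l * w..z i + (l + 1 : ℕ) * w, g x := by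
    intro i
    have := intervalIntegral.sum_integral_adjacent_intervals (μ := volume) (f := g) (n := m)
      (a := fun l : ℕ => z i + l * w) fun k _ => hgi.intervalIntegrable
    rw [this]; simp
  simp_rw [h2]
  rw [Finset.sum_comm]
  refine (Finset.sum_le_sum fun l _ => h1 l).trans (le_of_eq ?_)
  simp

/-- Cauchy–Schwarz, read off from the nonnegative variance of `g`. -/
lemma sq_intervalIntegral_le {g : ℝ → ℝ} (hg : Continuous g) {a b : ℝ} (hab : a ≤ b) :
    (∫ x in a..b, g x) ^ 2 ≤ (b - a) * ∫ x in a..b, g x ^ 2 := by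
  rcases hab.eq_or_lt with rfl | hlt
  · simp
  set m := ∫ x in a..b, g x
  have h0 : 0 ≤ ∫ x in a..b, (g x - m / (b - a)) ^ 2 :=
    intervalIntegral.integral_nonneg hab fun _ _ => sq_nonneg _
  have e : ∀ x, (g x - m / (b - a)) ^ 2 = g x ^ 2 - 2 * (m / (b - a)) * g x + (m / (b - a)) ^ 2 :=
    fun x => by ring
  simp_rw [e] at h0
  rw [intervalIntegral.integral_add, intervalIntegral.integral_sub,
    intervalIntegral.integral_const_mul, intervalIntegral.integral_const, smul_eq_mul] at h0
  · have hb : 0 < b - a := by linarith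
    change 0 ≤ (∫ x in a..b, g x ^ 2) - 2 * (m / (b - a)) * m + (b - a) * (m / (b - a)) ^ 2 at h0
    have e2 : (∫ x in a..b, g x ^ 2) - 2 * (m / (b - a)) * m + (b - a) * (m / (b - a)) ^ 2
        = (∫ x in a..b, g x ^ 2) - m ^ 2 / (b - a) := by field_simp; ring
    rw [e2, sub_nonneg, div_le_iff₀ hb] at h0
    linarith
  all_goals exact Continuous.intervalIntegrable (by fun_prop) _ _

/-- Taylor polynomials of degree `q` with an `L²` remainder. -/
lemma taylor_sq_le {q : ℕ} {G : ℕ → ℝ → ℝ} (hG : ∀ k ≤ q, ∀ x, HasDerivAt (G k) (G (k + 1) x) x)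
    (hc : Continuous (G (q + 1))) {z ρ y : ℝ} (hρ : 0 ≤ ρ) (hy : |y - z| ≤ ρ) :
    (G 0 y - ∑ k ∈ Finset.range (q + 1), G k z * (y - z) ^ k / (k.factorial : ℝ)) ^ 2
      ≤ ρ ^ (2 * q + 1) * ∫ x in z - ρ..z + ρ, G (q + 1) x ^ 2 := by
  set I := ∫ x in z - ρ..z + ρ, G (q + 1) x ^ 2 with hI
  have hI0 : 0 ≤ I := intervalIntegral.integral_nonneg (by linarith) fun _ _ => sq_nonneg _
  have hsub : ∀ a b, a ≤ b → z - ρ ≤ a → b ≤ z + ρ → ∫ x in a..b, G (q + 1) x ^ 2 ≤ I := by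
    intro a b hab ha hb
    exact intervalIntegral.integral_mono_interval ha hab hb (.of_forall fun _ => sq_nonneg _)
      (Continuous.intervalIntegrable (by fun_prop) _ _)
  have hab : ∀ a b, a ≤ b → z - ρ ≤ a → b ≤ z + ρ → b - a ≤ ρ → (G q b - G q a) ^ 2 ≤ ρ * I := by
    intro a b hab ha hb hba
    rw [← intervalIntegral.integral_eq_sub_of_hasDerivAt (fun x _ => hG q le_rfl x)
      (hc.intervalIntegrable _ _)]
    refine (sq_intervalIntegral_le hc hab).trans ?_
    exact mul_le_mul hba (hsub a b hab ha hb)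
      (intervalIntegral.integral_nonneg hab fun _ _ => sq_nonneg _) hρ
  -- The oscillation of the `q`-th derivative is bounded by the `L²` norm of the next one, and so
  -- may serve as the constant in `taylor_bound`.
  have hK : ∀ x ∈ Set.Icc (z - ρ) (z + ρ), |G q x - G q z| ≤ Real.sqrt (ρ * I) := by
    intro x hx
    refine Real.abs_le_sqrt ?_
    rcases le_total z x with h | h
    · exact hab z x h (by linarith) hx.2 (by linarith [hx.2])
    · rw [← neg_sub, neg_sq]
      exact hab x z h hx.1 (by linarith) (by linarith [hx.1])
  rw [abs_le] at hy
  have := taylor_bound (convex_Icc (z - ρ) (z + ρ)) (a := z) ⟨by linarith, by linarith⟩ q G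
    (fun k hk x _ => (hG k hk.le x).hasDerivWithinAt) hK y ⟨by linarith, by linarith⟩
  rw [Finset.sum_range_succ, ← sub_sub]
  calc _ = |G 0 y - ∑ k ∈ Finset.range q, G k z * (y - z) ^ k / (k.factorial : ℝ)
        - G q z * (y - z) ^ q / (q.factorial : ℝ)| ^ 2 := (sq_abs _).symm
    _ ≤ (Real.sqrt (ρ * I) * |y - z| ^ q) ^ 2 := by gcongr
    _ ≤ (Real.sqrt (ρ * I) * ρ ^ q) ^ 2 := by gcongr; exact abs_le.2 hy
    _ = _ := by rw [mul_pow, Real.sq_sqrt (by positivity)]; ring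

lemma exists_taylor_polynomial (q : ℕ) (a : ℕ → ℝ) (d z : ℝ) : ∃ P : ℝ[X], P.natDegree ≤ q ∧
    ∀ y, P.eval y = ∑ k ∈ Finset.range (q + 1), a k * (y * d - z) ^ k / (k.factorial : ℝ) := by
  refine ⟨∑ k ∈ Finset.range (q + 1), C (a k / (k.factorial : ℝ)) * (C d * X - C z) ^ k, ?_, ?_⟩
  · refine natDegree_sum_le_of_forall_le _ _ fun k hk => ?_
    refine (natDegree_C_mul_le _ _).trans ((natDegree_pow_le_of_le k (?_ : _ ≤ 1)).trans ?_)
    · exact (natDegree_sub_le _ _).trans (max_le ((natDegree_C_mul_le _ _).trans natDegree_X_le)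
        (by simp))
    · have := Finset.mem_range.1 hk; omega
  · intro y
    rw [Polynomial.eval_finsetSum]
    refine Finset.sum_congr rfl fun k _ => ?_
    simp; ring

/-- Sampled at separated points, interpolation with the kernel `ψ` has an `ℓ²` error of order
`q + 1`. -/
theorem IsKernel.interp_error {q : ℕ} {ψ : ℝ → ℝ} (h : IsKernel (q + 1) ψ) : ∃ C, 0 ≤ C ∧
    ∀ (Δx : ℝ) (z : ℤ → ℝ) (G : ℕ → ℝ → ℝ), 0 < Δx → (∀ i k, i < k → z i + Δx / 2 ≤ z k) →
      (∀ k ≤ q, ∀ x, HasDerivAt (G k) (G (k + 1) x) x) → Continuous (G (q + 1)) →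
      Integrable (fun x => G (q + 1) x ^ 2) → (∃ B, ∀ x, |G 0 x| ≤ B) →
      Summable (fun i => (G 0 (z i) - kernelInterp ψ Δx (fun j => G 0 (j * Δx)) (z i)) ^ 2) ∧
      Δx * ∑' i, (G 0 (z i) - kernelInterp ψ Δx (fun j => G 0 (j * Δx)) (z i)) ^ 2
        ≤ C * Δx ^ (2 * (q + 1)) * ∫ x, G (q + 1) x ^ 2 := by
  -- With `t = 1 + |k|`, the squared kernel decays like `t^{-(2q+6)}`. The squared Taylor remainder
  -- uses `2 q + 1` powers, the Cauchy–Schwarz weight two, and the overlap of the integration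
  -- windows one; two are left for summation.
  obtain ⟨A, hA⟩ := h.decay (q + 3)
  have hA0 : 0 ≤ A := le_trans (by positivity) (hA 0)
  set Z := ∑' l : ℤ, ((1 + |(l : ℝ)|) ^ 2)⁻¹ with hZ
  have hZ0 : 0 ≤ Z := tsum_nonneg fun _ => by positivity
  have hZS : ∀ J : Finset ℤ, ∑ k ∈ J, ((1 + |(k : ℝ)|) ^ 2)⁻¹ ≤ Z := fun J =>
    summable_inv_one_add_abs_sq.sum_le_tsum J fun _ _ => by positivity
  set A' := (A * 2 ^ (q + 3)) ^ 2 with hA'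
  refine ⟨4 * A' * Z ^ 2, by positivity, fun Δx z G hΔ hz hG hc hi ⟨B, hB⟩ => ?_⟩
  set M := ∫ x, G (q + 1) x ^ 2 with hM
  have hM0 : 0 ≤ M := integral_nonneg fun _ => sq_nonneg _
  set n : ℤ → ℤ := fun i => ⌊z i / Δx⌋ with hn
  set R : ℤ → ℤ → ℝ := fun i k => ∑ l ∈ Finset.range (q + 1),
    G l (z i) * (((k + n i : ℤ) : ℝ) * Δx - z i) ^ l / (l.factorial : ℝ)
      - G 0 (((k + n i : ℤ) : ℝ) * Δx) with hR
  set I : ℤ → ℤ → ℝ := fun i k => ∫ x in z i - Δx * (|(k : ℝ)| + 1)..z i + Δx * (|(k : ℝ)| + 1),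
    G (q + 1) x ^ 2 with hI
  have hI0 : ∀ i k, 0 ≤ I i k := fun i k =>
    intervalIntegral.integral_nonneg (by have := abs_nonneg (k : ℝ); nlinarith)
      fun _ _ => sq_nonneg _
  have hfl : ∀ i k : ℤ, z i / Δx - (k + n i : ℤ) = Int.fract (z i / Δx) - k := by
    intro i k
    have := Int.self_sub_floor (z i / Δx)
    rw [hn]; push_cast; linarith
  -- Reproduction, applied to the Taylor polynomial at `z i`, writes the value `G 0 (z i)` as a
  -- kernel sum, so the interpolation error becomes a kernel sum of Taylor remainders, indexed
  -- relative to the cell of `z i`.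
  have hsum : ∀ i, HasSum (fun k : ℤ => R i k * ψ (z i / Δx - (k + n i : ℤ)))
      (G 0 (z i) - kernelInterp ψ Δx (fun j => G 0 (j * Δx)) (z i)) := by
    intro i
    obtain ⟨P, hPd, hP⟩ := exists_taylor_polynomial q (fun l => G l (z i)) Δx (z i)
    obtain ⟨K, hK⟩ := exists_eval_growth P
    have h1 := (h.summable_growth (v := fun j => P.eval (j : ℝ)) (fun j => hK j) (z i / Δx)).hasSum
    rw [h.repro P (by omega), hP, div_mul_cancel₀ _ hΔ.ne'] at h1
    rw [Finset.sum_eq_single 0 (fun l _ hl => by simp [hl]) (by simp)] at h1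
    have h2 := (h.summable (v := fun j => G 0 (j * Δx)) (fun j => hB _) (z i / Δx)).hasSum
    have h3 := (Equiv.addRight (n i)).hasSum_iff.2 (h1.sub h2)
    simp only [sub_self, pow_zero, mul_one, Nat.factorial_zero, Nat.cast_one, div_one] at h3
    refine (congrArg (HasSum · _) (funext fun k => ?_)).mpr h3
    simp only [Function.comp, Equiv.coe_addRight, hP, hR]
    ring
  have hpt : ∀ i k, R i k ^ 2 * ψ (z i / Δx - (k + n i : ℤ)) ^ 2 * (1 + |(k : ℝ)|) ^ 2
      ≤ A' * Δx ^ (2 * q + 1) * (((1 + |(k : ℝ)|) ^ 3)⁻¹ * I i k) := by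
    intro i k
    have hf0 := Int.fract_nonneg (z i / Δx)
    have hf1 := (Int.fract_lt_one (z i / Δx)).le
    set φ := Int.fract (z i / Δx) with hφ
    set t := 1 + |(k : ℝ)| with ht
    have ht0 : 0 < t := by positivity
    have hR2 : R i k ^ 2 ≤ (Δx * t) ^ (2 * q + 1) * I i k := by
      have := taylor_sq_le hG hc (z := z i) (ρ := Δx * (|(k : ℝ)| + 1))
        (y := ((k + n i : ℤ) : ℝ) * Δx) (by positivity) ?_
      · rw [← neg_sub, neg_sq] at this
        rw [ht, add_comm 1]; exact this
      · have e1 : ((k + n i : ℤ) : ℝ) * Δx - z i = Δx * (k - φ) := by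
          have := hfl i k
          rw [← neg_sub (φ : ℝ) k, ← this]; field_simp; ring
        rw [e1, abs_mul, abs_of_pos hΔ]
        gcongr
        refine (abs_sub _ _).trans ?_
        rw [abs_of_nonneg hf0]; gcongr
    have hψ : |ψ (z i / Δx - (k + n i : ℤ))| * t ^ (q + 3) ≤ A * 2 ^ (q + 3) := by
      rw [hfl]
      have h1 := one_add_abs_le_mul (k : ℝ) φ
      rw [abs_sub_comm, abs_of_nonneg hf0] at h1
      have h4 : t ≤ 2 * (1 + |φ - k|) := h1.trans (by gcongr; linarith)
      calc _ ≤ |ψ (φ - k)| * (2 * (1 + |φ - k|)) ^ (q + 3) := by gcongr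
        _ = (|ψ (φ - k)| * (1 + |φ - k|) ^ (q + 3)) * 2 ^ (q + 3) := by rw [mul_pow]; ring
        _ ≤ _ := by gcongr; exact hA _
    have hψ2 : ψ (z i / Δx - (k + n i : ℤ)) ^ 2 * t ^ (2 * (q + 3)) ≤ A' := by
      rw [hA']
      calc _ = (|ψ (z i / Δx - (k + n i : ℤ))| * t ^ (q + 3)) ^ 2 := by
            rw [mul_pow, sq_abs]; ring
        _ ≤ _ := by gcongr
    have e3 : (Δx * t) ^ (2 * q + 1) * t ^ 2 = Δx ^ (2 * q + 1) * (t ^ 3)⁻¹ * t ^ (2 * (q + 3)) := by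
      rw [mul_pow]; field_simp; ring
    calc _ ≤ (Δx * t) ^ (2 * q + 1) * I i k * ψ (z i / Δx - (k + n i : ℤ)) ^ 2 * t ^ 2 := by
          gcongr
      _ = ((Δx * t) ^ (2 * q + 1) * t ^ 2) * ψ (z i / Δx - (k + n i : ℤ)) ^ 2 * I i k := by ring
      _ = (ψ (z i / Δx - (k + n i : ℤ)) ^ 2 * t ^ (2 * (q + 3)))
          * (Δx ^ (2 * q + 1) * ((t ^ 3)⁻¹ * I i k)) := by rw [e3]; ring
      _ ≤ A' * (Δx ^ (2 * q + 1) * ((t ^ 3)⁻¹ * I i k)) := by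
          have := hI0 i k
          gcongr
      _ = _ := by ring
  -- A window of radius `Δx (|k| + 1)` consists of `4 (|k| + 1)` pieces of length `Δx / 2`, the
  -- separation of the points.
  have hIS : ∀ (S : Finset ℤ) (k : ℤ), ∑ i ∈ S, I i k ≤ 4 * (1 + |(k : ℝ)|) * M := by
    intro S k
    have := sum_intervalIntegral_le (g := fun x => G (q + 1) x ^ 2) (fun _ => sq_nonneg _) hi
      (w := Δx / 2) (by positivity) (z := fun i => z i - Δx * (|(k : ℝ)| + 1))
      (fun i l hil => by linarith [hz i l hil]) (4 * (k.natAbs + 1)) S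
    have hk : ((k.natAbs : ℕ) : ℝ) = |(k : ℝ)| := by rw [Nat.cast_natAbs, Int.cast_abs]
    push_cast [hk] at this
    rw [add_comm 1 |(k : ℝ)|]
    refine le_trans (le_of_eq (Finset.sum_congr rfl fun i _ => ?_)) this
    rw [hI]
    ring_nf
  have hfin : ∀ S J : Finset ℤ, ∑ i ∈ S, (∑ k ∈ J, R i k * ψ (z i / Δx - (k + n i : ℤ))) ^ 2
      ≤ 4 * A' * Z ^ 2 * Δx ^ (2 * q + 1) * M := by
    intro S J
    have hcs : ∀ i, (∑ k ∈ J, R i k * ψ (z i / Δx - (k + n i : ℤ))) ^ 2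
        ≤ Z * ∑ k ∈ J, A' * Δx ^ (2 * q + 1) * (((1 + |(k : ℝ)|) ^ 3)⁻¹ * I i k) := by
      intro i
      refine (Finset.sum_sq_le_sum_mul_sum_of_sq_le_mul J
        (f := fun k : ℤ => ((1 + |(k : ℝ)|) ^ 2)⁻¹)
        (g := fun k : ℤ => R i k ^ 2 * ψ (z i / Δx - (k + n i : ℤ)) ^ 2 * (1 + |(k : ℝ)|) ^ 2)
        (fun _ _ => by positivity) (fun _ _ => by positivity) fun k _ => ?_).trans ?_
      · rw [mul_pow]; exact le_of_eq (by field_simp)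
      · exact mul_le_mul (hZS J) (Finset.sum_le_sum fun k _ => hpt i k)
          (Finset.sum_nonneg fun _ _ => by positivity) hZ0
    refine (Finset.sum_le_sum fun i _ => hcs i).trans ?_
    rw [← Finset.mul_sum, Finset.sum_comm]
    simp_rw [← Finset.mul_sum]
    calc _ ≤ Z * (A' * Δx ^ (2 * q + 1) * ∑ k ∈ J, ((1 + |(k : ℝ)|) ^ 3)⁻¹
          * (4 * (1 + |(k : ℝ)|) * M)) := by
          gcongr with k hk
          exact hIS S k
      _ = Z * (A' * Δx ^ (2 * q + 1) * (4 * M * ∑ k ∈ J, ((1 + |(k : ℝ)|) ^ 2)⁻¹)) := by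
          congr 2
          rw [Finset.mul_sum]
          refine Finset.sum_congr rfl fun k _ => ?_
          have : 0 < 1 + |(k : ℝ)| := by positivity
          field_simp
      _ ≤ Z * (A' * Δx ^ (2 * q + 1) * (4 * M * Z)) := by gcongr; exact hZS J
      _ = _ := by ring
  have hbound : ∀ S : Finset ℤ,
      ∑ i ∈ S, (G 0 (z i) - kernelInterp ψ Δx (fun j => G 0 (j * Δx)) (z i)) ^ 2
      ≤ 4 * A' * Z ^ 2 * Δx ^ (2 * q + 1) * M := fun S =>
    le_of_tendsto (tendsto_finsetSum S fun i _ => (hsum i).pow 2) (.of_forall fun J => hfin S J)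
  refine ⟨summable_of_sum_le (fun _ => sq_nonneg _) hbound, ?_⟩
  calc _ ≤ Δx * (4 * A' * Z ^ 2 * Δx ^ (2 * q + 1) * M) := by
        gcongr; exact Real.tsum_le_of_sum_le (fun _ => sq_nonneg _) hbound
    _ = _ := by ring


/-! ### Expansions along characteristics, over the increments and in time -/

lemma taylor_bound_zero {a r N : ℝ} (n : ℕ) (φ : ℕ → ℝ → ℝ)
    (hd : ∀ k < n, ∀ x ∈ Set.Icc (a - r) (a + r), HasDerivAt (φ k) (φ (k + 1) x) x)
    (h : ∀ x ∈ Set.Icc (a - r) (a + r), |φ n x| ≤ N) {w y : ℝ}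
    (hw : w ∈ Set.Icc (a - r) (a + r)) (hy : y ∈ Set.Icc (a - r) (a + r)) :
    |φ 0 y - ∑ k ∈ Finset.range n, φ k w * (y - w) ^ k / (k.factorial : ℝ)| ≤ N * |y - w| ^ n := by
  have := taylor_bound (convex_Icc (a - r) (a + r)) hw (r := 0) n φ
    (fun k hk x hx => (hd k hk x hx).hasDerivWithinAt) (fun x hx => by simpa using h x hx) y hy
  simpa using this

/-- Moving the first-order transport terms into a shift of the argument. -/
lemma shift_expand {a r σ v w Nc Ng : ℝ} {φ γ : ℕ → ℝ → ℝ}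
    (hφ : ∀ k < 3, ∀ x ∈ Set.Icc (a - r) (a + r), HasDerivAt (φ k) (φ (k + 1) x) x)
    (hγ : ∀ k < 2, ∀ x ∈ Set.Icc (a - r) (a + r), HasDerivAt (γ k) (γ (k + 1) x) x)
    (hNc : ∀ x ∈ Set.Icc (a - r) (a + r), |φ 3 x| ≤ Nc)
    (hNg : ∀ x ∈ Set.Icc (a - r) (a + r), |γ 2 x| ≤ Ng)
    (hw : w ∈ Set.Icc (a - r) (a + r)) (hy : w + σ * v ∈ Set.Icc (a - r) (a + r)) :
    |φ 0 w + σ * v * φ 1 w + σ * γ 0 w - (φ 0 (w + σ * v) + σ * γ 0 (w + σ * v)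
      - σ ^ 2 * (v ^ 2 * φ 2 w / 2 + v * γ 1 w))| ≤ |σ| ^ 3 * (|v| ^ 3 * Nc + |v| ^ 2 * Ng) := by
  have h1 := taylor_bound_zero 3 φ hφ hNc hw hy
  have h2 := taylor_bound_zero 2 γ hγ hNg hw hy
  simp only [Finset.sum_range_succ, Finset.sum_range_zero, Nat.factorial, add_sub_cancel_left,
    abs_mul] at h1 h2
  set A := φ 0 (w + σ * v)
  set B := γ 0 (w + σ * v)
  push_cast at h1 h2
  have h3 := mul_le_mul_of_nonneg_left h2 (abs_nonneg σ)
  rw [← abs_mul] at h3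
  refine le_trans (le_trans (le_of_eq ?_) (abs_add_le _ _)) (le_trans (add_le_add
    ((abs_neg _).le.trans h1) ((abs_neg _).le.trans h3)) (le_of_eq (by ring)))
  congr 1
  ring

lemma average_expand_four {a r s y N : ℝ} {φ : ℕ → ℝ → ℝ}
    (hφ : ∀ k < 4, ∀ x ∈ Set.Icc (a - r) (a + r), HasDerivAt (φ k) (φ (k + 1) x) x)
    (hN : ∀ x ∈ Set.Icc (a - r) (a + r), |φ 4 x| ≤ N) (hy : y ∈ Set.Icc (a - r) (a + r))
    (hp : y + s ∈ Set.Icc (a - r) (a + r)) (hm : y - s ∈ Set.Icc (a - r) (a + r)) :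
    |1 / 6 * φ 0 (y + s) + 1 / 6 * φ 0 (y - s) + 2 / 3 * φ 0 y
      - (φ 0 y + s ^ 2 / 6 * φ 2 y)| ≤ s ^ 4 * N / 3 := by
  have h1 := taylor_bound_zero 4 φ hφ hN hy hp
  have h2 := taylor_bound_zero 4 φ hφ hN hy hm
  simp only [Finset.sum_range_succ, Finset.sum_range_zero, Nat.factorial, add_sub_cancel_left,
    sub_sub_cancel_left, abs_neg] at h1 h2
  rw [show |s| ^ 4 = s ^ 4 from (by decide : Even 4).pow_abs s] at h1 h2
  push_cast at h1 h2
  rw [abs_le] at h1 h2 ⊢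
  constructor <;> nlinarith [h1.1, h1.2, h2.1, h2.2]

/-- Odd terms cancel. For `s² = 6 h ν` the right-hand side is `φ + h ν φ'' + h² ν² φ'''' / 2`, the
heat semigroup to second order; this is where the weights and the increment are matched. -/
lemma average_expand_six {a r s y N : ℝ} {φ : ℕ → ℝ → ℝ}
    (hφ : ∀ k < 6, ∀ x ∈ Set.Icc (a - r) (a + r), HasDerivAt (φ k) (φ (k + 1) x) x)
    (hN : ∀ x ∈ Set.Icc (a - r) (a + r), |φ 6 x| ≤ N) (hy : y ∈ Set.Icc (a - r) (a + r))
    (hp : y + s ∈ Set.Icc (a - r) (a + r)) (hm : y - s ∈ Set.Icc (a - r) (a + r)) :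
    |1 / 6 * φ 0 (y + s) + 1 / 6 * φ 0 (y - s) + 2 / 3 * φ 0 y
      - (φ 0 y + s ^ 2 / 6 * φ 2 y + s ^ 4 / 72 * φ 4 y)| ≤ s ^ 6 * N / 3 := by
  have h1 := taylor_bound_zero 6 φ hφ hN hy hp
  have h2 := taylor_bound_zero 6 φ hφ hN hy hm
  simp only [Finset.sum_range_succ, Finset.sum_range_zero, Nat.factorial, add_sub_cancel_left,
    sub_sub_cancel_left, abs_neg] at h1 h2
  rw [show |s| ^ 6 = s ^ 6 from (by decide : Even 6).pow_abs s] at h1 h2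
  push_cast at h1 h2
  rw [abs_le] at h1 h2 ⊢
  constructor <;> linarith [h1.1, h1.2, h2.1, h2.2]

/-- `D a b` are the partial derivatives `∂_t^a ∂_x^b` of a function on `ℝ × [0, T]`, up to
parabolic order `7`. -/
structure IsParabolicJet (T : ℝ) (D : ℕ → ℕ → ℝ → ℝ → ℝ) : Prop where
  dx : ∀ a b, 2 * a + b ≤ 6 → ∀ x, ∀ t ∈ Set.Icc 0 T,
    HasDerivAt (fun y => D a b y t) (D a (b + 1) x t) x
  dt : ∀ a b, 2 * a + b ≤ 5 → ∀ x, ∀ t ∈ Set.Icc 0 T,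
    HasDerivWithinAt (fun s => D a b x s) (D (a + 1) b x t) (Set.Icc 0 T) t
  cont : ∀ a b, 2 * a + b ≤ 7 →
    ContinuousOn (fun q : ℝ × ℝ => D a b q.1 q.2) (Set.univ ×ˢ Set.Icc 0 T)

lemma IsParabolicJet.continuousOn_time {T : ℝ} {D : ℕ → ℕ → ℝ → ℝ → ℝ} (h : IsParabolicJet T D)
    {a b : ℕ} (hab : 2 * a + b ≤ 7) (x : ℝ) : ContinuousOn (D a b x) (Set.Icc 0 T) :=
  (h.cont a b hab).comp (f := fun t : ℝ => ((x, t) : ℝ × ℝ)) (by fun_prop)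
    fun _ ht => ⟨Set.mem_univ _, ht⟩

lemma IsParabolicJet.continuous_space {T : ℝ} {D : ℕ → ℕ → ℝ → ℝ → ℝ} (h : IsParabolicJet T D)
    {a b : ℕ} (hab : 2 * a + b ≤ 7) {t : ℝ} (ht : t ∈ Set.Icc 0 T) :
    Continuous fun x => D a b x t :=
  (h.cont a b hab).comp_continuous (f := fun x : ℝ => ((x, t) : ℝ × ℝ)) (by fun_prop)
    fun _ => ⟨Set.mem_univ _, ht⟩

lemma abs_sub_le_integral {φ φ' N : ℝ → ℝ} {t t' θ : ℝ} (hθ : θ ∈ Set.Icc t t')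
    (hd : ∀ s ∈ Set.Icc t t', HasDerivWithinAt φ (φ' s) (Set.Icc t t') s)
    (hc : ContinuousOn φ' (Set.Icc t t')) (hN : Continuous N)
    (hle : ∀ s ∈ Set.Icc t t', |φ' s| ≤ N s) : |φ θ - φ t| ≤ ∫ s in t..t', N s := by
  have hsub : Set.Icc t θ ⊆ Set.Icc t t' := Set.Icc_subset_Icc_right hθ.2
  have h1 : ∫ s in t..θ, φ' s = φ θ - φ t := by
    refine intervalIntegral.integral_eq_sub_of_hasDeriv_right_of_le hθ.1
      (fun s hs => ((hd s (hsub hs)).mono hsub).continuousWithinAt) (fun s hs => ?_) ?_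
    · refine ((hd s (hsub ⟨hs.1.le, hs.2.le⟩)).mono_of_mem_nhdsWithin ?_)
      exact mem_nhdsWithin_of_mem_nhds (Icc_mem_nhds hs.1 (hs.2.trans_le hθ.2))
    · exact (hc.mono hsub).intervalIntegrable_of_Icc hθ.1
  rw [← h1]
  calc |∫ s in t..θ, φ' s| ≤ ∫ s in t..θ, |φ' s| := intervalIntegral.abs_integral_le_integral_abs hθ.1
    _ ≤ ∫ s in t..θ, N s := intervalIntegral.integral_mono_on hθ.1
        ((hc.mono hsub).abs.intervalIntegrable_of_Icc hθ.1) (hN.intervalIntegrable _ _)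
        fun s hs => hle s (hsub hs)
    _ ≤ _ := by
      rw [← sub_nonneg, intervalIntegral.integral_interval_sub_left (hN.intervalIntegrable _ _)
        (hN.intervalIntegrable _ _)]
      exact intervalIntegral.integral_nonneg hθ.2 fun s hs =>
        (abs_nonneg _).trans (hle s ⟨hθ.1.trans hs.1, hs.2⟩)

/-- Single displacements are only `O(√h)`, but their weighted mean is `O(h)`. The first derivative
therefore meets the mean and the second derivative the squares. -/
lemma average_expand_two {r x dp dm d0 K₁ K₂ m₁ m₂ : ℝ} {H : ℕ → ℝ → ℝ} (hr : 0 ≤ r)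
    (hH : ∀ k < 2, ∀ y ∈ Set.Icc (x - r) (x + r), HasDerivAt (H k) (H (k + 1) y) y)
    (h1 : |H 1 x| ≤ K₁) (h2 : ∀ y ∈ Set.Icc (x - r) (x + r), |H 2 y| ≤ K₂)
    (hp : |dp| ≤ r) (hm : |dm| ≤ r) (h0 : |d0| ≤ r)
    (hd : |1 / 6 * dp + 1 / 6 * dm + 2 / 3 * d0| ≤ m₁)
    (hp2 : dp ^ 2 ≤ m₂) (hm2 : dm ^ 2 ≤ m₂) (h02 : d0 ^ 2 ≤ m₂) :
    |1 / 6 * H 0 (x + dp) + 1 / 6 * H 0 (x + dm) + 2 / 3 * H 0 (x + d0) - H 0 x|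
      ≤ K₁ * m₁ + K₂ * m₂ := by
  have hx : x ∈ Set.Icc (x - r) (x + r) := ⟨by linarith, by linarith⟩
  have hK2 : 0 ≤ K₂ := (abs_nonneg _).trans (h2 x hx)
  have key : ∀ d, |d| ≤ r → d ^ 2 ≤ m₂ → |H 0 (x + d) - H 0 x - H 1 x * d| ≤ K₂ * m₂ := by
    intro d hd hd2
    rw [abs_le] at hd
    have := taylor_bound_zero 2 H hH h2 hx (y := x + d) ⟨by linarith, by linarith⟩
    simp only [Finset.sum_range_succ, Finset.sum_range_zero, Nat.factorial,
      add_sub_cancel_left, sq_abs] at this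
    norm_num at this
    rw [← sub_sub] at this
    exact this.trans (by gcongr)
  have a1 := key dp hp hp2
  have a2 := key dm hm hm2
  have a3 := key d0 h0 h02
  have a4 : |H 1 x * (1 / 6 * dp + 1 / 6 * dm + 2 / 3 * d0)| ≤ K₁ * m₁ := by
    rw [abs_mul]
    exact mul_le_mul h1 hd (abs_nonneg _) ((abs_nonneg _).trans h1)
  rw [abs_le] at a1 a2 a3 a4 ⊢
  constructor <;> nlinarith [a1.1, a1.2, a2.1, a2.2, a3.1, a3.2, a4.1, a4.2]

lemma abs_le_of_displacement {U ν h ux uz e x z : ℝ} (hU : 0 ≤ U) (hν : 0 < ν) (hh : 0 < h)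
    (hh1 : h ≤ 1) (hux : |ux| ≤ U) (huz : |uz| ≤ U) (he : |e| ≤ 1)
    (hz : z = x - h / 2 * (ux + uz) + e * Real.sqrt (6 * h * ν)) :
    (z - x) ^ 2 ≤ h * (2 * U ^ 2 + 12 * ν) := by
  set s := Real.sqrt (6 * h * ν) with hs
  have hs2 : s ^ 2 = 6 * h * ν := Real.sq_sqrt (by positivity)
  have h1 : (h / 2 * (ux + uz)) ^ 2 ≤ (h * U) ^ 2 := by
    rw [sq_le_sq, abs_mul, abs_of_pos (by positivity : 0 < h / 2), abs_of_nonneg (a := h * U)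
      (by positivity)]
    have := (abs_add_le ux uz).trans (add_le_add hux huz)
    nlinarith
  have h2 : (e * s) ^ 2 ≤ s ^ 2 := by
    rw [mul_pow]
    have : e ^ 2 ≤ 1 := by rw [sq_le_one_iff_abs_le_one]; exact he
    nlinarith [sq_nonneg s]
  have h3 : (h * U) ^ 2 ≤ h * U ^ 2 := by
    rw [mul_pow]
    have : h ^ 2 ≤ h := by nlinarith
    gcongr
  rw [hz]
  nlinarith [sq_nonneg (h / 2 * (ux + uz) + e * s)]

lemma exists_small_step (U : ℝ) {ν : ℝ} (hν : 0 < ν) : ∃ h₀, 0 < h₀ ∧ h₀ ≤ 1 ∧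
    ∀ h, 0 < h → h ≤ h₀ → h * (2 * U ^ 2 + 12 * ν) ≤ 1 := by
  refine ⟨min 1 (2 * U ^ 2 + 12 * ν)⁻¹, by positivity, min_le_left _ _, fun h _ hh => ?_⟩
  have := hh.trans (min_le_right _ _)
  rwa [← one_div, le_div_iff₀ (by positivity)] at this

/-! ### The pointwise truncation error -/

section Truncation

variable {T U ν : ℝ} {u u₁ u₂ : ℝ → ℝ} {D : ℕ → ℕ → ℝ → ℝ → ℝ}

/-- The space derivatives of `g = c_t - ν c_xx`. -/
def heatPart (ν : ℝ) (D : ℕ → ℕ → ℝ → ℝ → ℝ) (a b : ℕ) (x t : ℝ) : ℝ :=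
  D (a + 1) b x t - ν * D a (b + 2) x t

/-- The second-order correction `H = u² c_xx / 2 + u g_x` and its space derivatives. -/
def corrPart (ν : ℝ) (u u₁ u₂ : ℝ → ℝ) (D : ℕ → ℕ → ℝ → ℝ → ℝ) (t : ℝ) : ℕ → ℝ → ℝ
  | 0, x => u x ^ 2 * D 0 2 x t / 2 + u x * heatPart ν D 0 1 x t
  | 1, x => u x * u₁ x * D 0 2 x t + u x ^ 2 * D 0 3 x t / 2 + u₁ x * heatPart ν D 0 1 x t
      + u x * heatPart ν D 0 2 x t
  | _, x => (u₁ x ^ 2 + u x * u₂ x) * D 0 2 x t + 2 * u x * u₁ x * D 0 3 x t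
      + u x ^ 2 * D 0 4 x t / 2 + u₂ x * heatPart ν D 0 1 x t + 2 * u₁ x * heatPart ν D 0 2 x t
      + u x * heatPart ν D 0 3 x t

lemma heatPart_dx (hD : IsParabolicJet T D) {a b : ℕ} (hab : 2 * a + b ≤ 4) (x : ℝ) {t : ℝ}
    (ht : t ∈ Set.Icc 0 T) :
    HasDerivAt (fun y => heatPart ν D a b y t) (heatPart ν D a (b + 1) x t) x :=
  (hD.dx (a + 1) b (by omega) x t ht).sub ((hD.dx a (b + 2) (by omega) x t ht).const_mul ν)

lemma heatPart_dt (hD : IsParabolicJet T D) {a b : ℕ} (hab : 2 * a + b ≤ 3) (x : ℝ) {t : ℝ}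
    (ht : t ∈ Set.Icc 0 T) :
    HasDerivWithinAt (fun s => heatPart ν D a b x s) (heatPart ν D (a + 1) b x t)
      (Set.Icc 0 T) t :=
  (hD.dt (a + 1) b (by omega) x t ht).sub ((hD.dt a (b + 2) (by omega) x t ht).const_mul ν)

lemma heatPart_abs_le {N x t : ℝ} (hν : 0 ≤ ν) {a b : ℕ} (h1 : |D (a + 1) b x t| ≤ N)
    (h2 : |D a (b + 2) x t| ≤ N) : |heatPart ν D a b x t| ≤ (1 + ν) * N := by
  unfold heatPart
  refine (abs_sub _ _).trans ?_
  rw [abs_mul, abs_of_nonneg hν]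
  nlinarith

lemma heatPart_continuousOn_time (hD : IsParabolicJet T D) {a b : ℕ} (hab : 2 * a + b ≤ 5) (x : ℝ) :
    ContinuousOn (heatPart ν D a b x) (Set.Icc 0 T) :=
  (hD.continuousOn_time (by omega) x).sub
    (continuousOn_const.mul (hD.continuousOn_time (by omega) x))

lemma corrPart_dx (hD : IsParabolicJet T D) (hu : ∀ x, HasDerivAt u (u₁ x) x)
    (hu₁ : ∀ x, HasDerivAt u₁ (u₂ x) x) {t : ℝ} (ht : t ∈ Set.Icc 0 T) {k : ℕ} (hk : k < 2)
    (x : ℝ) : HasDerivAt (corrPart ν u u₁ u₂ D t k) (corrPart ν u u₁ u₂ D t (k + 1) x) x := by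
  have c2 := hD.dx 0 2 (by norm_num) x t ht
  have c3 := hD.dx 0 3 (by norm_num) x t ht
  have g1 := heatPart_dx (ν := ν) hD (a := 0) (b := 1) (by norm_num) x ht
  have g2 := heatPart_dx (ν := ν) hD (a := 0) (b := 2) (by norm_num) x ht
  interval_cases k
  · refine HasDerivAt.congr_deriv (((((hu x).pow 2).mul c2).div_const 2).add ((hu x).mul g1)) ?_
    simp [corrPart]; ring
  · refine HasDerivAt.congr_deriv ((((((hu x).mul (hu₁ x)).mul c2).add ((((hu x).pow 2).mul c3).div_const 2)).add
      ((hu₁ x).mul g1)).add ((hu x).mul g2)) ?_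
    simp [corrPart]; ring

end Truncation


lemma abs_le_const_mul {c X B : ℝ} (hc : 0 ≤ c) (hX : |X| ≤ B) :
    -(c * B) ≤ c * X ∧ c * X ≤ c * B := by
  rw [abs_le] at hX
  constructor <;> nlinarith [hX.1, hX.2]

section Truncation

variable {T U ν : ℝ} {u u₁ u₂ : ℝ → ℝ} {D : ℕ → ℕ → ℝ → ℝ → ℝ}

/-- The right-hand side `c_t + u c_x - ν c_xx`. -/
def reactPart (ν : ℝ) (u : ℝ → ℝ) (D : ℕ → ℕ → ℝ → ℝ → ℝ) (x t : ℝ) : ℝ :=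
  heatPart ν D 0 0 x t + u x * D 0 1 x t

/-- A trapezoidal half step `σ = ±h/2` is absorbed into a shift of the argument by `σ u`. The new
level at `x` is thereby moved to `x - h u(x) / 2`, and the feet to this same point plus their
increments, so the two sides of the scheme can be compared. -/
lemma reactPart_shift (hD : IsParabolicJet T D) (hν : 0 ≤ ν) (hub : ∀ x, |u x| ≤ U) {σ t x w N : ℝ}
    (ht : t ∈ Set.Icc 0 T)
    (hN : ∀ y ∈ Set.Icc (x - 1) (x + 1), ∀ a b, 1 ≤ 2 * a + b → 2 * a + b ≤ 6 → |D a b y t| ≤ N)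
    (hw : w ∈ Set.Icc (x - 1) (x + 1)) (hy : w + σ * u w ∈ Set.Icc (x - 1) (x + 1)) :
    |D 0 0 w t + σ * reactPart ν u D w t - (D 0 0 (w + σ * u w) t
      + σ * heatPart ν D 0 0 (w + σ * u w) t - σ ^ 2 * corrPart ν u u₁ u₂ D t 0 w)|
      ≤ |σ| ^ 3 * ((U ^ 3 + U ^ 2 * (1 + ν)) * N) := by
  have hN0 : 0 ≤ N := (abs_nonneg _).trans (hN w hw 0 1 (by norm_num) (by norm_num))
  have := shift_expand (φ := fun k y => D 0 k y t) (γ := fun k y => heatPart ν D 0 k y t)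
    (a := x) (r := 1) (σ := σ) (v := u w) (w := w) (Nc := N) (Ng := (1 + ν) * N)
    (fun k hk y _ => hD.dx 0 k (by omega) y t ht)
    (fun k hk y _ => heatPart_dx hD (by omega) y ht)
    (fun y hy => hN y hy 0 3 (by norm_num) (by norm_num))
    (fun y hy => heatPart_abs_le hν (hN y hy _ _ (by norm_num) (by norm_num))
      (hN y hy _ _ (by norm_num) (by norm_num))) hw hy
  refine le_trans (le_of_eq ?_) (this.trans ?_)
  · congr 1; simp only [reactPart, corrPart]; ring
  · have h1 := hub w
    have : |u w| ^ 3 * N + |u w| ^ 2 * ((1 + ν) * N) ≤ U ^ 3 * N + U ^ 2 * ((1 + ν) * N) := by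
      gcongr
    refine mul_le_mul_of_nonneg_left (this.trans (le_of_eq (by ring))) (by positivity)

/-- The constant in the truncation error estimate. -/
def truncConst (U ν : ℝ) : ℝ :=
  2 * (U ^ 3 + U ^ 2 * (1 + ν)) + 1 + (1 + ν) + (U ^ 2 + U * (1 + ν)) + 72 * ν ^ 3
    + 6 * ν ^ 2 * (1 + ν) + (3 * U ^ 2 + 2 * U * (1 + ν)) * U
    + (5 * U ^ 2 + 4 * U * (1 + ν)) * (2 * U ^ 2 + 12 * ν)

/-- The remainders keep the time integral of the local bound instead of its supremum: the grid sum
of squares of the bound is controlled at each fixed time, and this passes to the integral but not to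
a supremum. -/
lemma IsParabolicJet.time_expand (hD : IsParabolicJet T D) (hν : 0 ≤ ν)
    (hub : ∀ x, |u x| ≤ U) {h t x y : ℝ} {N : ℝ → ℝ} (hh : 0 < h) (ht : 0 ≤ t) (hT : t + h ≤ T)
    (hN : Continuous N) (hy : y ∈ Set.Icc (x - 1) (x + 1))
    (hNb : ∀ θ ∈ Set.Icc t (t + h), ∀ y ∈ Set.Icc (x - 1) (x + 1), ∀ a b, 1 ≤ 2 * a + b →
      2 * a + b ≤ 6 → |D a b y θ| ≤ N θ) :
    |D 0 0 y (t + h) - (D 0 0 y t + D 1 0 y t * h + D 2 0 y t * h ^ 2 / 2)|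
        ≤ (∫ θ in t..t + h, N θ) * h ^ 2 ∧
    |heatPart ν D 0 0 y (t + h) - (heatPart ν D 0 0 y t + heatPart ν D 1 0 y t * h)|
        ≤ (1 + ν) * (∫ θ in t..t + h, N θ) * h ∧
    |corrPart ν u u₁ u₂ D (t + h) 0 y - corrPart ν u u₁ u₂ D t 0 y|
        ≤ (U ^ 2 + U * (1 + ν)) * ∫ θ in t..t + h, N θ := by
  set J := ∫ θ in t..t + h, N θ with hJ
  have hsub : Set.Icc t (t + h) ⊆ Set.Icc 0 T := Set.Icc_subset_Icc ht hT
  have htm : t ∈ Set.Icc t (t + h) := ⟨le_rfl, by linarith⟩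
  have htm' : t + h ∈ Set.Icc t (t + h) := ⟨by linarith, le_rfl⟩
  have hJ0 : 0 ≤ J := intervalIntegral.integral_nonneg (by linarith) fun θ hθ =>
    (abs_nonneg _).trans (hNb θ hθ y hy 0 1 (by norm_num) (by norm_num))
  have hDJ : ∀ a b, 2 * a + b ≤ 4 → ∀ θ ∈ Set.Icc t (t + h), |D a b y θ - D a b y t| ≤ J :=
    fun a b hab θ hθ => abs_sub_le_integral hθ
      (fun s hs => (hD.dt a b (by omega) y s (hsub hs)).mono hsub)
      ((hD.continuousOn_time (by omega) y).mono hsub) hN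
      fun s hs => hNb s hs y hy _ _ (by omega) (by omega)
  have hGJ : ∀ a b, 2 * a + b ≤ 2 → ∀ θ ∈ Set.Icc t (t + h),
      |heatPart ν D a b y θ - heatPart ν D a b y t| ≤ (1 + ν) * J := by
    intro a b hab θ hθ
    have := abs_sub_le_integral hθ
      (fun s hs => (heatPart_dt (ν := ν) hD (by omega) y (hsub hs)).mono hsub)
      ((heatPart_continuousOn_time (ν := ν) hD (a := a + 1) (b := b) (by omega) y).mono hsub)
      (hN.const_mul (1 + ν))
      fun s hs => heatPart_abs_le hν (hNb s hs y hy _ _ (by omega) (by omega))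
        (hNb s hs y hy _ _ (by omega) (by omega))
    rwa [intervalIntegral.integral_const_mul] at this
  refine ⟨?_, ?_, ?_⟩
  · have := taylor_bound (convex_Icc t (t + h)) htm 2 (fun k => D k 0 y)
      (fun k hk s hs => (hD.dt k 0 (by omega) y s (hsub hs)).mono hsub)
      (fun s hs => hDJ 2 0 (by norm_num) s hs) _ htm'
    simp only [Finset.sum_range_succ, Finset.sum_range_zero, Nat.factorial, add_sub_cancel_left,
      abs_of_pos hh] at this
    refine le_trans (le_of_eq ?_) this
    congr 1; push_cast; ring
  · have := taylor_bound (convex_Icc t (t + h)) htm 1 (fun k => heatPart ν D k 0 y)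
      (fun k hk s hs => (heatPart_dt hD (by omega) y (hsub hs)).mono hsub)
      (fun s hs => hGJ 1 0 (by norm_num) s hs) _ htm'
    simp only [Finset.sum_range_succ, Finset.sum_range_zero, Nat.factorial, add_sub_cancel_left,
      abs_of_pos hh] at this
    refine le_trans (le_of_eq ?_) (this.trans_eq (by ring))
    congr 1; push_cast; ring
  · have e : corrPart ν u u₁ u₂ D (t + h) 0 y - corrPart ν u u₁ u₂ D t 0 y
        = u y ^ 2 / 2 * (D 0 2 y (t + h) - D 0 2 y t)
          + u y * (heatPart ν D 0 1 y (t + h) - heatPart ν D 0 1 y t) := by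
      simp only [corrPart]; ring
    have h1 := hub y
    have hU : 0 ≤ U := (abs_nonneg _).trans h1
    rw [e]
    refine (abs_add_le _ _).trans ?_
    rw [abs_mul, abs_mul, abs_div, abs_pow, abs_two]
    calc _ ≤ U ^ 2 / 2 * J + U * ((1 + ν) * J) := by
          gcongr
          · exact hDJ 0 2 (by norm_num) _ htm'
          · exact hGJ 0 1 (by norm_num) _ htm'
      _ ≤ _ := by nlinarith [mul_nonneg (sq_nonneg U) hJ0]

lemma corrPart_one_abs_le {x t N : ℝ} (h0 : |u x| ≤ U) (h1 : |u₁ x| ≤ U)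
    (n2 : |D 0 2 x t| ≤ N) (n3 : |D 0 3 x t| ≤ N) (m1 : |heatPart ν D 0 1 x t| ≤ (1 + ν) * N)
    (m2 : |heatPart ν D 0 2 x t| ≤ (1 + ν) * N) :
    |corrPart ν u u₁ u₂ D t 1 x| ≤ (3 * U ^ 2 + 2 * U * (1 + ν)) * N := by
  have hU : 0 ≤ U := (abs_nonneg _).trans h0
  have hN : 0 ≤ N := (abs_nonneg _).trans n2
  have hM : 0 ≤ (1 + ν) * N := (abs_nonneg _).trans m1
  simp only [corrPart]
  refine (abs_add_le _ _).trans (le_trans (add_le_add_left ((abs_add_le _ _).trans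
    (add_le_add_left (abs_add_le _ _) _)) _) ?_)
  simp only [abs_mul, abs_div, abs_pow, abs_two]
  calc _ ≤ U * U * N + U ^ 2 * N / 2 + U * ((1 + ν) * N) + U * ((1 + ν) * N) := by gcongr
    _ ≤ _ := by nlinarith [mul_nonneg (sq_nonneg U) hN]

lemma corrPart_two_abs_le {x t N : ℝ} (h0 : |u x| ≤ U) (h1 : |u₁ x| ≤ U) (h2 : |u₂ x| ≤ U)
    (n2 : |D 0 2 x t| ≤ N) (n3 : |D 0 3 x t| ≤ N) (n4 : |D 0 4 x t| ≤ N)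
    (m1 : |heatPart ν D 0 1 x t| ≤ (1 + ν) * N) (m2 : |heatPart ν D 0 2 x t| ≤ (1 + ν) * N)
    (m3 : |heatPart ν D 0 3 x t| ≤ (1 + ν) * N) :
    |corrPart ν u u₁ u₂ D t 2 x| ≤ (5 * U ^ 2 + 4 * U * (1 + ν)) * N := by
  have hU : 0 ≤ U := (abs_nonneg _).trans h0
  have hN : 0 ≤ N := (abs_nonneg _).trans n2
  have hM : 0 ≤ (1 + ν) * N := (abs_nonneg _).trans m1
  simp only [corrPart]
  have b1 : |(u₁ x ^ 2 + u x * u₂ x) * D 0 2 x t| ≤ 2 * U ^ 2 * N := by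
    rw [abs_mul]
    refine mul_le_mul ((abs_add_le _ _).trans ?_) n2 (abs_nonneg _) (by positivity)
    rw [abs_mul, abs_pow]
    calc _ ≤ U ^ 2 + U * U := by gcongr
      _ = _ := by ring
  have b2 : |2 * u x * u₁ x * D 0 3 x t| ≤ 2 * U * U * N := by
    simp only [abs_mul, abs_two]; gcongr
  have b3 : |u x ^ 2 * D 0 4 x t / 2| ≤ U ^ 2 * N / 2 := by
    simp only [abs_mul, abs_div, abs_pow, abs_two]; gcongr
  have b4 : |u₂ x * heatPart ν D 0 1 x t| ≤ U * ((1 + ν) * N) := by rw [abs_mul]; gcongr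
  have b5 : |2 * u₁ x * heatPart ν D 0 2 x t| ≤ 2 * U * ((1 + ν) * N) := by
    simp only [abs_mul, abs_two]; gcongr
  have b6 : |u x * heatPart ν D 0 3 x t| ≤ U * ((1 + ν) * N) := by rw [abs_mul]; gcongr
  have hUN : 0 ≤ U ^ 2 * N := by positivity
  rw [abs_le] at b1 b2 b3 b4 b5 b6 ⊢
  constructor <;> linarith [b1.1, b1.2, b2.1, b2.2, b3.1, b3.2, b4.1, b4.2, b5.1, b5.2, b6.1, b6.2]

/-- The pointwise truncation error, in terms of local bounds for the derivatives of the solution. -/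
theorem truncation_le (hD : IsParabolicJet T D) (hν : 0 < ν)
    (hu : ∀ x, HasDerivAt u (u₁ x) x) (hu₁ : ∀ x, HasDerivAt u₁ (u₂ x) x)
    (hub : ∀ x, |u x| ≤ U) (hub₁ : ∀ x, |u₁ x| ≤ U) (hub₂ : ∀ x, |u₂ x| ≤ U)
    {h t x zp zm z0 : ℝ} {N : ℝ → ℝ} (hh : 0 < h) (hh1 : h ≤ 1)
    (hsmall : h * (2 * U ^ 2 + 12 * ν) ≤ 1) (ht : 0 ≤ t) (hT : t + h ≤ T) (hN : Continuous N)
    (hNb : ∀ θ ∈ Set.Icc t (t + h), ∀ y ∈ Set.Icc (x - 1) (x + 1), ∀ a b, 1 ≤ 2 * a + b →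
      2 * a + b ≤ 6 → |D a b y θ| ≤ N θ)
    (hzp : IsFoot u ν h 1 x zp) (hzm : IsFoot u ν h (-1) x zm) (hz0 : IsFoot u ν h 0 x z0) :
    |D 0 0 x (t + h) - h / 2 * reactPart ν u D x (t + h)
        - (1 / 6 * (D 0 0 zp t + h / 2 * reactPart ν u D zp t)
          + 1 / 6 * (D 0 0 zm t + h / 2 * reactPart ν u D zm t)
          + 2 / 3 * (D 0 0 z0 t + h / 2 * reactPart ν u D z0 t))|
      ≤ truncConst U ν * (h ^ 3 * N t + h ^ 3 * N (t + h) + h ^ 2 * ∫ θ in t..t + h, N θ) := by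
  have hU : 0 ≤ U := (abs_nonneg _).trans (hub 0)
  set s := Real.sqrt (6 * h * ν) with hs
  have hs2 : s ^ 2 = 6 * h * ν := Real.sq_sqrt (by positivity)
  -- The common base point: adding `h u(z) / 2` to the feet gives `y + s`, `y - s` and `y`.
  set y := x - h / 2 * u x with hy
  have hdisp : ∀ e ux uz z : ℝ, |e| ≤ 1 → |ux| ≤ U → |uz| ≤ U →
      z = x - h / 2 * (ux + uz) + e * s →
      (z - x) ^ 2 ≤ h * (2 * U ^ 2 + 12 * ν) ∧ |z - x| ≤ 1 ∧ z ∈ Set.Icc (x - 1) (x + 1) := by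
    intro e ux uz z he h1 h2 hz
    have h3 := abs_le_of_displacement hU hν hh hh1 h1 h2 he hz
    have h4 : |z - x| ≤ 1 := by rw [← sq_le_one_iff_abs_le_one]; linarith
    refine ⟨h3, h4, ?_⟩
    rw [abs_le] at h4
    constructor <;> linarith
  have ha1 : |(1 : ℝ)| ≤ 1 := by norm_num
  have ham : |(-1 : ℝ)| ≤ 1 := by norm_num
  have ha0 : |(0 : ℝ)| ≤ 1 := by norm_num
  have hU0 : |(0 : ℝ)| ≤ U := by simpa using hU
  obtain ⟨sp, dp, mp⟩ := hdisp 1 _ _ zp ha1 (hub x) (hub zp) hzp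
  obtain ⟨sm, dm, mm⟩ := hdisp (-1) _ _ zm ham (hub x) (hub zm) hzm
  obtain ⟨s0, d0, m0⟩ := hdisp 0 _ _ z0 ha0 (hub x) (hub z0) hz0
  obtain ⟨-, -, my⟩ := hdisp 0 (u x) 0 y ha0 (hub x) hU0 (by rw [hy]; ring)
  obtain ⟨-, -, myp⟩ := hdisp 1 (u x) 0 (y + s) ha1 (hub x) hU0 (by rw [hy]; ring)
  obtain ⟨-, -, mym⟩ := hdisp (-1) (u x) 0 (y - s) ham (hub x) hU0 (by rw [hy]; ring)
  have mx : x ∈ Set.Icc (x - 1) (x + 1) := ⟨by linarith, by linarith⟩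
  have htT : t ∈ Set.Icc 0 T := ⟨ht, by linarith⟩
  have htT' : t + h ∈ Set.Icc 0 T := ⟨by linarith, hT⟩
  have htm : t ∈ Set.Icc t (t + h) := ⟨le_rfl, by linarith⟩
  have htm' : t + h ∈ Set.Icc t (t + h) := ⟨by linarith, le_rfl⟩
  have hNt := hNb t htm
  have hNt' := hNb (t + h) htm'
  have hN0 : 0 ≤ N t := (abs_nonneg _).trans (hNt x mx 0 1 (by norm_num) (by norm_num))
  have hN0' : 0 ≤ N (t + h) := (abs_nonneg _).trans (hNt' x mx 0 1 (by norm_num) (by norm_num))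
  have hg : ∀ b ≤ 4, ∀ y ∈ Set.Icc (x - 1) (x + 1), |heatPart ν D 0 b y t| ≤ (1 + ν) * N t :=
    fun b hb y hy => heatPart_abs_le hν.le (hNt y hy _ _ (by omega) (by omega))
      (hNt y hy _ _ (by omega) (by omega))
  -- shifts
  have ezp : zp + h / 2 * u zp = y + s := by unfold IsFoot at hzp; rw [hy]; linarith
  have ezm : zm + h / 2 * u zm = y - s := by unfold IsFoot at hzm; rw [hy]; linarith
  have ez0 : z0 + h / 2 * u z0 = y := by unfold IsFoot at hz0; rw [hy]; linarith
  have ex : x + (-(h / 2)) * u x = y := by rw [hy]; ring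
  have r1 := reactPart_shift (u₁ := u₁) (u₂ := u₂) hD hν.le hub htT' hNt' mx (σ := -(h / 2))
    (by rw [ex]; exact my)
  have rp := reactPart_shift (u₁ := u₁) (u₂ := u₂) hD hν.le hub htT hNt mp (σ := h / 2)
    (by rw [ezp]; exact myp)
  have rm := reactPart_shift (u₁ := u₁) (u₂ := u₂) hD hν.le hub htT hNt mm (σ := h / 2)
    (by rw [ezm]; exact mym)
  have r0 := reactPart_shift (u₁ := u₁) (u₂ := u₂) hD hν.le hub htT hNt m0 (σ := h / 2)
    (by rw [ez0]; exact my)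
  rw [ex, abs_neg] at r1
  rw [ezp] at rp
  rw [ezm] at rm
  rw [ez0] at r0
  rw [abs_of_pos (by positivity : 0 < h / 2)] at r1 rp rm r0
  -- averages over the increments
  have q1 := average_expand_six (φ := fun k y => D 0 k y t) (a := x) (r := 1)
    (fun k hk y _ => hD.dx 0 k (by omega) y t htT)
    (fun y hy => hNt y hy 0 6 (by norm_num) (by norm_num)) my myp mym
  have q2 := average_expand_four (φ := fun k y => heatPart ν D 0 k y t) (a := x) (r := 1)
    (fun k hk y _ => heatPart_dx hD (by omega) y htT) (hg 4 le_rfl) my myp mym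
  rw [show s ^ 6 = (s ^ 2) ^ 3 by ring, show s ^ 4 = (s ^ 2) ^ 2 by ring, hs2] at q1
  rw [show s ^ 4 = (s ^ 2) ^ 2 by ring, hs2] at q2
  -- time increments
  obtain ⟨p1, p2, -⟩ := hD.time_expand (u₁ := u₁) (u₂ := u₂) hν.le hub hh ht hT hN my hNb
  obtain ⟨-, -, k1⟩ := hD.time_expand (u₁ := u₁) (u₂ := u₂) hν.le hub hh ht hT hN mx hNb
  set J := ∫ θ in t..t + h, N θ with hJ
  have hJ0 : 0 ≤ J := intervalIntegral.integral_nonneg (by linarith) fun θ hθ =>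
    (abs_nonneg _).trans (hNb θ hθ y my 0 1 (by norm_num) (by norm_num))
  -- the correction
  have k2 := average_expand_two (H := corrPart ν u u₁ u₂ D t) (x := x) (r := 1) (dp := zp - x)
    (dm := zm - x) (d0 := z0 - x) (K₁ := (3 * U ^ 2 + 2 * U * (1 + ν)) * N t)
    (K₂ := (5 * U ^ 2 + 4 * U * (1 + ν)) * N t) (m₁ := h * U)
    (m₂ := h * (2 * U ^ 2 + 12 * ν)) zero_le_one
    (fun k hk y _ => corrPart_dx hD hu hu₁ htT hk y) ?_ ?_ dp dm d0 ?_ sp sm s0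
  rotate_left
  · exact corrPart_one_abs_le (hub x) (hub₁ x) (hNt x mx 0 2 (by norm_num) (by norm_num))
      (hNt x mx 0 3 (by norm_num) (by norm_num)) (hg 1 (by norm_num) x mx)
      (hg 2 (by norm_num) x mx)
  · exact fun y hy => corrPart_two_abs_le (hub y) (hub₁ y) (hub₂ y)
      (hNt y hy 0 2 (by norm_num) (by norm_num)) (hNt y hy 0 3 (by norm_num) (by norm_num))
      (hNt y hy 0 4 (by norm_num) (by norm_num)) (hg 1 (by norm_num) y hy)
      (hg 2 (by norm_num) y hy) (hg 3 (by norm_num) y hy)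
  · have e : 1 / 6 * (zp - x) + 1 / 6 * (zm - x) + 2 / 3 * (z0 - x)
        = h / 2 * -(u x + (1 / 6 * u zp + 1 / 6 * u zm + 2 / 3 * u z0)) := by
      unfold IsFoot at hzp hzm hz0
      linear_combination 1 / 6 * hzp + 1 / 6 * hzm + 2 / 3 * hz0
    have e1 : |u x + (1 / 6 * u zp + 1 / 6 * u zm + 2 / 3 * u z0)| ≤ 2 * U := by
      have b0 := abs_le.1 (hub x)
      have b1 := abs_le.1 (hub zp)
      have b2 := abs_le.1 (hub zm)
      have b3 := abs_le.1 (hub z0)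
      rw [abs_le]; constructor <;> linarith [b0.1, b0.2, b1.1, b1.2, b2.1, b2.2, b3.1, b3.2]
    rw [e, abs_mul, abs_neg, abs_of_pos (by positivity : 0 < h / 2)]
    exact (mul_le_mul_of_nonneg_left e1 (by positivity)).trans_eq (by ring)
  simp only [add_sub_cancel] at k2
  have hh2 : 0 ≤ h / 2 := by positivity
  have g0 : heatPart ν D 0 0 y t = D 1 0 y t - ν * D 0 2 y t := rfl
  have g1 : heatPart ν D 1 0 y t = D 2 0 y t - ν * D 1 2 y t := rfl
  have g2 : heatPart ν D 0 2 y t = D 1 2 y t - ν * D 0 4 y t := rfl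
  rw [g0, g1] at p2
  rw [g0, g2] at q2
  rw [g0] at r0
  obtain ⟨P₁, ep1, p1⟩ : ∃ X, _ = X ∧ |X| ≤ _ := ⟨_, rfl, p1⟩
  obtain ⟨P₂, ep2, p2⟩ : ∃ X, _ = X ∧ |X| ≤ _ := ⟨_, rfl, p2⟩
  obtain ⟨K₁, ek1, k1⟩ : ∃ X, _ = X ∧ |X| ≤ _ := ⟨_, rfl, k1⟩
  obtain ⟨K₂, ek2, k2⟩ : ∃ X, _ = X ∧ |X| ≤ _ := ⟨_, rfl, k2⟩
  obtain ⟨Q₁, eq1, q1⟩ : ∃ X, _ = X ∧ |X| ≤ _ := ⟨_, rfl, q1⟩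
  obtain ⟨Q₂, eq2, q2⟩ : ∃ X, _ = X ∧ |X| ≤ _ := ⟨_, rfl, q2⟩
  obtain ⟨R₁, er1, r1⟩ : ∃ X, _ = X ∧ |X| ≤ _ := ⟨_, rfl, r1⟩
  obtain ⟨Rp, erp, rp⟩ : ∃ X, _ = X ∧ |X| ≤ _ := ⟨_, rfl, rp⟩
  obtain ⟨Rm, erm, rm⟩ : ∃ X, _ = X ∧ |X| ≤ _ := ⟨_, rfl, rm⟩
  obtain ⟨R₀, er0, r0⟩ : ∃ X, _ = X ∧ |X| ≤ _ := ⟨_, rfl, r0⟩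
  -- With `c_t` and `c_xx` at time `t`, both sides reduce to `c + h (c_t + ν c_xx) / 2 + h² ν c_txx
  -- / 2` at `y`, minus `h² / 4` times the correction at `x`. The terms in `c_tt` cancel on one
  -- side, those in `ν² c_xxxx` on the other; only remainders survive.
  have eτ : D 0 0 x (t + h) - h / 2 * reactPart ν u D x (t + h)
        - (1 / 6 * (D 0 0 zp t + h / 2 * reactPart ν u D zp t)
          + 1 / 6 * (D 0 0 zm t + h / 2 * reactPart ν u D zm t)
          + 2 / 3 * (D 0 0 z0 t + h / 2 * reactPart ν u D z0 t))
      = P₁ - h / 2 * P₂ - (h / 2) ^ 2 * K₁ + R₁ - Q₁ - h / 2 * Q₂ + (h / 2) ^ 2 * K₂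
        - (1 / 6 * Rp + 1 / 6 * Rm + 2 / 3 * R₀) := by
    linear_combination ep1 - h / 2 * ep2 - (h / 2) ^ 2 * ek1 + er1 - eq1 - h / 2 * eq2
      + (h / 2) ^ 2 * ek2 - (1 / 6 * erp + 1 / 6 * erm + 2 / 3 * er0)
  rw [eτ]
  clear eτ ep1 ep2 ek1 er1 eq1 eq2 ek2 erp erm er0
  obtain ⟨p2l, p2u⟩ := abs_le_const_mul hh2 p2
  obtain ⟨q2l, q2u⟩ := abs_le_const_mul hh2 q2
  obtain ⟨k1l, k1u⟩ := abs_le_const_mul (sq_nonneg (h / 2)) k1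
  obtain ⟨k2l, k2u⟩ := abs_le_const_mul (sq_nonneg (h / 2)) k2
  rw [abs_le] at p1 q1 r1 rp rm r0
  have hX : 0 ≤ h ^ 3 * N t := by positivity
  have hY : 0 ≤ h ^ 3 * N (t + h) := by positivity
  have hZ : 0 ≤ h ^ 2 * J := by positivity
  refine le_trans (b := (h / 2) ^ 3 * ((U ^ 3 + U ^ 2 * (1 + ν)) * N (t + h))
    + (h / 2) ^ 3 * ((U ^ 3 + U ^ 2 * (1 + ν)) * N t) + J * h ^ 2
    + h / 2 * ((1 + ν) * J * h) + (h / 2) ^ 2 * ((U ^ 2 + U * (1 + ν)) * J)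
    + (6 * h * ν) ^ 3 * N t / 3 + h / 2 * ((6 * h * ν) ^ 2 * ((1 + ν) * N t) / 3)
    + (h / 2) ^ 2 * ((3 * U ^ 2 + 2 * U * (1 + ν)) * N t * (h * U)
      + (5 * U ^ 2 + 4 * U * (1 + ν)) * N t * (h * (2 * U ^ 2 + 12 * ν)))) ?_ ?_
  · rw [abs_le]
    constructor
    · linarith only [p1.1, q1.2, r1.1, rp.2, rm.2, r0.2, p2u, q2u, k1u, k2l]
    · linarith only [p1.2, q1.1, r1.2, rp.1, rm.1, r0.1, p2l, q2l, k1l, k2u]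
  · have c1 : 0 ≤ U ^ 3 + U ^ 2 * (1 + ν) := by positivity
    have c2 : 0 ≤ U ^ 2 + U * (1 + ν) := by positivity
    have c3 : 0 ≤ ν ^ 3 := by positivity
    have c4 : 0 ≤ ν ^ 2 * (1 + ν) := by positivity
    have c5 : 0 ≤ (3 * U ^ 2 + 2 * U * (1 + ν)) * U := by positivity
    have c6 : 0 ≤ (5 * U ^ 2 + 4 * U * (1 + ν)) * (2 * U ^ 2 + 12 * ν) := by positivity
    have t1 := mul_le_mul_of_nonneg_right (show (U ^ 3 + U ^ 2 * (1 + ν)) / 8 + 72 * ν ^ 3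
      + 6 * ν ^ 2 * (1 + ν) + ((3 * U ^ 2 + 2 * U * (1 + ν)) * U
      + (5 * U ^ 2 + 4 * U * (1 + ν)) * (2 * U ^ 2 + 12 * ν)) / 4 ≤ truncConst U ν by
        unfold truncConst; linarith only [c1, c2, c3, c4, c5, c6, hν]) hX
    have t2 := mul_le_mul_of_nonneg_right (show (U ^ 3 + U ^ 2 * (1 + ν)) / 8
      ≤ truncConst U ν by unfold truncConst; linarith only [c1, c2, c3, c4, c5, c6, hν]) hY
    have t3 := mul_le_mul_of_nonneg_right (show 1 + (1 + ν) / 2 + (U ^ 2 + U * (1 + ν)) / 4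
      ≤ truncConst U ν by unfold truncConst; linarith only [c1, c2, c3, c4, c5, c6, hν]) hZ
    linarith only [t1, t2, t3]

end Truncation


/-! ### From pointwise bounds to `ℓ²` bounds -/

/-- The one-dimensional Sobolev inequality on an interval of length two: `φ y ^ 2 ≤ 2 φ z ^ 2 + 4 ∫
φ'²` is averaged over `z`. -/
lemma sq_le_integral {φ φ' : ℝ → ℝ} (hd : ∀ x, HasDerivAt φ (φ' x) x) (hc : Continuous φ')
    {x y : ℝ} (hy : y ∈ Set.Icc (x - 1) (x + 1)) :
    φ y ^ 2 ≤ (∫ z in x - 1..x + 1, φ z ^ 2) + 4 * ∫ z in x - 1..x + 1, φ' z ^ 2 := by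
  set I := ∫ z in x - 1..x + 1, φ' z ^ 2 with hI
  have hφ : Continuous φ := continuous_iff_continuousAt.2 fun x => (hd x).continuousAt
  have hx : x - 1 ≤ x + 1 := by linarith
  have hI0 : 0 ≤ I := intervalIntegral.integral_nonneg hx fun _ _ => sq_nonneg _
  have hab : ∀ a b, a ≤ b → x - 1 ≤ a → b ≤ x + 1 → (φ b - φ a) ^ 2 ≤ 2 * I := by
    intro a b h ha hb
    rw [← intervalIntegral.integral_eq_sub_of_hasDerivAt (fun x _ => hd x)
      (hc.intervalIntegrable _ _)]
    refine (sq_intervalIntegral_le hc h).trans (mul_le_mul (by linarith) ?_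
      (intervalIntegral.integral_nonneg h fun _ _ => sq_nonneg _) (by norm_num))
    exact intervalIntegral.integral_mono_interval ha h hb (.of_forall fun _ => sq_nonneg _)
      (Continuous.intervalIntegrable (by fun_prop) _ _)
  have hpt : ∀ z ∈ Set.Icc (x - 1) (x + 1), φ y ^ 2 ≤ 2 * φ z ^ 2 + 4 * I := by
    intro z hz
    have h1 : (φ y - φ z) ^ 2 ≤ 2 * I := by
      rcases le_total z y with h | h
      · exact hab z y h hz.1 hy.2
      · rw [← neg_sub, neg_sq]; exact hab y z h hy.1 hz.2
    nlinarith [sq_nonneg (φ y - 2 * φ z)]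
  have := intervalIntegral.integral_mono_on (μ := volume) hx (f := fun _ => φ y ^ 2)
    (g := fun z => 2 * φ z ^ 2 + 4 * I) (Continuous.intervalIntegrable (by fun_prop) _ _)
    (Continuous.intervalIntegrable (by fun_prop) _ _) hpt
  rw [intervalIntegral.integral_const, intervalIntegral.integral_add
    (Continuous.intervalIntegrable (by fun_prop) _ _)
    (Continuous.intervalIntegrable (by fun_prop) _ _), intervalIntegral.integral_const,
    intervalIntegral.integral_const_mul] at this
  simp only [smul_eq_mul] at this
  linarith

/-- The orders of the derivatives, of parabolic order between `1` and `7`. -/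
def jetOrders : Finset (ℕ × ℕ) :=
  (Finset.range 4 ×ˢ Finset.range 8).filter fun q => 1 ≤ 2 * q.1 + q.2 ∧ 2 * q.1 + q.2 ≤ 7

lemma mem_jetOrders {a b : ℕ} : (a, b) ∈ jetOrders ↔ 1 ≤ 2 * a + b ∧ 2 * a + b ≤ 7 := by
  simp only [jetOrders, Finset.mem_filter, Finset.mem_product, Finset.mem_range]
  omega

/-- The energy density `∑ (∂_t^a ∂_x^b c)²`, with time clamped to `[0, T]`. -/
def jetDensity (T : ℝ) (D : ℕ → ℕ → ℝ → ℝ → ℝ) (θ x : ℝ) : ℝ :=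
  ∑ q ∈ jetOrders, D q.1 q.2 x (max 0 (min T θ)) ^ 2

/-- A local bound for the derivatives of parabolic order between `1` and `6` near `x`. -/
def jetBound (T : ℝ) (D : ℕ → ℕ → ℝ → ℝ → ℝ) (x θ : ℝ) : ℝ :=
  Real.sqrt (5 * ∫ y in x - 1..x + 1, jetDensity T D θ y)

section

variable {T : ℝ} {D : ℕ → ℕ → ℝ → ℝ → ℝ}

lemma clamp_mem (hT : 0 ≤ T) (θ : ℝ) : max 0 (min T θ) ∈ Set.Icc 0 T :=
  ⟨le_max_left _ _, max_le hT (min_le_left _ _)⟩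

lemma clamp_eq {θ : ℝ} (hθ : θ ∈ Set.Icc 0 T) : max 0 (min T θ) = θ := by
  rw [min_eq_right hθ.2, max_eq_right hθ.1]

lemma jetDensity_nonneg (θ x : ℝ) : 0 ≤ jetDensity T D θ x :=
  Finset.sum_nonneg fun _ _ => sq_nonneg _

lemma continuous_jetDensity (hT : 0 ≤ T) (hD : IsParabolicJet T D) :
    Continuous fun q : ℝ × ℝ => jetDensity T D q.1 q.2 := by
  refine continuous_finsetSum _ fun q hq => Continuous.pow ?_ 2
  have := (mem_jetOrders.1 hq).2
  exact (hD.cont q.1 q.2 this).comp_continuous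
    (f := fun r : ℝ × ℝ => (r.2, max 0 (min T r.1))) (by fun_prop)
    fun r => ⟨Set.mem_univ _, clamp_mem hT _⟩

lemma continuous_jetDensity_space (hT : 0 ≤ T) (hD : IsParabolicJet T D) (θ : ℝ) :
    Continuous (jetDensity T D θ) :=
  (continuous_jetDensity hT hD).comp (by fun_prop : Continuous fun x : ℝ => (θ, x))

/-- Clamping the time in `jetDensity` gives continuity on the whole line, as `truncation_le`
requires of its bound `N`. -/
lemma continuous_jetBound (hT : 0 ≤ T) (hD : IsParabolicJet T D) (x : ℝ) :
    Continuous (jetBound T D x) := by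
  refine Real.continuous_sqrt.comp (continuous_const.mul ?_)
  exact intervalIntegral.continuous_parametric_intervalIntegral_of_continuous'
    (continuous_jetDensity hT hD) _ _

lemma jetBound_sq (x θ : ℝ) :
    jetBound T D x θ ^ 2 = 5 * ∫ y in x - 1..x + 1, jetDensity T D θ y :=
  Real.sq_sqrt (mul_nonneg (by norm_num) (intervalIntegral.integral_nonneg (by linarith)
    fun _ _ => jetDensity_nonneg _ _))

lemma abs_le_jetBound (hT : 0 ≤ T) (hD : IsParabolicJet T D) {x y θ : ℝ} {a b : ℕ}
    (hθ : θ ∈ Set.Icc 0 T) (hy : y ∈ Set.Icc (x - 1) (x + 1)) (h1 : 1 ≤ 2 * a + b)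
    (h6 : 2 * a + b ≤ 6) : |D a b y θ| ≤ jetBound T D x θ := by
  refine Real.abs_le_sqrt ?_
  have hle : ∀ a b, 1 ≤ 2 * a + b → 2 * a + b ≤ 7 → ∫ z in x - 1..x + 1, D a b z θ ^ 2
      ≤ ∫ z in x - 1..x + 1, jetDensity T D θ z := by
    intro a b h1 h7
    refine intervalIntegral.integral_mono_on (by linarith)
      ((hD.continuous_space h7 hθ).pow 2 |>.intervalIntegrable _ _)
      ((continuous_jetDensity_space hT hD θ).intervalIntegrable _ _) fun z _ => ?_
    unfold jetDensity
    rw [clamp_eq hθ]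
    exact Finset.single_le_sum (f := fun q : ℕ × ℕ => D q.1 q.2 z θ ^ 2)
      (fun _ _ => sq_nonneg _) (mem_jetOrders.2 ⟨h1, h7⟩)
  -- Both integrals are dominated by that of the density, which explains the factor `5 = 1 + 4` in
  -- `jetBound`. One order is lost, from seven to six.
  have := sq_le_integral (fun z => hD.dx a b h6 z θ hθ) (hD.continuous_space (by omega) hθ) hy
  linarith [hle a b h1 (by omega), hle a (b + 1) (by omega) (by omega)]

/-- The sum of the local bounds over a grid. -/
lemma sum_jetBound_sq_le (hT : 0 ≤ T) {M : ℝ}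
    (hM : ∀ a b, 1 ≤ 2 * a + b → 2 * a + b ≤ 7 → ∀ t ∈ Set.Icc 0 T,
      Integrable (fun x => D a b x t ^ 2) ∧ ∫ x, D a b x t ^ 2 ≤ M)
    {Δx : ℝ} (hx : 0 < Δx) (hx1 : Δx ≤ 1) (S : Finset ℤ) (θ : ℝ) :
    Δx * ∑ i ∈ S, jetBound T D (i * Δx) θ ^ 2 ≤ 15 * (jetOrders.card * M) := by
  have hint : ∀ q ∈ jetOrders, Integrable (fun x => D q.1 q.2 x (max 0 (min T θ)) ^ 2) :=
    fun q hq => (hM _ _ (mem_jetOrders.1 hq).1 (mem_jetOrders.1 hq).2 _ (clamp_mem hT θ)).1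
  have hi : Integrable (jetDensity T D θ) := integrable_finsetSum _ hint
  have htot : ∫ x, jetDensity T D θ x ≤ jetOrders.card * M := by
    unfold jetDensity
    rw [integral_finsetSum _ hint]
    refine (Finset.sum_le_card_nsmul _ _ M fun q hq =>
      (hM _ _ (mem_jetOrders.1 hq).1 (mem_jetOrders.1 hq).2 _ (clamp_mem hT θ)).2).trans ?_
    rw [nsmul_eq_mul]
  have htot0 : 0 ≤ ∫ x, jetDensity T D θ x := integral_nonneg (jetDensity_nonneg θ)
  -- Each window has length two and is covered by `⌈2 / Δx⌉` grid cells, of total length at most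
  -- three.
  have hm : 2 ≤ ⌈2 / Δx⌉₊ * Δx := (div_le_iff₀ hx).1 (Nat.le_ceil _)
  have hm' : ⌈2 / Δx⌉₊ * Δx ≤ 3 := by
    have := (Nat.ceil_lt_add_one (by positivity : 0 ≤ 2 / Δx)).le
    calc _ ≤ (2 / Δx + 1) * Δx := by gcongr
      _ = 2 + Δx := by field_simp
      _ ≤ 3 := by linarith
  have h1 := sum_intervalIntegral_le (jetDensity_nonneg θ) hi hx (z := fun i => i * Δx - 1)
    (fun i k hik => by
      have : (i : ℝ) + 1 ≤ k := by exact_mod_cast hik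
      nlinarith) ⌈2 / Δx⌉₊ S
  simp_rw [jetBound_sq]
  rw [← Finset.mul_sum]
  have h2 : ∑ i ∈ S, ∫ y in (i : ℝ) * Δx - 1..i * Δx + 1, jetDensity T D θ y
      ≤ ⌈2 / Δx⌉₊ * ∫ x, jetDensity T D θ x := by
    refine le_trans (Finset.sum_le_sum fun i _ => ?_) h1
    exact intervalIntegral.integral_mono_interval le_rfl (by linarith) (by linarith)
      (.of_forall fun _ => jetDensity_nonneg _ _) hi.intervalIntegrable
  calc _ ≤ Δx * (5 * (⌈2 / Δx⌉₊ * ∫ x, jetDensity T D θ x)) := by gcongr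
    _ = 5 * (⌈2 / Δx⌉₊ * Δx) * ∫ x, jetDensity T D θ x := by ring
    _ ≤ 5 * 3 * (jetOrders.card * M) := by gcongr
    _ = _ := by ring

/-- Pointwise errors bounded by the local bounds are of third order in `ℓ²`. -/
lemma sum_sq_le_of_jetBound (hT : 0 ≤ T) (hD : IsParabolicJet T D) {M : ℝ}
    (hM : ∀ a b, 1 ≤ 2 * a + b → 2 * a + b ≤ 7 → ∀ t ∈ Set.Icc 0 T,
      Integrable (fun x => D a b x t ^ 2) ∧ ∫ x, D a b x t ^ 2 ≤ M)
    {K h t Δx : ℝ} (hh : 0 < h) (hx : 0 < Δx) (hx1 : Δx ≤ 1) {τ : ℤ → ℝ}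
    (hτ : ∀ i : ℤ, |τ i| ≤ K * (h ^ 3 * jetBound T D (i * Δx) t
      + h ^ 3 * jetBound T D (i * Δx) (t + h)
      + h ^ 2 * ∫ θ in t..t + h, jetBound T D (i * Δx) θ)) (S : Finset ℤ) :
    Δx * ∑ i ∈ S, τ i ^ 2 ≤ 9 * K ^ 2 * (15 * (jetOrders.card * M)) * h ^ 6 := by
  set A := 15 * (jetOrders.card * M) with hA
  have hc := fun i : ℤ => continuous_jetBound hT hD (i * Δx)
  -- Cauchy–Schwarz in time trades the square of the integral for `h` times the integral of the
  -- square, so all three terms are of order `h⁶` after summation.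
  have hpt : ∀ i, τ i ^ 2 ≤ 3 * K ^ 2 * (h ^ 6 * jetBound T D (i * Δx) t ^ 2
      + h ^ 6 * jetBound T D (i * Δx) (t + h) ^ 2
      + h ^ 5 * ∫ θ in t..t + h, jetBound T D (i * Δx) θ ^ 2) := by
    intro i
    have h1 := sq_intervalIntegral_le (hc i) (a := t) (b := t + h) (by linarith)
    rw [add_sub_cancel_left] at h1
    set X := jetBound T D (i * Δx) t
    set Y := jetBound T D (i * Δx) (t + h)
    set Z := ∫ θ in t..t + h, jetBound T D (i * Δx) θ
    set Q := ∫ θ in t..t + h, jetBound T D (i * Δx) θ ^ 2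
    have h2 : τ i ^ 2 ≤ (K * (h ^ 3 * X + h ^ 3 * Y + h ^ 2 * Z)) ^ 2 := by
      rw [← sq_abs]; exact pow_le_pow_left₀ (abs_nonneg _) (hτ i) 2
    have h3 : (h ^ 3 * X + h ^ 3 * Y + h ^ 2 * Z) ^ 2
        ≤ 3 * ((h ^ 3 * X) ^ 2 + (h ^ 3 * Y) ^ 2 + (h ^ 2 * Z) ^ 2) := by
      nlinarith [sq_nonneg (h ^ 3 * X - h ^ 3 * Y), sq_nonneg (h ^ 3 * X - h ^ 2 * Z),
        sq_nonneg (h ^ 3 * Y - h ^ 2 * Z)]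
    have h4 : h ^ 4 * Z ^ 2 ≤ h ^ 4 * (h * Q) := by gcongr
    calc _ ≤ _ := h2
      _ = K ^ 2 * (h ^ 3 * X + h ^ 3 * Y + h ^ 2 * Z) ^ 2 := by ring
      _ ≤ K ^ 2 * (3 * ((h ^ 3 * X) ^ 2 + (h ^ 3 * Y) ^ 2 + (h ^ 2 * Z) ^ 2)) := by gcongr
      _ = 3 * K ^ 2 * (h ^ 6 * X ^ 2 + h ^ 6 * Y ^ 2 + h ^ 4 * Z ^ 2) := by ring
      _ ≤ 3 * K ^ 2 * (h ^ 6 * X ^ 2 + h ^ 6 * Y ^ 2 + h ^ 4 * (h * Q)) := by gcongr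
      _ = _ := by ring
  have hint : Δx * ∑ i ∈ S, ∫ θ in t..t + h, jetBound T D (i * Δx) θ ^ 2 ≤ h * A := by
    rw [← intervalIntegral.integral_finsetSum (f := fun (i : ℤ) θ => jetBound T D (i * Δx) θ ^ 2)
        fun i _ => ((hc i).pow 2).intervalIntegrable _ _,
      ← intervalIntegral.integral_const_mul]
    calc _ ≤ ∫ θ in t..t + h, A := by
          refine intervalIntegral.integral_mono_on (by linarith)
            (Continuous.intervalIntegrable ?_ _ _) (by simp)
            fun θ _ => sum_jetBound_sq_le hT hM hx hx1 S θ
          exact continuous_const.mul (continuous_finsetSum _ fun i _ => (hc i).pow 2)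
      _ = _ := by simp
  calc _ ≤ Δx * ∑ i ∈ S, 3 * K ^ 2 * (h ^ 6 * jetBound T D (i * Δx) t ^ 2
      + h ^ 6 * jetBound T D (i * Δx) (t + h) ^ 2
      + h ^ 5 * ∫ θ in t..t + h, jetBound T D (i * Δx) θ ^ 2) := by
        gcongr with i; exact hpt i
    _ = 3 * K ^ 2 * (h ^ 6 * (Δx * ∑ i ∈ S, jetBound T D (i * Δx) t ^ 2)
      + h ^ 6 * (Δx * ∑ i ∈ S, jetBound T D (i * Δx) (t + h) ^ 2)
      + h ^ 5 * (Δx * ∑ i ∈ S, ∫ θ in t..t + h, jetBound T D (i * Δx) θ ^ 2)) := by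
        rw [← Finset.mul_sum, Finset.sum_add_distrib, Finset.sum_add_distrib, ← Finset.mul_sum,
          ← Finset.mul_sum, ← Finset.mul_sum]
        ring
    _ ≤ 3 * K ^ 2 * (h ^ 6 * A + h ^ 6 * A + h ^ 5 * (h * A)) := by
        have a1 := sum_jetBound_sq_le hT hM hx hx1 S t
        have a2 := sum_jetBound_sq_le hT hM hx hx1 S (t + h)
        gcongr
    _ = _ := by ring

end


/-! ### Feet of characteristics and solvability of the scheme -/

/-- A contraction argument that serves both implicit equations of the scheme: the feet and the
reaction term. -/
lemma existsUnique_fixed {φ : ℝ → ℝ} {L k : ℝ} (hφ : ∀ x y, |φ x - φ y| ≤ L * |x - y|)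
    (hk : |k| * L ≤ 1 / 2) (a : ℝ) : ∃! z, z = a + k * φ z := by
  have hlip : ∀ x y, |k * φ x - k * φ y| ≤ 1 / 2 * |x - y| := by
    intro x y
    rw [← mul_sub, abs_mul]
    calc _ ≤ |k| * (L * |x - y|) := by gcongr; exact hφ x y
      _ = |k| * L * |x - y| := by ring
      _ ≤ _ := by gcongr
  have hc : ContractingWith (1 / 2) fun z => a + k * φ z := by
    refine ⟨by norm_num, LipschitzWith.of_dist_le_mul fun x y => ?_⟩
    rw [Real.dist_eq, Real.dist_eq, add_sub_add_left_eq_sub]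
    simpa using hlip x y
  refine ⟨hc.fixedPoint, hc.fixedPoint_isFixedPt.symm, fun y hy => ?_⟩
  exact hc.fixedPoint_unique (show a + k * φ y = y from hy.symm)

lemma exists_feet {u : ℝ → ℝ} {U ν h : ℝ} (hu : ∀ x y, |u x - u y| ≤ U * |x - y|)
    (hh : 0 ≤ h) (hU : h * U ≤ 1 / 4) :
    ∃ Z : ℝ → ℝ → ℝ, ∀ e x z, IsFoot u ν h e x z ↔ z = Z e x := by
  have h1 : |(-(h / 2))| * U ≤ 1 / 2 := by
    rw [abs_neg, abs_of_nonneg (by positivity)]; linarith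
  choose Z hZ hZu using fun e x : ℝ => existsUnique_fixed hu h1
    (x - h / 2 * u x + e * Real.sqrt (6 * h * ν))
  refine ⟨Z, fun e x z => ⟨fun hz => hZu e x z ?_, fun hz => ?_⟩⟩
  · unfold IsFoot at hz
    simp only
    linarith
  · have := hZ e x
    simp only at this
    unfold IsFoot
    rw [hz]
    linarith

/-- The map from grid points to feet, for a fixed increment, is a translation up to a relative error
`O(h U)`. This is the near-equidistance that `IsKernel.stability` needs. -/
lemma foot_displacement {u : ℝ → ℝ} {U ν h e x x' z z' : ℝ}
    (hu : ∀ x y, |u x - u y| ≤ U * |x - y|) (hh : 0 ≤ h) (hU : h * U ≤ 1 / 4)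
    (hz : IsFoot u ν h e x z) (hz' : IsFoot u ν h e x' z') :
    |z - z' - (x - x')| ≤ 2 * (h * U) * |x - x'| := by
  unfold IsFoot at hz hz'
  set d := z - z' - (x - x') with hd
  have e1 : d = -(h / 2 * (u x - u x')) - h / 2 * (u z - u z') := by rw [hd]; linarith
  have h1 : |d| ≤ h / 2 * (U * |x - x'|) + h / 2 * (U * |z - z'|) := by
    rw [e1]
    refine (abs_sub _ _).trans ?_
    rw [abs_neg, abs_mul, abs_mul, abs_of_nonneg (by positivity : 0 ≤ h / 2)]
    gcongr
    · exact hu _ _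
    · exact hu _ _
  have h2 : |z - z'| ≤ |x - x'| + |d| := by
    have := abs_add_le (x - x') d
    rwa [hd, add_sub_cancel] at this
  by_cases hU0 : 0 ≤ U
  · have h3 : h / 2 * (U * |z - z'|) ≤ h / 2 * (U * (|x - x'| + |d|)) := by gcongr
    have h4 : h * U * |d| ≤ 1 / 4 * |d| := by gcongr
    nlinarith [abs_nonneg d, mul_nonneg (mul_nonneg hh hU0) (abs_nonneg (x - x'))]
  -- A negative Lipschitz constant forces any two points to coincide.
  · have hxx : x = x' := by
      by_contra hne
      have h3 := (abs_nonneg _).trans (hu x x')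
      have h4 : 0 < |x - x'| := abs_pos.2 (sub_ne_zero.2 hne)
      nlinarith
    have hzz : z = z' := by
      by_contra hne
      have h3 := (abs_nonneg _).trans (hu z z')
      have h4 : 0 < |z - z'| := abs_pos.2 (sub_ne_zero.2 hne)
      nlinarith
    simp [hd, hxx, hzz]

/-- The explicit part of a step, in terms of the interpolant `s` and the feet `Z`. -/
def stepRhs (f : ℝ → ℝ) (h Δx : ℝ) (Z : ℝ → ℝ → ℝ) (s : ℝ → ℝ) (i : ℤ) : ℝ :=
  1 / 6 * (s (Z 1 (i * Δx)) + h / 2 * f (s (Z 1 (i * Δx))))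
    + 1 / 6 * (s (Z (-1) (i * Δx)) + h / 2 * f (s (Z (-1) (i * Δx))))
    + 2 / 3 * (s (Z 0 (i * Δx)) + h / 2 * f (s (Z 0 (i * Δx))))

section Scheme

variable {κ : InterpKind} {p : ℕ} {u f : ℝ → ℝ} {ν h Δx : ℝ} {ψ : ℝ → ℝ} {Z : ℝ → ℝ → ℝ}

lemma isStep_iff (hψ : ∀ Δx > 0, ∀ v, (∃ C, ∀ j, |v j| ≤ C) → ∀ s, IsInterpolant κ p Δx v s ↔
      ∀ x, s x = kernelInterp ψ Δx v x)
    (hZ : ∀ e x z, IsFoot u ν h e x z ↔ z = Z e x) (hx : 0 < Δx) {v w : ℤ → ℝ}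
    (hv : ∃ C, ∀ j, |v j| ≤ C) : IsStep κ p u f ν h Δx v w ↔
      ∀ i, w i = stepRhs f h Δx Z (kernelInterp ψ Δx v) i + h / 2 * f (w i) := by
  constructor
  · rintro ⟨s, hs, hstep⟩ i
    obtain rfl : s = kernelInterp ψ Δx v := funext ((hψ Δx hx v hv s).1 hs)
    obtain ⟨zp, zm, z0, h1, h2, h3, h4⟩ := hstep i
    rw [(hZ _ _ _).1 h1, (hZ _ _ _).1 h2, (hZ _ _ _).1 h3] at h4
    exact h4
  · intro hw
    exact ⟨kernelInterp ψ Δx v, (hψ Δx hx v hv _).2 fun _ => rfl, fun i =>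
      ⟨_, _, _, (hZ _ _ _).2 rfl, (hZ _ _ _).2 rfl, (hZ _ _ _).2 rfl, hw i⟩⟩

lemma abs_stepRhs_le {s : ℝ → ℝ} {C F : ℝ} (hh : 0 ≤ h) (hs : ∀ x, |s x| ≤ C)
    (hf : ∀ x, |f x| ≤ F) (i : ℤ) : |stepRhs f h Δx Z s i| ≤ C + h / 2 * F := by
  have key : ∀ x, |s x + h / 2 * f (s x)| ≤ C + h / 2 * F := by
    intro x
    refine (abs_add_le _ _).trans (add_le_add (hs x) ?_)
    rw [abs_mul, abs_of_nonneg (by positivity)]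
    exact mul_le_mul_of_nonneg_left (hf _) (by positivity)
  have a1 := abs_le.1 (key (Z 1 (i * Δx)))
  have a2 := abs_le.1 (key (Z (-1) (i * Δx)))
  have a3 := abs_le.1 (key (Z 0 (i * Δx)))
  unfold stepRhs
  rw [abs_le]
  constructor <;> linarith [a1.1, a1.2, a2.1, a2.2, a3.1, a3.2]

/-- A solution of the scheme consists of bounded grid functions. -/
lemma IsSchemeSolution.bounded (hker : IsKernel p ψ)
    (hψ : ∀ Δx > 0, ∀ v, (∃ C, ∀ j, |v j| ≤ C) → ∀ s, IsInterpolant κ p Δx v s ↔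
      ∀ x, s x = kernelInterp ψ Δx v x)
    (hZ : ∀ e x z, IsFoot u ν h e x z ↔ z = Z e x) (hx : 0 < Δx) (hh : 0 ≤ h) {F : ℝ}
    (hf : ∀ x, |f x| ≤ F) {c₀ : ℝ → ℝ} (hc₀ : ∃ C, ∀ x, |c₀ x| ≤ C) {W : ℕ → ℤ → ℝ}
    (hW : IsSchemeSolution κ p u f c₀ ν h Δx W) (n : ℕ) : ∃ C, ∀ j, |W n j| ≤ C := by
  induction n with
  | zero =>
    obtain ⟨C, hC⟩ := hc₀
    exact ⟨C, fun j => by rw [hW.1]; exact hC _⟩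
  | succ n ih =>
    obtain ⟨K, _, hK⟩ := hker.abs_interp_le
    obtain ⟨C, hC⟩ := ih
    have := (isStep_iff hψ hZ hx ⟨C, hC⟩).1 (hW.2 n)
    refine ⟨K * C + h / 2 * F + h / 2 * F, fun j => ?_⟩
    rw [this j]
    refine (abs_add_le _ _).trans (add_le_add (abs_stepRhs_le hh (hK Δx _ C hC) hf j) ?_)
    rw [abs_mul, abs_of_nonneg (by positivity)]
    exact mul_le_mul_of_nonneg_left (hf _) (by positivity)

theorem existsUnique_schemeSolution (hker : IsKernel p ψ)
    (hψ : ∀ Δx > 0, ∀ v, (∃ C, ∀ j, |v j| ≤ C) → ∀ s, IsInterpolant κ p Δx v s ↔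
      ∀ x, s x = kernelInterp ψ Δx v x)
    (hZ : ∀ e x z, IsFoot u ν h e x z ↔ z = Z e x) (hx : 0 < Δx) (hh : 0 ≤ h) {F L : ℝ}
    (hf : ∀ x, |f x| ≤ F) (hL : ∀ x y, |f x - f y| ≤ L * |x - y|) (hhL : h * L ≤ 1)
    {c₀ : ℝ → ℝ} (hc₀ : ∃ C, ∀ x, |c₀ x| ≤ C) :
    ∃! W : ℕ → ℤ → ℝ, IsSchemeSolution κ p u f c₀ ν h Δx W := by
  have hk : |h / 2| * L ≤ 1 / 2 := by rw [abs_of_nonneg (by positivity)]; linarith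
  choose w hw hwu using existsUnique_fixed hL hk
  let W : ℕ → ℤ → ℝ := fun n => Nat.rec (fun i => c₀ (i * Δx))
    (fun _ v i => w (stepRhs f h Δx Z (kernelInterp ψ Δx v) i)) n
  have hWs : ∀ n i, W (n + 1) i = w (stepRhs f h Δx Z (kernelInterp ψ Δx (W n)) i) :=
    fun _ _ => rfl
  have hWb : ∀ n, ∃ C, ∀ j, |W n j| ≤ C := by
    intro n
    induction n with
    | zero =>
      obtain ⟨C, hC⟩ := hc₀
      exact ⟨C, fun j => hC _⟩
    | succ n ih =>
      obtain ⟨K, _, hK⟩ := hker.abs_interp_le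
      obtain ⟨C, hC⟩ := ih
      refine ⟨K * C + h / 2 * F + h / 2 * F, fun j => ?_⟩
      rw [hWs, hw]
      refine (abs_add_le _ _).trans (add_le_add (abs_stepRhs_le hh (hK Δx _ C hC) hf j) ?_)
      rw [abs_mul, abs_of_nonneg (by positivity)]
      exact mul_le_mul_of_nonneg_left (hf _) (by positivity)
  refine ⟨W, ⟨fun i => rfl, fun n => (isStep_iff hψ hZ hx (hWb n)).2 fun i => ?_⟩, ?_⟩
  · rw [hWs]; exact hw _
  · intro V hV
    funext n
    induction n with
    | zero => funext i; exact hV.1 i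
    | succ n ih =>
      funext i
      -- The kernel form of the interpolant is available for bounded data only; by induction the
      -- competitor equals `W` at this level and is bounded.
      have := (isStep_iff hψ hZ hx (hWb n)).1 (ih ▸ hV.2 n) i
      rw [hWs]
      exact hwu _ _ this

end Scheme

/-! ### Error propagation over one step and over many -/

/-- The pointwise error after one step. -/
lemma step_error_le {f : ℝ → ℝ} {L h c' w' ap am a0 bp bm b0 τ Jp Jm J0 ρp ρm ρ0 : ℝ}
    (hL0 : 0 ≤ L) (hL : ∀ x y, |f x - f y| ≤ L * |x - y|) (hh : 0 ≤ h) (hhL : h * L ≤ 1)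
    (hτ : c' - h / 2 * f c' - (1 / 6 * (ap + h / 2 * f ap) + 1 / 6 * (am + h / 2 * f am)
      + 2 / 3 * (a0 + h / 2 * f a0)) = τ)
    (hw : w' = 1 / 6 * (bp + h / 2 * f bp) + 1 / 6 * (bm + h / 2 * f bm)
      + 2 / 3 * (b0 + h / 2 * f b0) + h / 2 * f w')
    (hp : ap - bp = ρp + Jp) (hm : am - bm = ρm + Jm) (h0 : a0 - b0 = ρ0 + J0) :
    |c' - w'| ≤ (1 + 2 * h * L) * (1 / 6 * |Jp| + 1 / 6 * |Jm| + 2 / 3 * |J0|)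
      + (3 * (1 / 6 * |ρp| + 1 / 6 * |ρm| + 2 / 3 * |ρ0|) + 2 * |τ|) := by
  set l := h * L / 2 with hl
  have hl0 : 0 ≤ l := by positivity
  have key : ∀ a b, |a - b + h / 2 * (f a - f b)| ≤ (1 + l) * |a - b| := by
    intro a b
    refine (abs_add_le _ _).trans ?_
    rw [abs_mul, abs_of_nonneg (by positivity : 0 ≤ h / 2)]
    have := mul_le_mul_of_nonneg_left (hL a b) (by positivity : 0 ≤ h / 2)
    rw [hl]; linarith
  have e : c' - w' = h / 2 * (f c' - f w') + τ + (1 / 6 * (ap - bp + h / 2 * (f ap - f bp))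
      + 1 / 6 * (am - bm + h / 2 * (f am - f bm)) + 2 / 3 * (a0 - b0 + h / 2 * (f a0 - f b0))) := by
    linear_combination hτ - hw
  have h1 : |h / 2 * (f c' - f w')| ≤ l * |c' - w'| := by
    rw [abs_mul, abs_of_nonneg (by positivity : 0 ≤ h / 2)]
    have := mul_le_mul_of_nonneg_left (hL c' w') (by positivity : 0 ≤ h / 2)
    rw [hl]; linarith
  set A := 1 / 6 * |Jp| + 1 / 6 * |Jm| + 2 / 3 * |J0| with hA
  set R := 1 / 6 * |ρp| + 1 / 6 * |ρm| + 2 / 3 * |ρ0| with hR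
  have hA0 : 0 ≤ A := by positivity
  have hR0 : 0 ≤ R := by positivity
  have split : ∀ {a b ρ J : ℝ}, a - b = ρ + J →
      |a - b + h / 2 * (f a - f b)| ≤ (1 + l) * (|ρ| + |J|) := by
    intro a b ρ J hab
    refine (key a b).trans (mul_le_mul_of_nonneg_left ?_ (by positivity))
    rw [hab]; exact abs_add_le _ _
  have h2 : |1 / 6 * (ap - bp + h / 2 * (f ap - f bp)) + 1 / 6 * (am - bm + h / 2 * (f am - f bm))
      + 2 / 3 * (a0 - b0 + h / 2 * (f a0 - f b0))| ≤ (1 + l) * (R + A) := by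
    have b1 := abs_le.1 (split hp)
    have b2 := abs_le.1 (split hm)
    have b3 := abs_le.1 (split h0)
    rw [hA, hR, abs_le]
    constructor <;> linarith [b1.1, b1.2, b2.1, b2.2, b3.1, b3.2]
  have h3 : |c' - w'| ≤ l * |c' - w'| + |τ| + (1 + l) * (R + A) := by
    conv_lhs => rw [e]
    exact (abs_add_le _ _).trans (add_le_add ((abs_add_le _ _).trans (add_le_add_left h1 _)) h2)
  have hl2 : l ≤ 1 / 2 := by rw [hl]; linarith
  -- The implicit term is absorbed on the left. For `l ≤ 1/2`, division by `1 - l` is harmless since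
  -- `1 + l ≤ (1 - l)(1 + 4 l)`, `1 + l ≤ 3 (1 - l)` and `1 ≤ 2 (1 - l)`; this gives the constants
  -- of the statement.
  have hpos : 0 < 1 - l := by linarith
  refine le_of_mul_le_mul_left ?_ hpos
  have e2 : 2 * h * L = 4 * l := by rw [hl]; ring
  rw [e2]
  have t1 : 0 ≤ l * (1 - 2 * l) * A := by
    have : 0 ≤ 1 - 2 * l := by linarith
    positivity
  have t2 : 0 ≤ (1 - 2 * l) * R := mul_nonneg (by linarith) hR0
  have t3 : 0 ≤ (1 - 2 * l) * |τ| := mul_nonneg (by linarith) (abs_nonneg _)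
  nlinarith


/-- Young's inequality with weight `h`: the old error is multiplied only by `1 + h`, at the price of
`2 / h` in front of the perturbation. -/
lemma sq_le_of_step {h l d A R A₂ R₂ : ℝ} (hh : 0 < h) (hh1 : h ≤ 1)
    (hd : |d| ≤ (1 + l) * A + R) (hl : 0 ≤ l) (hA₂ : A ^ 2 ≤ A₂) (hR₂ : R ^ 2 ≤ R₂) :
    d ^ 2 ≤ (1 + h) * (1 + l) ^ 2 * A₂ + 2 / h * R₂ := by
  set a := (1 + l) * A with ha
  have h1 : d ^ 2 ≤ (a + R) ^ 2 := by
    rw [← sq_abs]; exact pow_le_pow_left₀ (abs_nonneg _) hd 2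
  have h2 : 2 * a * R ≤ h * a ^ 2 + 1 / h * R ^ 2 := by
    have : 0 ≤ 1 / h * (h * a - R) ^ 2 := by positivity
    have e : 1 / h * (h * a - R) ^ 2 = h * a ^ 2 + 1 / h * R ^ 2 - 2 * a * R := by
      field_simp; ring
    linarith
  have h3 : R ^ 2 ≤ 1 / h * R ^ 2 := by
    have : 1 ≤ 1 / h := by rw [le_div_iff₀ hh]; linarith
    nlinarith [sq_nonneg R]
  calc d ^ 2 ≤ (1 + h) * a ^ 2 + 2 / h * R ^ 2 := by
        have : 2 / h * R ^ 2 = 1 / h * R ^ 2 + 1 / h * R ^ 2 := by ring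
        rw [this]; nlinarith
    _ = (1 + h) * (1 + l) ^ 2 * A ^ 2 + 2 / h * R ^ 2 := by rw [ha]; ring
    _ ≤ _ := by gcongr

lemma sq_average_le (a b c : ℝ) : (1 / 6 * |a| + 1 / 6 * |b| + 2 / 3 * |c|) ^ 2
    ≤ 1 / 6 * a ^ 2 + 1 / 6 * b ^ 2 + 2 / 3 * c ^ 2 := by
  rw [← sq_abs a, ← sq_abs b, ← sq_abs c]
  nlinarith [sq_nonneg (|a| - |b|), sq_nonneg (|a| - |c|), sq_nonneg (|b| - |c|)]

lemma step_error_sum {h l g E Rρ Rτ Δx : ℝ} (hh : 0 < h) (hh1 : h ≤ 1) (hl : 0 ≤ l) (hx : 0 < Δx)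
    {d τ Jp Jm J0 ρp ρm ρ0 : ℤ → ℝ}
    (hd : ∀ i, |d i| ≤ (1 + l) * (1 / 6 * |Jp i| + 1 / 6 * |Jm i| + 2 / 3 * |J0 i|)
      + (3 * (1 / 6 * |ρp i| + 1 / 6 * |ρm i| + 2 / 3 * |ρ0 i|) + 2 * |τ i|))
    (hJp : Summable (fun i => Jp i ^ 2) ∧ ∑' i, Jp i ^ 2 ≤ g * E)
    (hJm : Summable (fun i => Jm i ^ 2) ∧ ∑' i, Jm i ^ 2 ≤ g * E)
    (hJ0 : Summable (fun i => J0 i ^ 2) ∧ ∑' i, J0 i ^ 2 ≤ g * E)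
    (hρp : Summable (fun i => ρp i ^ 2) ∧ Δx * ∑' i, ρp i ^ 2 ≤ Rρ)
    (hρm : Summable (fun i => ρm i ^ 2) ∧ Δx * ∑' i, ρm i ^ 2 ≤ Rρ)
    (hρ0 : Summable (fun i => ρ0 i ^ 2) ∧ Δx * ∑' i, ρ0 i ^ 2 ≤ Rρ)
    (hτ : ∀ S : Finset ℤ, Δx * ∑ i ∈ S, τ i ^ 2 ≤ Rτ) :
    Summable (fun i => d i ^ 2) ∧ Δx * ∑' i, d i ^ 2
      ≤ (1 + h) * (1 + l) ^ 2 * g * (Δx * E) + 2 / h * (18 * Rρ + 8 * Rτ) := by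
  have hpt : ∀ i, d i ^ 2 ≤ (1 + h) * (1 + l) ^ 2
        * (1 / 6 * Jp i ^ 2 + 1 / 6 * Jm i ^ 2 + 2 / 3 * J0 i ^ 2)
      + 2 / h * (18 * (1 / 6 * ρp i ^ 2 + 1 / 6 * ρm i ^ 2 + 2 / 3 * ρ0 i ^ 2) + 8 * τ i ^ 2) := by
    intro i
    -- Squaring `3 R + 2 |τ|` yields `18 = 2 · 3²` and `8 = 2 · 2²`.
    refine sq_le_of_step hh hh1 (hd i) hl (sq_average_le _ _ _) ?_
    have := sq_average_le (ρp i) (ρm i) (ρ0 i)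
    rw [← sq_abs (τ i)]
    nlinarith [sq_nonneg (3 * (1 / 6 * |ρp i| + 1 / 6 * |ρm i| + 2 / 3 * |ρ0 i|) - 2 * |τ i|)]
  have hfin : ∀ S : Finset ℤ, Δx * ∑ i ∈ S, d i ^ 2
      ≤ (1 + h) * (1 + l) ^ 2 * g * (Δx * E) + 2 / h * (18 * Rρ + 8 * Rτ) := by
    intro S
    have fj : ∀ {J : ℤ → ℝ}, (Summable (fun i => J i ^ 2) ∧ ∑' i, J i ^ 2 ≤ g * E) →
        Δx * ∑ i ∈ S, J i ^ 2 ≤ g * (Δx * E) := fun {J} hJ => by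
      have := (hJ.1.sum_le_tsum S fun _ _ => sq_nonneg _).trans hJ.2
      calc _ ≤ Δx * (g * E) := by gcongr
        _ = _ := by ring
    have fρ : ∀ {J : ℤ → ℝ}, (Summable (fun i => J i ^ 2) ∧ Δx * ∑' i, J i ^ 2 ≤ Rρ) →
        Δx * ∑ i ∈ S, J i ^ 2 ≤ Rρ := fun {J} hJ => by
      have := hJ.1.sum_le_tsum S fun _ _ => sq_nonneg _
      exact (mul_le_mul_of_nonneg_left this hx.le).trans hJ.2
    calc _ ≤ Δx * ∑ i ∈ S, ((1 + h) * (1 + l) ^ 2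
            * (1 / 6 * Jp i ^ 2 + 1 / 6 * Jm i ^ 2 + 2 / 3 * J0 i ^ 2)
          + 2 / h * (18 * (1 / 6 * ρp i ^ 2 + 1 / 6 * ρm i ^ 2 + 2 / 3 * ρ0 i ^ 2)
            + 8 * τ i ^ 2)) := by
          gcongr with i; exact hpt i
      _ = (1 + h) * (1 + l) ^ 2 * (1 / 6 * (Δx * ∑ i ∈ S, Jp i ^ 2)
            + 1 / 6 * (Δx * ∑ i ∈ S, Jm i ^ 2) + 2 / 3 * (Δx * ∑ i ∈ S, J0 i ^ 2))
          + 2 / h * (18 * (1 / 6 * (Δx * ∑ i ∈ S, ρp i ^ 2)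
            + 1 / 6 * (Δx * ∑ i ∈ S, ρm i ^ 2) + 2 / 3 * (Δx * ∑ i ∈ S, ρ0 i ^ 2))
            + 8 * (Δx * ∑ i ∈ S, τ i ^ 2)) := by
          simp only [Finset.sum_add_distrib, ← Finset.mul_sum]
          ring
      _ ≤ (1 + h) * (1 + l) ^ 2 * (1 / 6 * (g * (Δx * E)) + 1 / 6 * (g * (Δx * E))
            + 2 / 3 * (g * (Δx * E)))
          + 2 / h * (18 * (1 / 6 * Rρ + 1 / 6 * Rρ + 2 / 3 * Rρ) + 8 * Rτ) := by
          have a1 := fj hJp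
          have a2 := fj hJm
          have a3 := fj hJ0
          have a4 := fρ hρp
          have a5 := fρ hρm
          have a6 := fρ hρ0
          have a7 := hτ S
          gcongr
      _ = _ := by ring
  have hfin' : ∀ S : Finset ℤ, ∑ i ∈ S, d i ^ 2
      ≤ ((1 + h) * (1 + l) ^ 2 * g * (Δx * E) + 2 / h * (18 * Rρ + 8 * Rτ)) / Δx := fun S => by
    rw [le_div_iff₀ hx, mul_comm]; exact hfin S
  refine ⟨summable_of_sum_le (fun _ => sq_nonneg _) hfin', ?_⟩
  have := Real.tsum_le_of_sum_le (fun _ => sq_nonneg _) hfin'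
  rwa [le_div_iff₀ hx, mul_comm] at this

lemma growth_le_exp {h L C : ℝ} (hh : 0 ≤ h) (hL : 0 ≤ L) (hC : 0 ≤ C) :
    (1 + h) * (1 + 2 * h * L) ^ 2 * (1 + C * h) ≤ Real.exp (h * (1 + 4 * L + C)) := by
  have e : Real.exp (h * (1 + 4 * L + C))
      = Real.exp h * Real.exp (2 * h * L) ^ 2 * Real.exp (C * h) := by
    rw [← Real.exp_nat_mul, ← Real.exp_add, ← Real.exp_add]; congr 1; push_cast; ring
  rw [e]
  have a1 := Real.add_one_le_exp h
  have a2 := Real.add_one_le_exp (2 * h * L)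
  have a3 := Real.add_one_le_exp (C * h)
  rw [add_comm] at a1 a2 a3
  gcongr

lemma gronwall_le {E : ℕ → ℝ} {h B R : ℝ} (hh : 0 ≤ h) (hB : 0 ≤ B) (hR : 0 ≤ R) (h0 : E 0 ≤ 0)
    {m : ℕ} (hE : ∀ n < m, E (n + 1) ≤ Real.exp (h * B) * E n + R) :
    ∀ n ≤ m, E n ≤ n * (Real.exp (n * (h * B)) * R) := by
  intro n
  induction n with
  | zero => intro _; simpa using h0
  | succ n ih =>
    intro hn
    have h1 := hE n (by omega)
    have h2 := mul_le_mul_of_nonneg_left (ih (by omega)) (Real.exp_pos (h * B)).le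
    have e : Real.exp (h * B) * (n * (Real.exp (n * (h * B)) * R))
        = n * (Real.exp ((n + 1 : ℕ) * (h * B)) * R) := by
      rw [show ((n + 1 : ℕ) : ℝ) * (h * B) = h * B + n * (h * B) by push_cast; ring, Real.exp_add]
      ring
    have h3 : R ≤ Real.exp ((n + 1 : ℕ) * (h * B)) * R := by
      have : 1 ≤ Real.exp ((n + 1 : ℕ) * (h * B)) := Real.one_le_exp (by positivity)
      nlinarith
    rw [e] at h2
    push_cast at h1 h2 h3 ⊢
    linarith


/-! ### The error recursion and the final estimate -/

lemma BoundedDerivs.exists_bound {m : ℕ} (hm : 1 ≤ m) {g : ℝ → ℝ} (hg : BoundedDerivs m g) :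
    ∃ K, 0 ≤ K ∧ (∀ k ≤ m, ∀ x, |iteratedDeriv k g x| ≤ K) ∧ (∀ x, |g x| ≤ K) ∧
      ∀ x y, |g x - g y| ≤ K * |x - y| := by
  obtain ⟨hc, K, hK⟩ := hg
  have h0 : ∀ x, |g x| ≤ K := fun x => by simpa using hK 0 (by omega) x
  have hd : Differentiable ℝ g := hc.differentiable (by
    have : (m : WithTop ℕ∞) ≠ 0 := by exact_mod_cast (by omega : m ≠ 0)
    exact this)
  refine ⟨K, (abs_nonneg _).trans (h0 0), hK, h0, fun x y => ?_⟩
  have := convex_univ.norm_image_sub_le_of_norm_deriv_le (f := g) (C := K)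
    (fun z _ => hd z) (fun z _ => by simpa using hK 1 hm z) (Set.mem_univ y) (Set.mem_univ x)
  simpa [Real.norm_eq_abs] using this

lemma BoundedDerivs.hasDerivAt {m : ℕ} {g : ℝ → ℝ} (hg : BoundedDerivs m g) {k : ℕ} (hk : k < m)
    (x : ℝ) : HasDerivAt (iteratedDeriv k g) (iteratedDeriv (k + 1) g x) x := by
  rw [iteratedDeriv_succ]
  exact ((hg.1.differentiable_iteratedDeriv k (by exact_mod_cast hk)) x).hasDerivAt

/-- The equation is assumed for positive times only; continuity of the derivatives up to `t = 0`
extends it to the initial time, where the first step evaluates it. -/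
lemma reactPart_eq {T ν : ℝ} (hT : 0 < T) {u f : ℝ → ℝ} (hf : Continuous f)
    {D : ℕ → ℕ → ℝ → ℝ → ℝ} (hD : IsParabolicJet T D)
    (hpde : ∀ x, ∀ t ∈ Set.Ioc 0 T,
      D 1 0 x t + u x * D 0 1 x t - ν * D 0 2 x t = f (D 0 0 x t)) (x : ℝ) {t : ℝ}
    (ht : t ∈ Set.Icc 0 T) : reactPart ν u D x t = f (D 0 0 x t) := by
  have h1 : ContinuousOn (reactPart ν u D x) (Set.Icc 0 T) :=
    (heatPart_continuousOn_time hD (by norm_num) x).add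
      (continuousOn_const.mul (hD.continuousOn_time (by norm_num) x))
  have h2 : ContinuousOn (fun t => f (D 0 0 x t)) (Set.Icc 0 T) :=
    hf.comp_continuousOn (hD.continuousOn_time (by norm_num) x)
  refine Set.EqOn.of_subset_closure (s := Set.Ioc 0 T) (fun s hs => ?_) h1 h2
    Set.Ioc_subset_Icc_self (by rw [closure_Ioc hT.ne]) ht
  rw [← hpde x s hs]
  simp only [reactPart, heatPart]
  ring

/-- The constant multiplying the step error in the `ℓ²` recursion. -/
def errorConst (M K C : ℝ) : ℝ := 18 * (C * M) + 72 * K ^ 2 * (15 * (jetOrders.card * M))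

lemma error_recursion {q : ℕ} {κ : InterpKind} {ψ : ℝ → ℝ} (hker : IsKernel (q + 1) ψ)
    (hψ : ∀ Δx > 0, ∀ v, (∃ C, ∀ j, |v j| ≤ C) → ∀ s, IsInterpolant κ (q + 1) Δx v s ↔
      ∀ x, s x = kernelInterp ψ Δx v x)
    {T ν U F L M B : ℝ} (hT : 0 < T) (hν : 0 < ν) {u u₁ u₂ f : ℝ → ℝ}
    (hu : ∀ x, HasDerivAt u (u₁ x) x) (hu₁ : ∀ x, HasDerivAt u₁ (u₂ x) x)
    (hub : ∀ x, |u x| ≤ U) (hub₁ : ∀ x, |u₁ x| ≤ U) (hub₂ : ∀ x, |u₂ x| ≤ U)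
    (huL : ∀ x y, |u x - u y| ≤ U * |x - y|) (hfb : ∀ x, |f x| ≤ F) (hL0 : 0 ≤ L)
    (hfL : ∀ x y, |f x - f y| ≤ L * |x - y|)
    {D : ℕ → ℕ → ℝ → ℝ → ℝ} (hD : IsParabolicJet T D)
    (hDx : ∀ k ≤ q, ∀ x, ∀ t ∈ Set.Icc 0 T,
      HasDerivAt (fun y => D 0 k y t) (D 0 (k + 1) x t) x)
    (hDc : ∀ t ∈ Set.Icc 0 T, Continuous fun x => D 0 (q + 1) x t)
    (hDi : ∀ t ∈ Set.Icc 0 T, Integrable (fun x => D 0 (q + 1) x t ^ 2) ∧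
      ∫ x, D 0 (q + 1) x t ^ 2 ≤ M)
    (hM : ∀ a b, 1 ≤ 2 * a + b → 2 * a + b ≤ 7 → ∀ t ∈ Set.Icc 0 T,
      Integrable (fun x => D a b x t ^ 2) ∧ ∫ x, D a b x t ^ 2 ≤ M)
    (hB : ∀ x, ∀ t ∈ Set.Icc 0 T, |D 0 0 x t| ≤ B)
    (hreact : ∀ x, ∀ t ∈ Set.Icc 0 T, reactPart ν u D x t = f (D 0 0 x t)) :
    ∃ C₁ C₂, 0 ≤ C₁ ∧ 0 ≤ C₂ ∧ ∀ (h Δx : ℝ) (c₀ : ℝ → ℝ) (W : ℕ → ℤ → ℝ), 0 < h → h ≤ 1 →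
      h * (2 * U ^ 2 + 12 * ν) ≤ 1 → h * U ≤ 1 / 4 → h * L ≤ 1 → 0 < Δx → Δx ≤ 1 →
      (∃ C, ∀ x, |c₀ x| ≤ C) → IsSchemeSolution κ (q + 1) u f c₀ ν h Δx W →
      ∀ n : ℕ, n * h + h ≤ T → Summable (fun i : ℤ => (D 0 0 (i * Δx) (n * h) - W n i) ^ 2) →
        Summable (fun i : ℤ => (D 0 0 (i * Δx) (n * h + h) - W (n + 1) i) ^ 2) ∧
        Δx * ∑' i : ℤ, (D 0 0 (i * Δx) (n * h + h) - W (n + 1) i) ^ 2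
          ≤ Real.exp (h * (1 + 4 * L + C₁))
              * (Δx * ∑' i : ℤ, (D 0 0 (i * Δx) (n * h) - W n i) ^ 2)
            + 2 / h * (C₂ * (Δx ^ (2 * (q + 1)) + h ^ 6)) := by
  obtain ⟨Cs, hCs, hstab⟩ := hker.stability
  obtain ⟨Ci, hCi, hinterp⟩ := hker.interp_error
  have hU : 0 ≤ U := (abs_nonneg _).trans (hub 0)
  have hM0 : 0 ≤ M := (integral_nonneg fun _ => sq_nonneg _).trans
    (hM 0 1 (by norm_num) (by norm_num) 0 ⟨le_rfl, hT.le⟩).2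
  have hC2 : 0 ≤ errorConst M (truncConst U ν) Ci := by unfold errorConst; positivity
  refine ⟨2 * Cs * U, errorConst M (truncConst U ν) Ci, by positivity, hC2, ?_⟩
  intro h Δx c₀ W hh hh1 hsm hhU hhL hx hx1 hc₀ hW n hn hsum
  obtain ⟨Z, hZ⟩ := exists_feet (ν := ν) huL hh.le hhU
  have hWb := hW.bounded hker hψ hZ hx hh.le hfb hc₀
  have hfoot : ∀ e x, IsFoot u ν h e x (Z e x) := fun e x => (hZ e x _).2 rfl
  set t : ℝ := n * h with ht
  have ht0 : 0 ≤ t := by positivity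
  have htm : t ∈ Set.Icc 0 T := ⟨ht0, by linarith⟩
  have htm' : t + h ∈ Set.Icc 0 T := ⟨by linarith, hn⟩
  have hstep := (isStep_iff hψ hZ hx (hWb n)).1 (hW.2 n)
  set d : ℤ → ℝ := fun i => D 0 0 (i * Δx) t - W n i with hd
  set G : ℤ → ℝ := fun j => D 0 0 (j * Δx) t with hG
  have hdisp : ∀ e (i k : ℤ), |Z e (i * Δx) - Z e (k * Δx) - (i * Δx - k * Δx)|
      ≤ 2 * (h * U) * |(i : ℝ) * Δx - k * Δx| := fun e i k =>
    foot_displacement huL hh.le hhU (hfoot e _) (hfoot e _)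
  have hJ : ∀ e, Summable (fun i : ℤ => kernelInterp ψ Δx d (Z e (i * Δx)) ^ 2) ∧
      ∑' i : ℤ, kernelInterp ψ Δx d (Z e (i * Δx)) ^ 2
        ≤ (1 + Cs * (2 * (h * U))) * ∑' i, d i ^ 2 := by
    intro e
    -- Stability is applied with relative displacement `η = 2 h U`, which is at most `1/2`; the
    -- amplification is then `1 + O(h)`.
    refine hstab (2 * (h * U)) (fun i => Z e (i * Δx) / Δx) d (by positivity) (by linarith)
      (fun i k => ?_) hsum
    have h1 := hdisp e i k
    have e1 : Z e (i * Δx) / Δx - Z e (k * Δx) / Δx - (i - k)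
        = (Z e (i * Δx) - Z e (k * Δx) - (i * Δx - k * Δx)) / Δx := by field_simp
    rw [e1, abs_div, abs_of_pos hx, div_le_iff₀ hx]
    rw [show |(i : ℝ) * Δx - k * Δx| = |(i : ℝ) - k| * Δx by
      rw [← sub_mul, abs_mul, abs_of_pos hx]] at h1
    linarith
  have hρ : ∀ e, Summable (fun i : ℤ => (D 0 0 (Z e (i * Δx)) t
        - kernelInterp ψ Δx G (Z e (i * Δx))) ^ 2) ∧
      Δx * ∑' i : ℤ, (D 0 0 (Z e (i * Δx)) t - kernelInterp ψ Δx G (Z e (i * Δx))) ^ 2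
        ≤ Ci * M * Δx ^ (2 * (q + 1)) := by
    intro e
    have hsep : ∀ i k : ℤ, i < k → Z e (i * Δx) + Δx / 2 ≤ Z e (k * Δx) := by
      intro i k hik
      have h1 := hdisp e k i
      have hki : (i : ℝ) + 1 ≤ k := by exact_mod_cast hik
      have hki' : Δx ≤ k * Δx - i * Δx := by nlinarith
      rw [abs_of_pos (a := (k : ℝ) * Δx - i * Δx) (by linarith)] at h1
      have h2 := (abs_le.1 h1).1
      nlinarith
    obtain ⟨h1, h2⟩ := hinterp Δx (fun i => Z e (i * Δx)) (fun k x => D 0 k x t) hx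
      hsep (fun k hk x => hDx k hk x t htm) (hDc t htm) (hDi t htm).1
      ⟨B, fun x => hB x t htm⟩
    refine ⟨h1, h2.trans ?_⟩
    calc _ ≤ Ci * Δx ^ (2 * (q + 1)) * M := by
          gcongr
          exact (hDi t htm).2
      _ = _ := by ring
  set τ : ℤ → ℝ := fun i => D 0 0 (i * Δx) (t + h) - h / 2 * f (D 0 0 (i * Δx) (t + h))
    - (1 / 6 * (D 0 0 (Z 1 (i * Δx)) t + h / 2 * f (D 0 0 (Z 1 (i * Δx)) t))
      + 1 / 6 * (D 0 0 (Z (-1) (i * Δx)) t + h / 2 * f (D 0 0 (Z (-1) (i * Δx)) t))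
      + 2 / 3 * (D 0 0 (Z 0 (i * Δx)) t + h / 2 * f (D 0 0 (Z 0 (i * Δx)) t))) with hτ
  have hτs := sum_sq_le_of_jetBound hT.le hD hM hh hx hx1 (t := t) (τ := τ) (K := truncConst U ν)
    fun i => by
      have := truncation_le hD hν hu hu₁ hub hub₁ hub₂ hh hh1 hsm ht0 hn
        (continuous_jetBound hT.le hD (i * Δx)) (fun θ hθ y hy a b h1 h6 => abs_le_jetBound hT.le hD
          ⟨ht0.trans hθ.1, hθ.2.trans hn⟩ hy h1 h6) (hfoot 1 _) (hfoot (-1) _) (hfoot 0 _)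
      rw [hreact _ _ htm', hreact _ _ htm, hreact _ _ htm, hreact _ _ htm] at this
      exact this
  obtain ⟨Bn, hBn⟩ := hWb n
  -- At a foot, the exact value differs from the interpolated numerical one by the interpolation
  -- error of the exact solution plus the interpolant of the previous error.
  have hsplit : ∀ z, D 0 0 z t - kernelInterp ψ Δx (W n) z
      = (D 0 0 z t - kernelInterp ψ Δx G z) + kernelInterp ψ Δx d z := by
    intro z
    rw [hd, kernelInterp_sub hker (v := G) (fun j => hB _ t htm) hBn]
    ring
  obtain ⟨s1, s2⟩ := step_error_sum (l := 2 * h * L) hh hh1 (by positivity) hx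
    (d := fun i : ℤ => D 0 0 (i * Δx) (t + h) - W (n + 1) i) (τ := τ)
    (fun i => step_error_le hL0 hfL hh.le hhL (hτ := rfl) (hstep i) (hsplit _) (hsplit _)
      (hsplit _)) (hJ 1) (hJ (-1)) (hJ 0) (hρ 1) (hρ (-1)) (hρ 0) hτs
  refine ⟨s1, s2.trans ?_⟩
  have hE0 : 0 ≤ Δx * ∑' i, d i ^ 2 := mul_nonneg hx.le (tsum_nonneg fun _ => sq_nonneg _)
  refine add_le_add (mul_le_mul_of_nonneg_right ?_ hE0) ?_
  · refine (le_of_eq ?_).trans (growth_le_exp hh.le hL0 (by positivity : 0 ≤ 2 * Cs * U))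
    ring
  · refine mul_le_mul_of_nonneg_left ?_ (by positivity)
    unfold errorConst
    have hX : 0 ≤ Δx ^ (2 * (q + 1)) := by positivity
    have hY : 0 ≤ h ^ 6 := by positivity
    have c1 : 0 ≤ Ci * M := by positivity
    have c2 : 0 ≤ truncConst U ν ^ 2 * (15 * (jetOrders.card * M)) :=
      mul_nonneg (sq_nonneg _) (mul_nonneg (by norm_num) (mul_nonneg (Nat.cast_nonneg _) hM0))
    have a1 := mul_nonneg c1 hY
    have a2 := mul_nonneg c2 hX
    generalize (jetOrders.card : ℝ) = c at a1 a2 ⊢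
    linarith


/-- Starting from zero error, `n` perturbations of size `(2 / h)(Δx^{2p} + h⁶)` sum to at most `(2 T
/ h²)(Δx^{2p} + h⁶)`, up to `C` and the exponential factor. -/
lemma discreteNorm_le_of_recursion {e : ℕ → ℤ → ℝ} {T h Δx B C : ℝ} {p n : ℕ} (hh : 0 < h)
    (hx : 0 < Δx) (hB : 0 ≤ B) (hC : 0 ≤ C) (hn : n * h ≤ T) (h0 : ∀ i, e 0 i = 0)
    (hrec : ∀ k < n, Summable (fun i => e k i ^ 2) → Summable (fun i => e (k + 1) i ^ 2) ∧
      Δx * ∑' i, e (k + 1) i ^ 2 ≤ Real.exp (h * B) * (Δx * ∑' i, e k i ^ 2)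
        + 2 / h * (C * (Δx ^ (2 * p) + h ^ 6))) :
    Summable (fun i => e n i ^ 2) ∧
      discreteNorm Δx (e n) ≤ (2 * T * Real.exp (T * B) * C + 1) * (h ^ 2 + Δx ^ p / h) := by
  have hsum : ∀ k ≤ n, Summable fun i => e k i ^ 2 := by
    intro k
    induction k with
    | zero => intro _; simp [h0, summable_zero]
    | succ k ih => exact fun hk => (hrec k (by omega) (ih (by omega))).1
  refine ⟨hsum n le_rfl, ?_⟩
  have hT : 0 ≤ T := le_trans (by positivity) hn
  set R := 2 / h * (C * (Δx ^ (2 * p) + h ^ 6)) with hR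
  have hE := gronwall_le (E := fun k => Δx * ∑' i, e k i ^ 2) hh.le hB (R := R)
    (by positivity) (by simp [h0]) (fun k hk => (hrec k hk (hsum k hk.le)).2) n le_rfl
  set Q := 2 * T * Real.exp (T * B) * C with hQ
  have hQ0 : 0 ≤ Q := by positivity
  have h1 : Δx * ∑' i, e n i ^ 2 ≤ Q * ((h ^ 2) ^ 2 + (Δx ^ p / h) ^ 2) := by
    have hexp : Real.exp (n * (h * B)) ≤ Real.exp (T * B) := by
      rw [← mul_assoc]; gcongr
    calc _ ≤ n * (Real.exp (n * (h * B)) * R) := hE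
      _ ≤ n * (Real.exp (T * B) * R) := by gcongr
      _ = (n * h) * (2 * Real.exp (T * B) * C * ((h ^ 2) ^ 2 + (Δx ^ p / h) ^ 2)) := by
          rw [hR]; field_simp; ring
      _ ≤ T * (2 * Real.exp (T * B) * C * ((h ^ 2) ^ 2 + (Δx ^ p / h) ^ 2)) := by gcongr
      _ = _ := by rw [hQ]; ring
  have hX : 0 ≤ h ^ 2 := by positivity
  have hY : 0 ≤ Δx ^ p / h := by positivity
  refine Real.sqrt_le_iff.2 ⟨by positivity, h1.trans ?_⟩
  generalize h ^ 2 = X at hX ⊢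
  generalize Δx ^ p / h = Y at hY ⊢
  rw [mul_pow]
  -- Uses `Q ≤ (Q + 1)²` and `X² + Y² ≤ (X + Y)²`; taking `Q + 1` avoids a square root and keeps the
  -- constant positive.
  refine mul_le_mul ?_ ?_ (by positivity) (by positivity) <;> nlinarith [mul_nonneg hX hY]

lemma exists_step_bounds {U L ν : ℝ} (hU : 0 ≤ U) (hL : 0 ≤ L) (hν : 0 < ν) :
    ∃ δ, 0 < δ ∧ δ ≤ 1 ∧ ∀ h, 0 < h → h < δ →
      h * (2 * U ^ 2 + 12 * ν) ≤ 1 ∧ h * U ≤ 1 / 4 ∧ h * L ≤ 1 := by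
  obtain ⟨h₀, hpos, hle, hs⟩ := exists_small_step U hν
  -- The summands `+ 1` keep the denominators positive when `U` or `L` is zero.
  refine ⟨min h₀ (min (1 / (4 * (U + 1))) (1 / (L + 1))), by positivity,
    (min_le_left _ _).trans hle, fun h hh hδ => ⟨hs h hh (hδ.le.trans (min_le_left _ _)), ?_, ?_⟩⟩
  · have := hδ.le.trans ((min_le_right _ _).trans (min_le_left _ _))
    rw [le_div_iff₀ (by positivity)] at this
    linarith
  · have := hδ.le.trans ((min_le_right _ _).trans (min_le_right _ _))
    rw [le_div_iff₀ (by positivity)] at this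
    linarith

end SL2

end

theorem mainTheorem1 (κ : SL2.InterpKind) (p : ℕ) (hp : Odd p)
    (ν T : ℝ) (hν : 0 < ν) (hT : 0 < T)
    (u f c₀ : ℝ → ℝ) (hf : SL2.BoundedDerivs 4 f) (hu : SL2.BoundedDerivs 2 u)
    (c : ℝ → ℝ → ℝ) (hc : SL2.IsRegularSolution p u f c₀ ν T c) :
    ∃ K > 0, ∃ δ > 0, ∀ Δt Δx : ℝ, 0 < Δt → Δt < δ → 0 < Δx → Δx < δ →
      (∃! U : ℕ → ℤ → ℝ, SL2.IsSchemeSolution κ p u f c₀ ν Δt Δx U) ∧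
      ∀ U : ℕ → ℤ → ℝ, SL2.IsSchemeSolution κ p u f c₀ ν Δt Δx U →
        ∀ n : ℕ, (n : ℝ) * Δt ≤ T →
          Summable (fun i : ℤ => (c ((i : ℝ) * Δx) ((n : ℝ) * Δt) - U n i) ^ 2) ∧
          SL2.discreteNorm Δx (fun i : ℤ => c ((i : ℝ) * Δx) ((n : ℝ) * Δt) - U n i)
            ≤ K * (Δt ^ 2 + Δx ^ p / Δt) := by
  obtain ⟨ψ, hker, hψ⟩ := SL2.exists_kernel κ hp
  obtain ⟨F, hF0, -, hFb, hFL⟩ := hf.exists_bound (by norm_num)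
  obtain ⟨A, hA0, hAk, hAb, hAL⟩ := hu.exists_bound (by norm_num)
  obtain ⟨D, M, hDc, hDx, hDt, hDcont, hcb, hDi, hpde, hinit⟩ := hc
  -- Interpolation errors are measured with Taylor polynomials of degree `q = p - 1` and the `p`-th
  -- derivative in `L²`, which gives the power `Δx^p`.
  obtain ⟨q, rfl⟩ : ∃ q, p = q + 1 := ⟨p - 1, by have := hp.pos; omega⟩
  have hjet : SL2.IsParabolicJet T D :=
    { dx := fun a b hab => hDx a b (Or.inl (by omega))
      dt := fun a b hab => hDt a b (Or.inl (by omega))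
      cont := fun a b hab => hDcont a b (Or.inl hab) }
  have hfc : Continuous f := hf.1.continuous
  have h0T : (0 : ℝ) ∈ Set.Icc 0 T := ⟨le_rfl, hT.le⟩
  have hcb' : ∀ x, ∀ t ∈ Set.Icc 0 T, |D 0 0 x t| ≤ M := fun x t ht => by
    rw [hDc x t ht]; exact hcb x t ht
  have hu₀ : ∀ x, HasDerivAt u (iteratedDeriv 1 u x) x := fun x => by
    simpa using hu.hasDerivAt (k := 0) (by norm_num) x
  obtain ⟨C₁, C₂, hC₁, hC₂, hrec⟩ := SL2.error_recursion hker hψ hT hν hu₀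
    (fun x => hu.hasDerivAt (k := 1) (by norm_num) x) hAb (hAk 1 (by norm_num))
    (hAk 2 le_rfl) hAL hFb hF0 hFL hjet
    (fun k hk => hDx 0 k (Or.inr ⟨rfl, by omega⟩))
    (fun t ht => (hDcont 0 (q + 1) (Or.inr ⟨rfl, by omega⟩)).comp_continuous
      (f := fun x : ℝ => ((x, t) : ℝ × ℝ)) (by fun_prop) fun _ => ⟨Set.mem_univ _, ht⟩)
    (hDi 0 (q + 1) (Or.inr ⟨rfl, by omega⟩) (by simp))
    (fun a b h1 h7 => hDi a b (Or.inl h7) (by rintro ⟨⟩; omega)) hcb'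
    (fun x t ht => SL2.reactPart_eq hT hfc hjet
      (fun x t ht => by
        rw [hDc x t (Set.Ioc_subset_Icc_self ht)]; exact hpde x t ht) x ht)
  obtain ⟨δ, hδ, hδ1, hsmall⟩ := SL2.exists_step_bounds hA0 hF0 hν
  have hc₀ : ∃ C, ∀ x, |c₀ x| ≤ C := ⟨M, fun x => by rw [← hinit x]; exact hcb x 0 h0T⟩
  refine ⟨2 * T * Real.exp (T * (1 + 4 * F + C₁)) * C₂ + 1, by positivity, δ, hδ,
    fun h Δx hh hhδ hx hxδ => ?_⟩
  obtain ⟨hs1, hs2, hs3⟩ := hsmall h hh hhδ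
  obtain ⟨Z, hZ⟩ := SL2.exists_feet (ν := ν) hAL hh.le hs2
  refine ⟨SL2.existsUnique_schemeSolution hker hψ hZ hx hh.le hFb hFL hs3 hc₀,
    fun W hW n hn => ?_⟩
  have htime : ∀ k ≤ n, (k : ℝ) * h ∈ Set.Icc 0 T := fun k hk =>
    ⟨by positivity, le_trans (by gcongr) hn⟩
  have hmain := SL2.discreteNorm_le_of_recursion (p := q + 1) (n := n) (T := T)
    (e := fun k (i : ℤ) => D 0 0 (i * Δx) (k * h) - W k i) hh hx
    (by positivity : 0 ≤ 1 + 4 * F + C₁) hC₂ hn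
    (fun i => by
      simp only [Nat.cast_zero, zero_mul]
      rw [hDc _ _ h0T, hinit, hW.1, sub_self])
    (fun k hk hsum => by
      have e : ((k + 1 : ℕ) : ℝ) * h = k * h + h := by push_cast; ring
      have hk1 := (htime (k + 1) hk).2
      simp only [e] at hk1 ⊢
      exact hrec h Δx c₀ W hh (hhδ.le.trans hδ1) hs1 hs2 hs3 hx (hxδ.le.trans hδ1) hc₀ hW k hk1 hsum)
  simp only [hDc _ _ (htime n le_rfl)] at hmain
  exact hmain
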